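/- Let $V$ be a finite-dimensional complex vector space, $W\subset GL(V)$ a finite subgroup, $\Gamma\subset V$ a $W$-invariant lattice, and $X=V/\Gamma$ the corresponding complex torus. A nontrivial semisimple element of $GL(V)$ is a reflection if its fixed subspace is a hyperplane. A reflection hypertorus is a connected component $H$ of the fixed point set $X^g$ of a reflection $g\in W$ (necessarily of codimension $1$). Let $W_H\subset W$ be the stabilizer of a generic point of $H$ (equivalently, the pointwise stabilizer of $H$), $n_H=|W_H|$, and let $g_H\in W_H$ be the generator with determinant $e^{2\pi i/n_H}$. Let $S$ be the finite set of pairs $(H,j)$ with $H$ a reflection hypertorus and $1\le j\le n_H-1$; the group $W$ acts on it by $w(H,j)=(wH,j)$. Let $V_H^*\subset V^*$ be the line of linear forms vanishing on $V^{g_H}$. For a holomorphic line bundle $L$ on $X$ and $w\in W$, let $L^w$ be the line bundle with fibers $(L^w)_x=L_{w^{-1}x}$, so that $(ws)(x)=s(w^{-1}x)$ defines a map $w$ from sections of $L$ to sections of $L^w$. Fix a topologically trivial holomorphic line bundle $L$ on $X$ such that $L^w\not\cong L$ for all $1\ne w\in W$, a flat holomorphic connection $\nabla$ on $L$, and a $W$-invariant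 function $C:S\to\mathbb C$. Then for every $(H,j)\in S$ there is a unique meromorphic section $f_{H,j}^L$ of $(L^{g_H^j})^*\otimes L\otimes V_H^*$ on $X$ which has a simple pole on $H$ and no other singularities, and whose Poincaré residue on $H$ is $1$. (Here $V_H^*\subset V^*=T_x^*X$, and $(L^{g_H^j})^*\otimes L$ is canonically trivial on $H$ because $g_H^j$ fixes every point of $H$.) Moreover, the elliptic Dunkl operators $$D_v=\nabla_v-\sum_{(H,j)\in S}C(H,j)\,\langle f_{H,j}^L,v\rangle\, g_H^j,\qquad v\in V,$$ acting on the meromorphic sections of $L$ over any $W$-invariant open subset of $X$, commute: $[D_v,D_u]=0$ for all $v,u\in V$. -/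

import Mathlib

open scoped Topology Pointwise

set_option linter.unusedSectionVars false

namespace EllipticDunkl

/-- The data of a finite group `W ⊂ GL(V)` preserving a lattice `Γ ⊂ V` (a discrete subgroup which
spans `V` over `ℝ`), where `V` is a finite dimensional complex vector space. -/
structure TorusAction (V : Type*) [NormedAddCommGroup V] [NormedSpace ℂ V] where
  Γ : Submodule ℤ V
  discrete : DiscreteTopology Γ
  lattice : IsZLattice ℝ Γ
  W : Subgroup (V ≃ₗ[ℂ] V)
  finite : Finite W
  map_mem : ∀ w ∈ W, ∀ γ ∈ Γ, w γ ∈ Γ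

/-- A (complex) reflection: a nontrivial semisimple element of `GL(V)` whose fixed space is a
hyperplane. -/
structure IsReflection {V : Type*} [NormedAddCommGroup V] [NormedSpace ℂ V]
    (g : V ≃ₗ[ℂ] V) : Prop where
  ne_one : g ≠ 1
  semisimple : Module.End.IsSemisimple (g : V →ₗ[ℂ] V)
  finrank_fixed : Module.finrank ℂ (LinearMap.ker ((g : V →ₗ[ℂ] V) - LinearMap.id)) + 1
    = Module.finrank ℂ V

namespace TorusAction

variable {V : Type*} [NormedAddCommGroup V] [NormedSpace ℂ V] (T : TorusAction V)

instance : DiscreteTopology T.Γ := T.discrete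
instance : IsZLattice ℝ T.Γ := T.lattice
instance : Finite T.W := T.finite

/-- The complex torus `X = V/Γ`, with its quotient topology. -/
abbrev X : Type _ := V ⧸ T.Γ

/-- The projection `V → X`. -/
abbrev proj (z : V) : T.X := Submodule.Quotient.mk z

/-- The action of `W` on `Γ`. -/
def latticeAct (w : T.W) (γ : T.Γ) : T.Γ := ⟨w.1 γ.1, T.map_mem w.1 w.2 γ.1 γ.2⟩

/-- The action of `W` on `X` induced by the linear action on `V`. -/
instance : MulAction T.W T.X where
  smul w := T.Γ.mapQ T.Γ ((w.1 : V →ₗ[ℂ] V).restrictScalars ℤ) (fun γ hγ => T.map_mem w.1 w.2 γ hγ)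
  one_smul x := by
    induction x using Submodule.Quotient.induction_on with
    | H z => rfl
  mul_smul a b x := by
    induction x using Submodule.Quotient.induction_on with
    | H z => rfl

theorem smul_proj (w : T.W) (z : V) : w • T.proj z = T.proj (w.1 z) := rfl

theorem proj_add (z : V) (γ : T.Γ) : T.proj (z + γ) = T.proj z :=
  (Submodule.Quotient.eq _).2 (by simp)

/-- A reflection hypertorus: a connected component (of codimension one) of the fixed point set
`X^g` of a reflection `g ∈ W`.  As `X^g` is locally a translate of the hyperplane `V^g`, all its
components have codimension one. -/
def IsHypertorus (H : Set T.X) : Prop :=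
  ∃ g : T.W, IsReflection g.1 ∧ ∃ x ∈ MulAction.fixedBy T.X g,
    H = connectedComponentIn (MulAction.fixedBy T.X g) x

/-- The stabilizer `W_H` of a generic point of `H`, i.e. the pointwise stabilizer of `H`. -/
abbrev WH (H : Set T.X) : Subgroup T.W := fixingSubgroup T.W H

/-- The order of `W_H`. -/
noncomputable def nH (H : Set T.X) : ℕ := Nat.card (T.WH H)

/-- The set of pairs `(H, j)`, where `H` is a reflection hypertorus and `1 ≤ j ≤ n_H - 1`. -/
structure Pairs where
  H : Set T.X
  isHypertorus : T.IsHypertorus H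
  j : ℕ
  one_le : 1 ≤ j
  lt : j < T.nH H

theorem Pairs.ext' {T : TorusAction V} {p q : T.Pairs} (h : p.H = q.H) (h' : p.j = q.j) :
    p = q := by
  cases p; cases q; cases h; cases h'; rfl

theorem eventually_eq_zero_of_mem : ∀ᶠ z in 𝓝 (0 : V), z ∈ T.Γ → z = 0 := by
  obtain ⟨U, hU, h⟩ := (discreteTopology_subtype_iff'.1 T.discrete) 0 T.Γ.zero_mem
  have h0 : (0 : V) ∈ U ∩ (T.Γ : Set V) := by
    have := Set.mem_singleton (0 : V)
    rwa [← h] at this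
  filter_upwards [hU.mem_nhds h0.1] with z hz hzΓ
  have : z ∈ U ∩ (T.Γ : Set V) := ⟨hz, hzΓ⟩
  rw [h] at this
  exact this

theorem continuous_proj : Continuous T.proj := continuous_quot_mk

theorem proj_eq_iff (x y : V) : T.proj x = T.proj y ↔ x - y ∈ T.Γ := Submodule.Quotient.eq _

theorem mem_fixedBy_proj (g : T.W) (z : V) :
    T.proj z ∈ MulAction.fixedBy T.X g ↔ g.1 z - z ∈ T.Γ := by
  rw [MulAction.mem_fixedBy, smul_proj, proj_eq_iff]

theorem nH_le (H : Set T.X) : T.nH H ≤ Nat.card T.W := Subgroup.card_le_card_group _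

section finite
variable [FiniteDimensional ℂ V]

theorem continuous_lin (w : V ≃ₗ[ℂ] V) : Continuous w :=
  (w : V →ₗ[ℂ] V).continuous_of_finiteDimensional

/-- Translates by `V^g` stay in the same component of `X^g`. -/
theorem proj_mem_component (g : T.W) (z v : V) (hz : T.proj z ∈ MulAction.fixedBy T.X g)
    (hv : g.1 v = v) :
    T.proj (z + v) ∈ connectedComponentIn (MulAction.fixedBy T.X g) (T.proj z) := by
  let p : ℝ → T.X := fun t => T.proj (z + t • v)
  have hp : Continuous p := T.continuous_proj.comp (by fun_prop)
  have hpre : IsPreconnected (Set.range p) := isPreconnected_range hp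
  have hsub : Set.range p ⊆ MulAction.fixedBy T.X g := by
    rintro _ ⟨t, rfl⟩
    rw [mem_fixedBy_proj] at hz ⊢
    have : g.1 (t • v) = t • v := by
      rw [← Complex.coe_smul, map_smul, hv]
    rw [map_add, this]
    simpa using hz
  exact hpre.subset_connectedComponentIn ⟨0, by simp [p]⟩ hsub ⟨1, by simp [p]⟩

theorem compactSpace_X : CompactSpace T.X := by
  have : FiniteDimensional ℝ V := FiniteDimensional.complexToReal V
  have := IsZLattice.isCompact_range_of_periodic T.Γ T.proj T.continuous_proj
    (fun z w hw => T.proj_add z ⟨w, hw⟩)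
  rw [Set.range_eq_univ.2 (Submodule.Quotient.mk_surjective _)] at this
  exact ⟨this⟩

theorem isClosed_fixedBy (g : T.W) : IsClosed (MulAction.fixedBy T.X g) := by
  have : DiscreteTopology T.Γ.toAddSubgroup := T.discrete
  have : IsClosed (T.Γ : Set V) :=
    AddSubgroup.isClosed_of_discrete (H := T.Γ.toAddSubgroup)
  have hc : Continuous fun x : T.X => g • x := by
    refine continuous_quot_lift _ ?_
    exact T.continuous_proj.comp (continuous_lin g.1)
  exact isClosed_eq hc continuous_id

theorem finite_components (g : T.W) :
    {H : Set T.X | ∃ x ∈ MulAction.fixedBy T.X g,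
      H = connectedComponentIn (MulAction.fixedBy T.X g) x}.Finite := by
  have := T.compactSpace_X
  have hloc : ∀ x ∈ MulAction.fixedBy T.X g, ∃ O ∈ 𝓝 x, O ∩ MulAction.fixedBy T.X g ⊆
      connectedComponentIn (MulAction.fixedBy T.X g) x := by
    intro x
    induction x using Submodule.Quotient.induction_on with
    | H z =>
      intro hz
      have hc : Continuous fun y : V => (g.1 (y - z) - (y - z)) :=
        ((continuous_lin g.1).comp (by fun_prop)).sub (by fun_prop)
      have h1 : ∀ᶠ y in 𝓝 z, (g.1 (y - z) - (y - z)) ∈ T.Γ → g.1 (y - z) - (y - z) = 0 := by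
        have := hc.tendsto z
        simp only [sub_self, map_zero] at this
        exact this.eventually T.eventually_eq_zero_of_mem
      refine ⟨T.proj '' {y | (g.1 (y - z) - (y - z)) ∈ T.Γ → g.1 (y - z) - (y - z) = 0},
        T.Γ.isOpenMap_mkQ.image_mem_nhds h1, ?_⟩
      rintro _ ⟨⟨y, hy, rfl⟩, hy'⟩
      have hz' := (T.mem_fixedBy_proj g z).1 hz
      rw [mem_fixedBy_proj] at hy'
      have h2 : g.1 (y - z) - (y - z) ∈ T.Γ := by
        have := T.Γ.sub_mem hy' hz'
        rw [map_sub]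
        convert this using 1
        abel
      have := T.proj_mem_component g z (y - z) hz (sub_eq_zero.1 (hy h2))
      simpa using this
  choose! O hO hO' using hloc
  obtain ⟨t, ht, hcov⟩ := (T.isClosed_fixedBy g).isCompact.elim_nhds_subcover O hO
  refine (t.finite_toSet.image fun x => connectedComponentIn (MulAction.fixedBy T.X g) x).subset ?_
  rintro _ ⟨x, hx, rfl⟩
  obtain ⟨y, hy, hxy⟩ := Set.mem_iUnion₂.1 (hcov hx)
  exact ⟨y, hy, connectedComponentIn_eq (hO' y (ht y hy) ⟨hxy, hx⟩)⟩

/-- The set of pairs `(H, j)` is finite. -/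
instance : Finite T.Pairs := by
  have h1 : {H : Set T.X | T.IsHypertorus H}.Finite := by
    refine (Set.finite_iUnion fun g : T.W => T.finite_components g).subset ?_
    rintro H ⟨g, -, x, hx, h⟩
    exact Set.mem_iUnion.2 ⟨g, x, hx, h⟩
  have := h1.to_subtype
  refine Finite.of_injective
    (fun p : T.Pairs => ((⟨p.H, p.isHypertorus⟩ : {H : Set T.X | T.IsHypertorus H}),
      (⟨p.j, p.lt.trans_le (T.nH_le _)⟩ : Fin (Nat.card T.W)))) ?_
  intro p q h
  simp only [Prod.mk.injEq, Subtype.mk.injEq, Fin.mk.injEq] at h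
  exact Pairs.ext' h.1 h.2

/-- Elements of `W_H` fix the direction hyperplane of `H` pointwise. -/
theorem fixes_of_mem_WH (g : T.W) (x : T.X) (hx : x ∈ MulAction.fixedBy T.X g) (w : T.W)
    (hw : w ∈ T.WH (connectedComponentIn (MulAction.fixedBy T.X g) x)) (v : V)
    (hv : g.1 v = v) : w.1 v = v := by
  induction x using Submodule.Quotient.induction_on with
  | H z =>
    have key : ∀ t : ℝ, t • (w.1 v - v) ∈ T.Γ := by
      intro t
      have hg : g.1 (t • v) = t • v := by rw [← Complex.coe_smul, map_smul, hv]
      have hw' : w.1 (t • v) = t • w.1 v := by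
        rw [← Complex.coe_smul, map_smul, Complex.coe_smul]
      have h1 := (mem_fixingSubgroup_iff _).1 hw _ (T.proj_mem_component g z (t • v) hx hg)
      have h0 := (mem_fixingSubgroup_iff _).1 hw _ (mem_connectedComponentIn hx)
      rw [smul_proj, proj_eq_iff] at h1
      erw [smul_proj, proj_eq_iff] at h0
      have := T.Γ.sub_mem h1 h0
      rw [map_add, hw'] at this
      rw [smul_sub]
      convert this using 1
      abel
    have hlim : Filter.Tendsto (fun t : ℝ => t • (w.1 v - v)) (𝓝 0) (𝓝 0) := by
      have : Continuous fun t : ℝ => t • (w.1 v - v) := by fun_prop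
      simpa using this.tendsto 0
    have := (hlim.eventually T.eventually_eq_zero_of_mem).filter_mono
      (nhdsWithin_le_nhds (s := {0}ᶜ))
    obtain ⟨t, ht, ht0⟩ := (this.and self_mem_nhdsWithin).exists
    have := ht (key t)
    rcases smul_eq_zero.1 this with h | h
    · exact absurd h ht0
    · exact sub_eq_zero.1 h

/-- An element of finite order and determinant one fixing a hyperplane pointwise is trivial. -/
theorem eq_one_of_det (g : V ≃ₗ[ℂ] V) (hg : IsReflection g) (w : V ≃ₗ[ℂ] V)
    (hfix : ∀ v, g v = v → w v = v) (hdet : LinearMap.det (w : V →ₗ[ℂ] V) = 1)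
    (hfin : IsOfFinOrder w) : w = 1 := by
  set K := LinearMap.ker ((g : V →ₗ[ℂ] V) - LinearMap.id) with hK
  have hmem : ∀ v, v ∈ K ↔ g v = v := fun v => by
    simp [hK, LinearMap.mem_ker, sub_eq_zero]
  have hKne : K ≠ ⊤ := by
    intro h
    have := hg.finrank_fixed
    rw [← hK, h, finrank_top] at this
    omega
  obtain ⟨e, he⟩ : ∃ e, e ∉ K := by
    by_contra! h
    exact hKne ((Submodule.eq_top_iff').2 h)
  obtain ⟨φ, hφe, hφK⟩ := Submodule.exists_dual_map_eq_bot_of_notMem he inferInstance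
  have hφ0 : ∀ v ∈ K, φ v = 0 := fun v hv => by
    have : φ v ∈ K.map φ := ⟨v, hv, rfl⟩
    rw [hφK] at this
    exact this
  set k := w e - e with hk
  have hdec : ∀ v, v - (φ v / φ e) • e ∈ K := by
    have hle : K ≤ LinearMap.ker φ := fun v hv => hφ0 v hv
    have hfr : Module.finrank ℂ (LinearMap.ker φ) + 1 = Module.finrank ℂ V :=
      Module.Dual.finrank_ker_add_one_of_ne_zero (fun h => hφe (by simp [h]))
    have heq : K = LinearMap.ker φ := Submodule.eq_of_le_of_finrank_eq hle (by
      have := hg.finrank_fixed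
      rw [← hK] at this
      omega)
    intro v
    rw [heq, LinearMap.mem_ker]
    simp [hφe]
  have hw : ∀ v, w v = v + φ v • ((φ e)⁻¹ • k) := by
    intro v
    have h1 := hfix _ ((hmem _).1 (hdec v))
    rw [map_sub, map_smul] at h1
    rw [sub_eq_iff_eq_add.1 h1, hk, smul_smul, smul_sub, div_eq_mul_inv]
    abel
  have hwt : (w : V →ₗ[ℂ] V) = LinearMap.transvection φ ((φ e)⁻¹ • k) := by
    ext v
    simpa [LinearMap.transvection.apply] using hw v
  have hφk : φ k = 0 := by
    rw [hwt, LinearMap.transvection.det] at hdet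
    simpa [hφe] using hdet
  have hpow : ∀ n : ℕ, (w ^ n) e = e + n • k := by
    have hwk : w k = k := by rw [hw k, hφk]; simp
    intro n
    induction n with
    | zero => simp
    | succ n ih =>
      rw [pow_succ', LinearEquiv.mul_apply, ih, map_add, map_nsmul, hwk, succ_nsmul]
      rw [show w e = e + k by rw [hk]; abel]
      abel
  obtain ⟨n, hn, hwn⟩ := isOfFinOrder_iff_pow_eq_one.1 hfin
  have := hpow n
  rw [hwn] at this
  have hk0 : k = 0 := by
    have h : n • k = 0 := by simpa using this.symm
    rw [← Nat.cast_smul_eq_nsmul ℂ] at h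
    rcases smul_eq_zero.1 h with h | h
    · exact absurd h (by exact_mod_cast hn.ne')
    · exact h
  ext v
  rw [hw v, hk0]
  simp

/-- `W_H` contains exactly one element with determinant `exp (2πi / n_H)`. -/
theorem existsUnique_gen {H : Set T.X} (hH : T.IsHypertorus H) :
    ∃! g : T.W, g ∈ T.WH H ∧
      LinearMap.det (g.1 : V →ₗ[ℂ] V) = Complex.exp (2 * Real.pi * Complex.I / T.nH H) := by
  obtain ⟨g, hg, x, hx, rfl⟩ := hH
  set H := connectedComponentIn (MulAction.fixedBy T.X g) x with hHdef
  let d : T.WH H →* ℂˣ := LinearEquiv.det.comp (T.W.subtype.comp (T.WH H).subtype)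
  have hdval : ∀ w : T.WH H, ((d w : ℂˣ) : ℂ) = LinearMap.det (w.1.1 : V →ₗ[ℂ] V) := fun w =>
    LinearEquiv.coe_det _
  have hinj : Function.Injective d := by
    rw [injective_iff_map_eq_one]
    intro w hw
    have h1 : LinearMap.det (w.1.1 : V →ₗ[ℂ] V) = 1 := by rw [← hdval, hw]; rfl
    have h2 : w.1.1 = 1 := eq_one_of_det g.1 hg w.1.1
      (fun v hv => T.fixes_of_mem_WH g x hx w.1 w.2 v hv) h1
      ((T.W.subtype).isOfFinOrder (isOfFinOrder_of_finite w.1))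
    exact Subtype.ext (Subtype.ext h2)
  have : NeZero (T.nH H) := ⟨Nat.card_pos.ne'⟩
  have hle : d.range ≤ rootsOfUnity (T.nH H) ℂ := by
    rintro _ ⟨w, rfl⟩
    rw [mem_rootsOfUnity, ← map_pow, nH, pow_card_eq_one', map_one]
  have hcard : Nat.card (rootsOfUnity (T.nH H) ℂ) ≤ Nat.card d.range := by
    rw [Complex.card_rootsOfUnity, ← Nat.card_congr (MonoidHom.ofInjective hinj).toEquiv]
    rfl
  have heq : d.range = rootsOfUnity (T.nH H) ℂ := Subgroup.eq_of_le_of_card_ge hle hcard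
  have hζ := Complex.isPrimitiveRoot_exp (T.nH H) (NeZero.ne _)
  have hmem : (hζ.isUnit (NeZero.ne _)).unit ∈ d.range := by
    rw [heq, mem_rootsOfUnity]
    ext
    simpa using hζ.pow_eq_one
  obtain ⟨w, hw⟩ := hmem
  refine ⟨w.1, ⟨w.2, ?_⟩, ?_⟩
  · rw [← hdval, hw]; rfl
  · rintro y ⟨hy, hy'⟩
    have : (⟨y, hy⟩ : T.WH H) = w := hinj (by
      rw [hw]; ext; rw [hdval, hy']; rfl)
    rw [← this]

/-- The generator `g_H` of the cyclic group `W_H`: its element with determinant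
`exp (2πi / n_H)`. -/
noncomputable def gen {H : Set T.X} (hH : T.IsHypertorus H) : T.W :=
  (T.existsUnique_gen hH).choose

end finite

/-! ### Holomorphic line bundles -/

/-- A holomorphic line bundle on `X`, given by a factor of automorphy `χ`: it is the quotient of
`V × ℂ` by the action `γ : (z, ξ) ↦ (z + γ, χ(γ, z) ξ)` of `Γ`. -/
structure LineBundle where
  χ : T.Γ → V → ℂ
  analytic : ∀ γ, AnalyticOnNhd ℂ (χ γ) Set.univ
  ne_zero : ∀ γ z, χ γ z ≠ 0
  cocycle : ∀ γ₁ γ₂ z, χ (γ₁ + γ₂) z = χ γ₁ (z + γ₂) * χ γ₂ z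

end TorusAction

namespace TorusAction.LineBundle

open TorusAction

variable {V : Type*} [NormedAddCommGroup V] [NormedSpace ℂ V] [FiniteDimensional ℂ V]
  {T : TorusAction V}

theorem analytic_lin (w : V ≃ₗ[ℂ] V) : AnalyticOnNhd ℂ w Set.univ :=
  (w.toContinuousLinearEquiv : V →L[ℂ] V).analyticOnNhd _

/-- The line bundle `L^w`, whose fiber at `x` is the fiber of `L` at `w⁻¹ x`. -/
def twist (L : T.LineBundle) (w : T.W) : T.LineBundle where
  χ γ z := L.χ (T.latticeAct w⁻¹ γ) ((w⁻¹).1 z)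
  analytic γ := (L.analytic _).comp (analytic_lin _) (Set.mapsTo_univ _ _)
  ne_zero γ z := L.ne_zero _ _
  cocycle γ₁ γ₂ z := by
    have h : T.latticeAct w⁻¹ (γ₁ + γ₂) = T.latticeAct w⁻¹ γ₁ + T.latticeAct w⁻¹ γ₂ :=
      Subtype.ext (map_add _ _ _)
    rw [h, L.cocycle, map_add]
    rfl

/-- The line bundle `M^* ⊗ L`. -/
noncomputable def homBundle (M L : T.LineBundle) : T.LineBundle where
  χ γ z := (M.χ γ z)⁻¹ * L.χ γ z
  analytic γ := ((M.analytic γ).inv fun z _ => M.ne_zero γ z).mul (L.analytic γ)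
  ne_zero γ z := mul_ne_zero (inv_ne_zero (M.ne_zero γ z)) (L.ne_zero γ z)
  cocycle γ₁ γ₂ z := by
    rw [M.cocycle, L.cocycle, mul_inv]
    ring

/-- `L` is topologically trivial: it has a continuous nowhere vanishing global section. -/
def IsTopologicallyTrivial (L : T.LineBundle) : Prop :=
  ∃ s : V → ℂ, Continuous s ∧ (∀ z, s z ≠ 0) ∧ ∀ (γ : T.Γ) (z : V), s (z + γ) = L.χ γ z * s z

/-- `L` is holomorphically trivial: it has a holomorphic nowhere vanishing global section. -/
def IsHolomorphicallyTrivial (L : T.LineBundle) : Prop :=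
  ∃ s : V → ℂ, AnalyticOnNhd ℂ s Set.univ ∧ (∀ z, s z ≠ 0) ∧
    ∀ (γ : T.Γ) (z : V), s (z + γ) = L.χ γ z * s z

/-- `L` has trivial stabilizer in `W`: for `w ≠ 1`, the line bundle `L^w` is not isomorphic
to `L`, that is, `(L^w)^* ⊗ L` is not holomorphically trivial. -/
def HasTrivialStabilizer (L : T.LineBundle) : Prop :=
  ∀ w : T.W, w ≠ 1 → ¬ ((L.twist w).homBundle L).IsHolomorphicallyTrivial

/-- A flat holomorphic connection `∇ = d + a` on `L`.  The form `a` is a holomorphic one-form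
on `V`; the condition `transform` says that `∇` maps sections of `L` to sections of `L`,
and `flat` that the curvature `da` vanishes. -/
structure FlatConnection (L : T.LineBundle) where
  form : V → (V →L[ℂ] ℂ)
  analytic : AnalyticOnNhd ℂ form Set.univ
  transform : ∀ (γ : T.Γ) (z v : V),
    fderiv ℂ (L.χ γ) z v + L.χ γ z * form (z + γ) v = L.χ γ z * form z v
  flat : ∀ z u v : V, fderiv ℂ form z u v = fderiv ℂ form z v u

end TorusAction.LineBundle

/-! ### Meromorphic functions -/

section meromorphic

variable {V : Type*} [NormedAddCommGroup V] [NormedSpace ℂ V]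

/-- The function `s` represents a meromorphic function on the open set `Ω`: locally it is a
quotient `h / k` of holomorphic functions, where `k` is not identically zero on any open set.
The values of `s` where `k` vanishes are irrelevant. -/
def IsMero (Ω : Set V) (s : V → ℂ) : Prop :=
  ∀ z ∈ Ω, ∃ N : Set V, IsOpen N ∧ z ∈ N ∧ ∃ h k : V → ℂ,
    AnalyticOnNhd ℂ h N ∧ AnalyticOnNhd ℂ k N ∧ N ⊆ closure {y ∈ N | k y ≠ 0} ∧
      ∀ y ∈ N, k y ≠ 0 → s y = h y / k y

/-- `s` and `t` represent the same meromorphic function on the open set `Ω`: they agree on a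
dense open subset of `Ω`. -/
def GenEq (Ω : Set V) (s t : V → ℂ) : Prop :=
  ∃ D : Set V, IsOpen D ∧ D ⊆ Ω ∧ Ω ⊆ closure D ∧ Set.EqOn s t D

theorem subset_closure_inter {N A B : Set V} (hBN : B ⊆ N)
    (hA : N ⊆ closure A) (hB : N ⊆ closure B) (hBo : IsOpen B) : N ⊆ closure (A ∩ B) := by
  intro z hz
  rw [mem_closure_iff]
  intro O hO hzO
  obtain ⟨y, hyO, hyB⟩ := mem_closure_iff.1 (hB hz) O hO hzO
  obtain ⟨x, ⟨hxO, hxB⟩, hxA⟩ :=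
    mem_closure_iff.1 (hA (hBN hyB)) (O ∩ B) (hO.inter hBo) ⟨hyO, hyB⟩
  exact ⟨x, hxO, hxA, hxB⟩

theorem GenEq.refl {Ω : Set V} (hΩ : IsOpen Ω) (s : V → ℂ) : GenEq Ω s s :=
  ⟨Ω, hΩ, subset_rfl, subset_closure, fun _ _ => rfl⟩

theorem GenEq.of_eqOn {Ω : Set V} (hΩ : IsOpen Ω) {s t : V → ℂ} (h : Set.EqOn s t Ω) :
    GenEq Ω s t := ⟨Ω, hΩ, subset_rfl, subset_closure, h⟩

theorem GenEq.symm {Ω : Set V} {s t : V → ℂ} (h : GenEq Ω s t) : GenEq Ω t s := by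
  obtain ⟨D, h1, h2, h3, h4⟩ := h
  exact ⟨D, h1, h2, h3, h4.symm⟩

theorem GenEq.map₂ {Ω : Set V} {s t s' t' a b : V → ℂ} (h : GenEq Ω s t) (h' : GenEq Ω s' t')
    (H : ∀ z ∈ Ω, s z = t z → s' z = t' z → a z = b z) : GenEq Ω a b := by
  obtain ⟨D, h1, h2, h3, h4⟩ := h
  obtain ⟨D', h1', h2', h3', h4'⟩ := h'
  exact ⟨D ∩ D', h1.inter h1', fun z hz => h2 hz.1, subset_closure_inter h2' h3 h3' h1',
    fun z hz => H z (h2 hz.1) (h4 hz.1) (h4' hz.2)⟩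

theorem GenEq.trans {Ω : Set V} {s t r : V → ℂ} (h : GenEq Ω s t) (h' : GenEq Ω t r) :
    GenEq Ω s r := h.map₂ h' fun _ _ => Eq.trans

theorem GenEq.congr {Ω : Set V} {s t s' t' : V → ℂ} (h : GenEq Ω s t)
    (H : ∀ z ∈ Ω, s z = t z → s' z = t' z) : GenEq Ω s' t' :=
  h.map₂ h fun z hz hst _ => H z hz hst

/-- Generic equality can be differentiated. -/
theorem GenEq.fderiv {Ω : Set V} {s t : V → ℂ} (h : GenEq Ω s t) (v : V) :
    GenEq Ω (fun z => fderiv ℂ s z v) (fun z => fderiv ℂ t z v) := by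
  obtain ⟨D, h1, h2, h3, h4⟩ := h
  refine ⟨D, h1, h2, h3, fun z hz => ?_⟩
  have : s =ᶠ[𝓝 z] t := Filter.eventually_of_mem (h1.mem_nhds hz) h4
  simp only [this.fderiv_eq]

/-- Generic equality is preserved by homeomorphisms. -/
theorem GenEq.comp {Ω : Set V} {s t : V → ℂ} (h : GenEq Ω s t) (e : V ≃ₜ V)
    (he : ∀ z, e z ∈ Ω ↔ z ∈ Ω) : GenEq Ω (s ∘ e) (t ∘ e) := by
  obtain ⟨D, h1, h2, h3, h4⟩ := h
  refine ⟨e ⁻¹' D, h1.preimage e.continuous, fun z hz => (he z).1 (h2 hz), fun z hz => ?_,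
    fun z hz => h4 hz⟩
  rw [← e.preimage_closure]
  exact h3 ((he z).2 hz)

theorem IsMero.of_analytic {Ω : Set V} (hΩ : IsOpen Ω) {s : V → ℂ} (h : AnalyticOnNhd ℂ s Ω) :
    IsMero Ω s := fun z hz =>
  ⟨Ω, hΩ, hz, s, fun _ => 1, h, analyticOnNhd_const, fun y hy => subset_closure ⟨hy, one_ne_zero⟩,
    fun y _ _ => by simp⟩

theorem isOpen_ne_zero {N : Set V} (hN : IsOpen N) {k : V → ℂ} (hk : AnalyticOnNhd ℂ k N) :
    IsOpen {y ∈ N | k y ≠ 0} :=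
  hk.continuousOn.isOpen_inter_preimage hN isOpen_ne

theorem IsMero.map₂ {Ω : Set V} {s t r : V → ℂ} (hs : IsMero Ω s) (ht : IsMero Ω t)
    (F : ∀ N : Set V, ∀ h k h' k' : V → ℂ, AnalyticOnNhd ℂ h N → AnalyticOnNhd ℂ k N →
      AnalyticOnNhd ℂ h' N → AnalyticOnNhd ℂ k' N → ∃ H : V → ℂ, AnalyticOnNhd ℂ H N ∧
      ∀ y ∈ N, k y ≠ 0 → k' y ≠ 0 → s y = h y / k y → t y = h' y / k' y →
        r y = H y / (k y * k' y)) : IsMero Ω r := by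
  intro z hz
  obtain ⟨N, hN, hzN, h, k, hh, hk, hd, he⟩ := hs z hz
  obtain ⟨N', hN', hzN', h', k', hh', hk', hd', he'⟩ := ht z hz
  obtain ⟨H, hH, hr⟩ := F (N ∩ N') h k h' k' (hh.mono Set.inter_subset_left)
    (hk.mono Set.inter_subset_left) (hh'.mono Set.inter_subset_right)
    (hk'.mono Set.inter_subset_right)
  refine ⟨N ∩ N', hN.inter hN', ⟨hzN, hzN'⟩, H, fun y => k y * k' y, hH,
    (hk.mono Set.inter_subset_left).mul (hk'.mono Set.inter_subset_right), ?_, ?_⟩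
  · intro y hy
    rw [mem_closure_iff]
    intro O hO hyO
    obtain ⟨x, ⟨hxO, hxN'⟩, hx⟩ := mem_closure_iff.1 (hd hy.1) (O ∩ N') (hO.inter hN')
      ⟨hyO, hy.2⟩
    obtain ⟨x', ⟨hxO', hx1⟩, hx2⟩ := mem_closure_iff.1 (hd' hxN') (O ∩ {y ∈ N | k y ≠ 0})
      (hO.inter (isOpen_ne_zero hN hk)) ⟨hxO, hx⟩
    exact ⟨x', hxO', ⟨hx1.1, hx2.1⟩, mul_ne_zero hx1.2 hx2.2⟩
  · intro y hy hky
    have h1 := left_ne_zero_of_mul hky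
    have h2 := right_ne_zero_of_mul hky
    exact hr y hy h1 h2 (he y hy.1 h1) (he' y hy.2 h2)

theorem IsMero.add {Ω : Set V} {s t : V → ℂ} (hs : IsMero Ω s) (ht : IsMero Ω t) :
    IsMero Ω (s + t) :=
  hs.map₂ ht fun N h k h' k' ah ak ah' ak' =>
    ⟨fun y => h y * k' y + h' y * k y, (ah.mul ak').add (ah'.mul ak), fun y _ h1 h2 e1 e2 => by
      rw [Pi.add_apply, e1, e2]; field_simp⟩

theorem IsMero.mul {Ω : Set V} {s t : V → ℂ} (hs : IsMero Ω s) (ht : IsMero Ω t) :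
    IsMero Ω (s * t) :=
  hs.map₂ ht fun N h k h' k' ah ak ah' ak' =>
    ⟨fun y => h y * h' y, ah.mul ah', fun y _ h1 h2 e1 e2 => by
      rw [Pi.mul_apply, e1, e2]; field_simp⟩

theorem IsMero.comp {Ω : Set V} {s : V → ℂ} (hs : IsMero Ω s) (e : V ≃ₜ V)
    (ha : AnalyticOnNhd ℂ e Set.univ) (he : ∀ z, e z ∈ Ω ↔ z ∈ Ω) : IsMero Ω (s ∘ e) := by
  intro z hz
  obtain ⟨N, hN, hzN, h, k, hh, hk, hd, hq⟩ := hs (e z) ((he z).2 hz)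
  refine ⟨e ⁻¹' N, hN.preimage e.continuous, hzN, h ∘ e, k ∘ e,
    hh.comp (ha.mono (Set.subset_univ _)) (fun y hy => hy),
    hk.comp (ha.mono (Set.subset_univ _)) (fun y hy => hy), ?_, fun y hy hky => hq (e y) hy hky⟩
  intro y hy
  have : e y ∈ closure {y ∈ N | k y ≠ 0} := hd hy
  have h2 : y ∈ e ⁻¹' closure {y ∈ N | k y ≠ 0} := this
  rw [e.preimage_closure] at h2
  exact h2

/-- Where `s` is a quotient of holomorphic functions, it is differentiable. -/
theorem IsMero.genDifferentiable {Ω : Set V} (hΩ : IsOpen Ω) {s : V → ℂ} (hs : IsMero Ω s) :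
    Ω ⊆ closure {z ∈ Ω | AnalyticAt ℂ s z} := by
  intro z hz
  obtain ⟨N, hN, hzN, h, k, hh, hk, hd, hq⟩ := hs z hz
  rw [mem_closure_iff]
  intro O hO hzO
  obtain ⟨y, ⟨hyO, hyΩ⟩, hy⟩ := mem_closure_iff.1 (hd hzN) (O ∩ Ω) (hO.inter hΩ) ⟨hzO, hz⟩
  refine ⟨y, hyO, hyΩ, ?_⟩
  refine ((hh y hy.1).div (hk y hy.1) hy.2).congr ?_
  filter_upwards [(isOpen_ne_zero hN hk).mem_nhds hy] with x hx
  exact (hq x hx.1 hx.2).symm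

theorem IsMero.fderiv {Ω : Set V} {s : V → ℂ} (hs : IsMero Ω s) (v : V) :
    IsMero Ω (fun z => fderiv ℂ s z v) := by
  intro z hz
  obtain ⟨N, hN, hzN, h, k, hh, hk, hd, hq⟩ := hs z hz
  have hev : ∀ f : V → ℂ, AnalyticOnNhd ℂ f N → AnalyticOnNhd ℂ (fun y => _root_.fderiv ℂ f y v) N :=
    fun f hf => (ContinuousLinearMap.analyticOnNhd
      (ContinuousLinearMap.apply ℂ ℂ v) Set.univ).comp hf.fderiv (Set.mapsTo_univ _ _)
  refine ⟨N, hN, hzN, fun y => _root_.fderiv ℂ h y v * k y - h y * _root_.fderiv ℂ k y v,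
    fun y => k y * k y, ((hev h hh).mul hk).sub (hh.mul (hev k hk)), hk.mul hk, ?_, ?_⟩
  · simpa using hd
  · intro y hy hky
    have hky' : k y ≠ 0 := left_ne_zero_of_mul hky
    have heq : s =ᶠ[𝓝 y] fun x => h x / k x := by
      filter_upwards [(isOpen_ne_zero hN hk).mem_nhds ⟨hy, hky'⟩] with x hx
      exact hq x hx.1 hx.2
    have hsd : DifferentiableAt ℂ s y :=
      (((hh y hy).div (hk y hy) hky').congr heq.symm).differentiableAt
    have hprod : h =ᶠ[𝓝 y] fun x => s x * k x := by
      filter_upwards [heq, (isOpen_ne_zero hN hk).mem_nhds ⟨hy, hky'⟩] with x hx hx'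
      have := hx'.2
      rw [hx]; field_simp
    have h3 := congrArg (fun φ : V →L[ℂ] ℂ => φ v) hprod.fderiv_eq
    rw [fderiv_fun_mul hsd (hk y hy).differentiableAt] at h3
    simp only [add_apply, smul_apply, smul_eq_mul] at h3
    have h4 : h y = s y * k y := hprod.self_of_nhds
    change _root_.fderiv ℂ s y v =
      (_root_.fderiv ℂ h y v * k y - h y * _root_.fderiv ℂ k y v) / (k y * k y)
    rw [h3, h4]
    field_simp
    ring

end meromorphic
/-! ### Local meromorphic sections -/

namespace TorusAction

variable {V : Type*} [NormedAddCommGroup V] [NormedSpace ℂ V]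

/-- A `W`-invariant open subset of `X`, i.e. the preimage of an open subset of `X/W`. -/
structure InvariantOpen (T : TorusAction V) where
  carrier : Set T.X
  isOpen : IsOpen carrier
  smul_mem : ∀ (w : T.W), ∀ x ∈ carrier, w • x ∈ carrier

variable {T : TorusAction V}

/-- The preimage in `V`. -/
def InvariantOpen.lift (U : T.InvariantOpen) : Set V := T.proj ⁻¹' U.carrier

theorem InvariantOpen.isOpen_lift (U : T.InvariantOpen) : IsOpen U.lift :=
  U.isOpen.preimage T.continuous_proj

theorem InvariantOpen.add_mem_lift (U : T.InvariantOpen) (γ : T.Γ) (z : V) :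
    z + γ ∈ U.lift ↔ z ∈ U.lift := by
  simp only [InvariantOpen.lift, Set.mem_preimage, proj_add]

theorem InvariantOpen.act_mem_lift (U : T.InvariantOpen) (w : T.W) (z : V) :
    w.1 z ∈ U.lift ↔ z ∈ U.lift := by
  simp only [InvariantOpen.lift, Set.mem_preimage, ← smul_proj]
  refine ⟨fun h => ?_, U.smul_mem w _⟩
  simpa using U.smul_mem w⁻¹ _ h

/-- Functions on `V` representing the zero meromorphic function on `Ω`. -/
def genericallyZero {Ω : Set V} (hΩ : IsOpen Ω) : Submodule ℂ (V → ℂ) where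
  carrier := {s | GenEq Ω s 0}
  add_mem' hs ht := GenEq.map₂ hs ht fun z _ h h' => by simp [h, h']
  zero_mem' := GenEq.refl hΩ _
  smul_mem' c _ hs := GenEq.congr hs fun z _ h => by simp [h]

namespace LineBundle

variable [FiniteDimensional ℂ V]

/-- Functions on `V` representing meromorphic sections of `L` over `U`: meromorphic functions on
the preimage of `U` with `s (z + γ) = χ(γ, z) s(z)`. -/
def representatives (L : T.LineBundle) (U : T.InvariantOpen) : Submodule ℂ (V → ℂ) where
  carrier := {s | IsMero U.lift s ∧
    ∀ γ : T.Γ, GenEq U.lift (fun z => s (z + γ)) (fun z => L.χ γ z * s z)}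
  add_mem' hs ht := ⟨hs.1.add ht.1, fun γ => (hs.2 γ).map₂ (ht.2 γ) fun z _ h h' => by
    simp only [Pi.add_apply, h, h', mul_add]⟩
  zero_mem' := ⟨IsMero.of_analytic U.isOpen_lift analyticOnNhd_const,
    fun γ => GenEq.of_eqOn U.isOpen_lift fun z _ => by simp⟩
  smul_mem' c s hs := by
    refine ⟨?_, fun γ => (hs.2 γ).congr fun z _ h => ?_⟩
    · exact (IsMero.of_analytic (s := fun _ => c) U.isOpen_lift analyticOnNhd_const).mul hs.1
    · simp only [Pi.smul_apply, h, smul_eq_mul]; ring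

/-- The space of meromorphic sections of `L` over `U`. -/
abbrev MerSections (L : T.LineBundle) (U : T.InvariantOpen) : Type _ :=
  L.representatives U ⧸ (genericallyZero U.isOpen_lift).submoduleOf (L.representatives U)

theorem mk_eq_iff (L : T.LineBundle) (U : T.InvariantOpen) (s t : L.representatives U) :
    (Submodule.Quotient.mk s : L.MerSections U) = Submodule.Quotient.mk t ↔
      GenEq U.lift s.1 t.1 := by
  rw [Submodule.Quotient.eq, Submodule.submoduleOf, Submodule.mem_comap]
  constructor
  · intro h
    exact GenEq.congr (s := (s - t).1) (t := 0) h fun z _ h => sub_eq_zero.1 h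
  · intro h
    exact GenEq.congr h fun z _ h => sub_eq_zero.2 h

/-- A linear operator on meromorphic sections induced by an operator on representatives. -/
noncomputable def liftOp {M L : T.LineBundle} {U : T.InvariantOpen} (F : (V → ℂ) → (V → ℂ))
    (hmem : ∀ s ∈ M.representatives U, F s ∈ L.representatives U)
    (hcongr : ∀ s t, GenEq U.lift s t → GenEq U.lift (F s) (F t))
    (hadd : ∀ s ∈ M.representatives U, ∀ t ∈ M.representatives U,
      GenEq U.lift (F (s + t)) (F s + F t))
    (hsmul : ∀ c : ℂ, ∀ s ∈ M.representatives U, GenEq U.lift (F (c • s)) (c • F s)) :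
    M.MerSections U →ₗ[ℂ] L.MerSections U where
  toFun := Quotient.map' (fun s => ⟨F s.1, hmem s.1 s.2⟩) (by
    intro s t hst
    have h1 : (Submodule.Quotient.mk s : M.MerSections U) = Submodule.Quotient.mk t :=
      Quotient.sound' hst
    exact Quotient.exact' ((mk_eq_iff L U _ _).2 (hcongr _ _ ((mk_eq_iff M U s t).1 h1))))
  map_add' x y := by
    induction x using Submodule.Quotient.induction_on with
    | H s =>
      induction y using Submodule.Quotient.induction_on with
      | H t => exact (mk_eq_iff L U _ _).2 (hadd s.1 s.2 t.1 t.2)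
  map_smul' c x := by
    induction x using Submodule.Quotient.induction_on with
    | H s => exact (mk_eq_iff L U _ _).2 (hsmul c s.1 s.2)

/-- An element of `GL(V)` as a homeomorphism. -/
noncomputable def homeo (w : V ≃ₗ[ℂ] V) : V ≃ₜ V := w.toContinuousLinearEquiv.toHomeomorph

/-- The action of `w ∈ W` on sections, `(w s)(x) = s(w⁻¹ x)`, from sections of `L` to sections
of `L^w`. -/
noncomputable def act (L : T.LineBundle) (U : T.InvariantOpen) (w : T.W) :
    L.MerSections U →ₗ[ℂ] (L.twist w).MerSections U :=
  liftOp (fun s z => s ((w⁻¹).1 z))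
    (fun s hs => by
      refine ⟨hs.1.comp (homeo (w⁻¹).1) (analytic_lin _) (U.act_mem_lift w⁻¹), fun γ => ?_⟩
      refine ((hs.2 (T.latticeAct w⁻¹ γ)).comp (homeo (w⁻¹).1) (U.act_mem_lift w⁻¹)).congr ?_
      intro z _ h
      have h' : s ((w⁻¹).1 z + (w⁻¹).1 γ) = L.χ (T.latticeAct w⁻¹ γ) ((w⁻¹).1 z) *
        s ((w⁻¹).1 z) := h
      change s ((w⁻¹).1 (z + γ)) = _
      rw [map_add]
      exact h')
    (fun s t h => h.comp (homeo (w⁻¹).1) (U.act_mem_lift w⁻¹))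
    (fun s _ t _ => GenEq.refl U.isOpen_lift _)
    (fun c s _ => GenEq.refl U.isOpen_lift _)

/-- Multiplication by a meromorphic section `m` of `M^* ⊗ L`, from sections of `M` to sections
of `L`. -/
noncomputable def mulBy {M L : T.LineBundle} {U : T.InvariantOpen} (m : V → ℂ)
    (hm : m ∈ (M.homBundle L).representatives U) :
    M.MerSections U →ₗ[ℂ] L.MerSections U :=
  liftOp (fun s => m * s)
    (fun s hs => ⟨hm.1.mul hs.1, fun γ => (hm.2 γ).map₂ (hs.2 γ) fun z _ h h' => by
      have := M.ne_zero γ z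
      simp only [Pi.mul_apply, h, h', homBundle]
      field_simp⟩)
    (fun s t h => h.congr fun z _ h => by simp [h])
    (fun s _ t _ => by rw [mul_add]; exact GenEq.refl U.isOpen_lift _)
    (fun c s _ => by rw [mul_smul_comm]; exact GenEq.refl U.isOpen_lift _)

/-- The covariant derivative `∇_v` on meromorphic sections of `L`. -/
noncomputable def FlatConnection.nabla {L : T.LineBundle} (conn : L.FlatConnection)
    (U : T.InvariantOpen) (v : V) : Module.End ℂ (L.MerSections U) :=
  liftOp (fun s z => fderiv ℂ s z v + conn.form z v * s z)
    (fun s hs => by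
      have hform : AnalyticOnNhd ℂ (fun z => conn.form z v) U.lift :=
        (ContinuousLinearMap.analyticOnNhd
          (ContinuousLinearMap.apply ℂ ℂ v) Set.univ).comp
            (conn.analytic.mono (Set.subset_univ _)) (Set.mapsTo_univ _ _)
      refine ⟨(hs.1.fderiv v).add ((IsMero.of_analytic U.isOpen_lift hform).mul hs.1),
        fun γ => ?_⟩
      have hD : GenEq U.lift (fun z => fderiv ℂ (fun y => L.χ γ y * s y) z v)
          (fun z => fderiv ℂ (L.χ γ) z v * s z + L.χ γ z * fderiv ℂ s z v) := by
        refine ⟨{z | AnalyticAt ℂ s z} ∩ U.lift, (isOpen_analyticAt ℂ s).inter U.isOpen_lift,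
          Set.inter_subset_right, ?_, ?_⟩
        · refine (hs.1.genDifferentiable U.isOpen_lift).trans (closure_mono ?_)
          exact fun z hz => ⟨hz.2, hz.1⟩
        · intro z hz
          simp only
          rw [fderiv_fun_mul (L.analytic γ z trivial).differentiableAt hz.1.differentiableAt]
          simp only [add_apply, smul_apply, smul_eq_mul]
          ring
      refine (((hs.2 γ).fderiv v).trans hD).map₂ (hs.2 γ) fun z _ h h' => ?_
      simp only at h h' ⊢
      rw [fderiv_comp_add_right] at h
      rw [h, h']
      linear_combination (s z) * conn.transform γ z v)
    (fun s t h => (h.fderiv v).map₂ h fun z _ h h' => 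
      congrArg₂ (· + ·) h (congrArg (conn.form z v * ·) h'))
    (fun s hs t ht => by
      refine ⟨({z | AnalyticAt ℂ s z} ∩ U.lift) ∩ ({z | AnalyticAt ℂ t z} ∩ U.lift),
        ((isOpen_analyticAt ℂ s).inter U.isOpen_lift).inter
          ((isOpen_analyticAt ℂ t).inter U.isOpen_lift), fun z hz => hz.1.2, ?_, ?_⟩
      · refine subset_closure_inter Set.inter_subset_right ?_ ?_
          ((isOpen_analyticAt ℂ t).inter U.isOpen_lift)
        · exact (hs.1.genDifferentiable U.isOpen_lift).trans
            (closure_mono fun z hz => ⟨hz.2, hz.1⟩)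
        · exact (ht.1.genDifferentiable U.isOpen_lift).trans
            (closure_mono fun z hz => ⟨hz.2, hz.1⟩)
      · intro z hz
        simp only [Pi.add_apply]
        rw [fderiv_add hz.1.1.differentiableAt hz.2.1.differentiableAt]
        simp only [add_apply]
        ring)
    (fun c s hs => by
      refine ⟨{z | AnalyticAt ℂ s z} ∩ U.lift, (isOpen_analyticAt ℂ s).inter U.isOpen_lift,
          Set.inter_subset_right, ?_, ?_⟩
      · exact (hs.1.genDifferentiable U.isOpen_lift).trans
            (closure_mono fun z hz => ⟨hz.2, hz.1⟩)
      · intro z hz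
        simp only [Pi.smul_apply]
        rw [fderiv_const_smul hz.1.differentiableAt]
        simp only [smul_apply, smul_eq_mul]
        ring)

/-! ### The sections `f_{H,j}` and the elliptic Dunkl operators -/

/-- The element `g_H ^ j` of `W`. -/
noncomputable def _root_.EllipticDunkl.TorusAction.Pairs.elt (p : T.Pairs) : T.W :=
  T.gen p.isHypertorus ^ p.j

/-- `f` is the section `f_{H,j}`, for `p = (H, j)`: a meromorphic section of
`(L^g)^* ⊗ L ⊗ V_H^*`, where `g = g_H ^ j`, with a simple pole on `H`, no other singularities,
and residue `1` on `H`.  Here `V_H^*` is the line of linear forms on `V` vanishing on `V^{g_H}`.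

At a point `x ∈ H`, the fiber `(L^g)_x = L_{g⁻¹ x} = L_x` is canonically identified with `L_x`,
so that `(L^g)^* ⊗ L` is canonically trivial on `H`, and the residue is a function on `H`.
If `z ∈ V` is over `x` and `z = g⁻¹ z + γ`, the identification maps the class of `(g⁻¹ z, ξ)`
to the class of `(z, χ(γ, g⁻¹ z) ξ)`; hence the residue is `1` at `x` if and only if the
coefficient of `dα / α` at `z` is `χ(γ, g⁻¹ z)`. -/
structure IsDunklSection (L : T.LineBundle) (p : T.Pairs) (f : V → (V →L[ℂ] ℂ)) : Prop where
  analytic : ∀ z, T.proj z ∉ p.H → AnalyticAt ℂ f z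
  periodic : ∀ (γ : T.Γ) (z : V), f (z + γ) = ((L.twist p.elt).homBundle L).χ γ z • f z
  mem_VH : ∀ z v, (T.gen p.isHypertorus).1 v = v → f z v = 0
  residue : ∀ z₀, T.proj z₀ ∈ p.H → ∃ α : V →L[ℂ] ℂ, α ≠ 0 ∧
    (∀ v, (T.gen p.isHypertorus).1 v = v → α v = 0) ∧ ∃ b : V → ℂ, AnalyticAt ℂ b z₀ ∧
      (∀ γ : T.Γ, z₀ = (p.elt⁻¹).1 z₀ + γ → b z₀ = L.χ γ ((p.elt⁻¹).1 z₀)) ∧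
      ∀ᶠ z in 𝓝 z₀, α (z - z₀) ≠ 0 → f z = (b z / α (z - z₀)) • α
  /-- On `H` itself, where `f` has its pole, its value is `0` by convention. -/
  zero_on : ∀ z, T.proj z ∈ p.H → f z = 0

open Classical in
/-- The section `f_{H,j}` of `L`. -/
noncomputable def dunklSection (L : T.LineBundle) (p : T.Pairs) : V → (V →L[ℂ] ℂ) :=
  if h : ∃ f, L.IsDunklSection p f then h.choose else 0

theorem IsDunklSection.mem_representatives {L : T.LineBundle} {p : T.Pairs}
    {f : V → (V →L[ℂ] ℂ)} (hf : L.IsDunklSection p f) (U : T.InvariantOpen) (v : V) :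
    (fun z => f z v) ∈ ((L.twist p.elt).homBundle L).representatives U := by
  refine ⟨fun z₀ _ => ?_, fun γ => GenEq.of_eqOn U.isOpen_lift fun z _ => by
    simp [hf.periodic γ z]⟩
  have happ : ∀ x : V →L[ℂ] ℂ, AnalyticAt ℂ (fun φ : V →L[ℂ] ℂ => φ v) x := fun x =>
    (ContinuousLinearMap.apply ℂ ℂ v).analyticAt x
  by_cases hz : T.proj z₀ ∈ p.H
  · obtain ⟨α, hα, -, b, hb, -, hev⟩ := hf.residue z₀ hz
    obtain ⟨N, hN, hNo, hzN⟩ := eventually_nhds_iff.1 (hev.and hb.eventually_analyticAt)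
    refine ⟨N, hNo, hzN, fun z => b z * α v, fun z => α (z - z₀),
      fun z hz => (hN z hz).2.mul analyticAt_const,
      fun z _ => (α.analyticAt _).comp (analyticAt_id.sub analyticAt_const), ?_, ?_⟩
    · obtain ⟨e, he⟩ : ∃ e, α e ≠ 0 := by
        by_contra! h
        exact hα (ContinuousLinearMap.ext h)
      intro y hy
      by_cases h0 : α (y - z₀) = 0
      · rw [mem_closure_iff_frequently]
        have hc : Filter.Tendsto (fun t : ℂ => y + t • e) (𝓝[≠] 0) (𝓝 y) := by
          have : Continuous fun t : ℂ => y + t • e := by fun_prop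
          have := this.tendsto 0
          simp only [zero_smul, add_zero] at this
          exact this.mono_left nhdsWithin_le_nhds
        refine hc.frequently (Filter.Eventually.frequently ?_)
        filter_upwards [hc.eventually (hNo.mem_nhds hy), self_mem_nhdsWithin] with t ht ht0
        refine ⟨ht, ?_⟩
        rw [add_sub_right_comm, map_add, h0, map_smul, zero_add]
        exact mul_ne_zero ht0 he
      · exact subset_closure ⟨hy, h0⟩
    · intro y hy hαy
      simp only [(hN y hy).1 hαy, smul_apply, smul_eq_mul]
      ring
  · have h1 : AnalyticAt ℂ (fun z => f z v) z₀ := (happ _).comp (hf.analytic z₀ hz)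
    obtain ⟨N, hN, hNo, hzN⟩ := eventually_nhds_iff.1 h1.eventually_analyticAt
    exact ⟨N, hNo, hzN, fun z => f z v, fun _ => 1, hN, analyticOnNhd_const,
      fun y hy => subset_closure ⟨hy, one_ne_zero⟩, fun y _ _ => by simp⟩

theorem dunklSection_mem (L : T.LineBundle) (p : T.Pairs) (U : T.InvariantOpen) (v : V) :
    (fun z => L.dunklSection p z v) ∈ ((L.twist p.elt).homBundle L).representatives U := by
  by_cases h : ∃ f, L.IsDunklSection p f
  · have : L.IsDunklSection p (L.dunklSection p) := by
      rw [dunklSection, dif_pos h]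
      exact h.choose_spec
    exact this.mem_representatives U v
  · have : L.dunklSection p = 0 := by rw [dunklSection, dif_neg h]
    rw [this]
    exact Submodule.zero_mem _

/-- The elliptic Dunkl operator `D_v = ∇_v - ∑ C(H,j) ⟨f_{H,j}, v⟩ g_H^j`, acting on the
meromorphic sections of `L` over a `W`-invariant open set `U`.  The sum is over the finite set
of pairs `(H, j)`. -/
noncomputable def dunklOperator (L : T.LineBundle) (conn : L.FlatConnection) (C : T.Pairs → ℂ)
    (U : T.InvariantOpen) (v : V) : Module.End ℂ (L.MerSections U) :=
  conn.nabla U v -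
    ∑ᶠ p : T.Pairs, C p • (mulBy (fun z => L.dunklSection p z v) (L.dunklSection_mem p U v) ∘ₗ
      L.act U p.elt)

end LineBundle

/-- A function `C` of the pairs `(H, j)` is `W`-invariant: `C(wH, j) = C(H, j)`. -/
def IsInvariant (C : T.Pairs → ℂ) : Prop :=
  ∀ (w : T.W) (p q : T.Pairs), q.H = w • p.H → q.j = p.j → C q = C p

end TorusAction
end EllipticDunkl

namespace EllipticDunkl

open Filter

/-! ### Elliptic functions with multipliers and a simple pole -/

section kronecker

variable (Λ : Submodule ℤ ℂ) [DiscreteTopology Λ]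

/-! The argument is to twist everything into a unitary gauge and then apply Liouville's theorem
twice, once for uniqueness and once for commutativity.

Gauge (`exists_unitaryGauge`): with `ψ` a primitive of the connection form and a suitable linear
form `c`, the function `φ = exp (c - ψ)` turns the automorphy factor of `L` into a unitary character
`u` of `Γ` and `∇` into `d + c`. In this gauge `(L^w)^* ⊗ L` has the character `γ ↦ u (γ - w⁻¹ γ)`,
and the hypothesis on the stabilizer makes it nontrivial for every `w ≠ 1` (`exists_u_ne_one`).

Vanishing (`eq_zero_of_multipliers`): a function on `V` with nontrivial unitary multipliers, whose
singularities lie on translates of finitely many hyperplanes and are removable in codimension one,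
is bounded. By Liouville it is constant along a period with multiplier `≠ 1`, hence zero.

Existence of `f_{H,j}`: for `g = g_H^j` one has `g⁻¹ x = x - α(x) ε`, so the character `u (γ - g⁻¹
γ)` depends on `α(γ)` alone. The problem becomes one-dimensional over the discrete group `α(Γ) ⊂ ℂ`
and is solved by a twisted zeta series (`exists_kronecker_function`). Uniqueness: the difference of
two solutions has no residue and falls under the vanishing theorem.

Commutativity: in the gauge `D_v = ∂_v + c(v) - ∑ C K_p α_p(v) g_p`. The terms of `D_v D_u`
involving at most one group element are symmetric in `u, v`. The others are collected by the product
`w = g_p g_q`. For `w = 1` the forms `α_p`, `α_q` are proportional, so each term vanishes. For `w ≠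
1` the coefficient has the nontrivial character `u (γ - w⁻¹ γ)`, and its residues cancel in pairs
under `(p, q) ↦ (q, g_q⁻¹ p)` (`residueFst_eq_neg`), so it vanishes too (`commCoeff_eq_zero`). -/

theorem finrank_le_two_of_discrete : Module.finrank ℤ Λ ≤ 2 := by
  have h : DiscreteTopology (Submodule.span ℤ (Λ : Set ℂ)) := by
    rw [Submodule.span_eq]; infer_instance
  have h2 := Real.finrank_eq_int_finrank_of_discrete h
  rw [Set.finrank, Set.finrank, Submodule.span_eq] at h2
  rw [← h2, ← Complex.finrank_real_complex]
  exact Submodule.finrank_le _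

theorem isClosed_of_subset_discrete {s : Set ℂ} (hs : s ⊆ Λ) : IsClosed s := by
  have hΛ : IsClosed (Λ : Set ℂ) :=
    @AddSubgroup.isClosed_of_discrete _ _ _ _ _ Λ.toAddSubgroup
      (inferInstanceAs (DiscreteTopology Λ))
  have := hΛ.isClosedMap_subtype_val _ (isClosed_discrete (α := Λ) ((↑) ⁻¹' s))
  convert this using 1
  ext x
  simp only [Set.mem_image, Set.mem_preimage, Subtype.exists, exists_and_left, exists_prop]
  exact ⟨fun hx => ⟨x, hx, hs hx, rfl⟩, by rintro ⟨y, hy, -, rfl⟩; exact hy⟩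

/-- The convergent summand `1/(x-a) + 1/a + x/a²` of a zeta-like lattice series. -/
noncomputable def zetaSummand (a x : ℂ) : ℂ := 1 / (x - a) + 1 / a + x / a ^ 2

/-- The three terms combine to `x² / (a² (x - a))`, which decays like `‖a‖⁻³`: just enough for
summation over a discrete group of rank at most two. -/
theorem norm_zetaSummand_le {r : ℝ} {a x : ℂ} (hx : ‖x‖ < r) (ha : 2 * r ≤ ‖a‖) :
    ‖zetaSummand a x‖ ≤ 2 * r ^ 2 * ‖a‖ ^ (-3 : ℝ) := by
  have hr : 0 < r := (norm_nonneg x).trans_lt hx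
  have ha0 : 0 < ‖a‖ := by linarith
  have hane : a ≠ 0 := norm_pos_iff.1 ha0
  have hd : ‖a‖ / 2 ≤ ‖x - a‖ := by
    rw [norm_sub_rev]
    have := norm_sub_norm_le a x
    linarith
  have hxa : x - a ≠ 0 := norm_pos_iff.1 (by linarith)
  have h : zetaSummand a x = x ^ 2 / (a ^ 2 * (x - a)) := by
    rw [zetaSummand]
    field_simp
    ring
  have h3 : ‖a‖ ^ (-3 : ℝ) = 1 / ‖a‖ ^ 3 := by
    rw [Real.rpow_neg ha0.le, one_div]
    norm_cast
  rw [h, h3, norm_div, norm_mul, norm_pow, norm_pow]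
  calc ‖x‖ ^ 2 / (‖a‖ ^ 2 * ‖x - a‖) ≤ r ^ 2 / (‖a‖ ^ 2 * (‖a‖ / 2)) := by gcongr
    _ = 2 * r ^ 2 * (1 / ‖a‖ ^ 3) := by field_simp

/-- On a ball of radius `r` only the finitely many points with `‖a‖ < 2 r` escape the summable
bound. -/
theorem hasSumLocallyUniformly_of_bound (f : Λ → ℂ → ℂ)
    (hf : ∀ r > 0, ∀ x, ∀ a : Λ, ‖x‖ < r → 2 * r ≤ ‖(a : ℂ)‖ →
      ‖f a x‖ ≤ 2 * r ^ 2 * ‖(a : ℂ)‖ ^ (-3 : ℝ)) :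
    HasSumLocallyUniformly f (∑' j, f j ·) := by
  have hlat : Summable fun a : Λ => ‖(a : ℂ)‖ ^ (-3 : ℝ) :=
    ZLattice.summable_norm_rpow Λ (-3) (by
      have : (Module.finrank ℤ Λ : ℝ) ≤ 2 := by exact_mod_cast finrank_le_two_of_discrete Λ
      linarith)
  have : ProperSpace Λ := .of_isClosed (isClosed_of_subset_discrete Λ subset_rfl)
  rw [hasSumLocallyUniformly_iff_tendstoLocallyUniformly, tendstoLocallyUniformly_iff_filter]
  intro x
  obtain ⟨r, hr, hr'⟩ : ∃ r, 0 < r ∧ 𝓝 x ≤ 𝓟 (Metric.ball 0 r) :=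
    ⟨‖x‖ + 1, by positivity, Filter.le_principal_iff.mpr (Metric.isOpen_ball.mem_nhds (by simp))⟩
  refine .mono_right ?_ hr'
  rw [← tendstoUniformlyOn_iff_tendstoUniformlyOnFilter]
  refine tendstoUniformlyOn_tsum_of_cofinite_eventually (hlat.mul_left (2 * r ^ 2)) ?_
  refine (isCompact_iff_finite.mp (isCompact_closedBall (0 : Λ) (2 * r))).subset ?_
  intro l hl
  obtain ⟨s, hs, hs'⟩ : ∃ x, ‖x‖ < r ∧ 2 * r ^ 2 * ‖(l : ℂ)‖ ^ (-3 : ℝ) < ‖f l x‖ := by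
    simpa using hl
  simp only [Metric.mem_closedBall, dist_zero_right]
  contrapose! hs'
  exact hf r hr s l hs hs'.le

/-- A nontrivial multiplier admits no affine function; this rigidity fixes the affine correction of
the zeta series. -/
theorem eq_zero_of_affine {A B b m : ℂ} (hm : m ≠ 1)
    (h : ∀ x : ℂ, A + B * (x + b) = m * (A + B * x)) : A = 0 ∧ B = 0 := by
  have h0 := h 0
  have h1 := h 1
  have hm' : (1 - m) ≠ 0 := sub_ne_zero.2 hm.symm
  have hB : B = 0 := by
    have : (1 - m) * B = 0 := by linear_combination h1 - h0
    exact (mul_eq_zero.1 this).resolve_left hm'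
  subst hB
  have : (1 - m) * A = 0 := by linear_combination h0
  exact ⟨(mul_eq_zero.1 this).resolve_left hm', rfl⟩

/-- For a nontrivial unitary character `μ` of a discrete group `Λ ⊂ ℂ` there is a meromorphic
function with multipliers `μ` whose only singularities are simple poles at `Λ`. -/
theorem exists_kronecker_function (μ : Λ → ℂ) (hadd : ∀ a b, μ (a + b) = μ a * μ b)
    (hnorm : ∀ a, ‖μ a‖ = 1) {b₀ : Λ} (hb₀ : μ b₀ ≠ 1) :
    ∃ F G : ℂ → ℂ, (∀ x ∉ Λ, AnalyticAt ℂ F x) ∧ (∀ (a : Λ) x, F (x + a) = μ a * F x) ∧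
      AnalyticAt ℂ G 0 ∧ ∀ x, F x = x⁻¹ + G x := by
  set f : Λ → ℂ → ℂ := fun a x => μ a * zetaSummand a x with hf
  have hbd : ∀ r > 0, ∀ x (a : Λ), ‖x‖ < r → 2 * r ≤ ‖(a : ℂ)‖ →
      ‖f a x‖ ≤ 2 * r ^ 2 * ‖(a : ℂ)‖ ^ (-3 : ℝ) := by
    intro r _ x a hx ha
    rw [hf, norm_mul, hnorm, one_mul]
    exact norm_zetaSummand_le hx ha
  have hsum : ∀ x, Summable fun a => f a x := fun x =>
    ⟨_, (hasSumLocallyUniformly_of_bound Λ f hbd).hasSum⟩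
  -- The series without its polar term at `0`; it supplies the regular part `G`.
  set f' : Λ → ℂ → ℂ := fun a x => if a = 0 then 0 else f a x with hf'
  have hbd' : ∀ r > 0, ∀ x (a : Λ), ‖x‖ < r → 2 * r ≤ ‖(a : ℂ)‖ →
      ‖f' a x‖ ≤ 2 * r ^ 2 * ‖(a : ℂ)‖ ^ (-3 : ℝ) := by
    intro r hr x a hx ha
    simp only [hf']
    split_ifs
    · rw [norm_zero]; positivity
    · exact hbd r hr x a hx ha
  have hopen : IsOpen ((Λ : Set ℂ) \ {0})ᶜ :=
    (isClosed_of_subset_discrete Λ Set.sdiff_subset).isOpen_compl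
  have hdiff : DifferentiableOn ℂ (fun x => ∑' a, f' a x) ((Λ : Set ℂ) \ {0})ᶜ := by
    refine (hasSumLocallyUniformly_of_bound Λ f' hbd').hasSumLocallyUniformlyOn.differentiableOn
      (.of_forall fun s => .fun_sum fun i _ => ?_) hopen
    simp only [hf', hf, zetaSummand]
    split_ifs with hi
    · simp
    · refine (DifferentiableOn.add (.add (.div (by fun_prop) (by fun_prop) ?_) (by fun_prop))
        (by fun_prop)).const_mul _
      intro x hx h0
      refine hx ⟨?_, ?_⟩
      · rw [sub_eq_zero.1 h0]; exact i.2
      · rw [sub_eq_zero.1 h0]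
        simpa using hi
  have hμ0 : μ 0 = 1 := by
    have h := hadd 0 0
    have h0 : μ 0 ≠ 0 := norm_pos_iff.1 (by rw [hnorm]; exact one_pos)
    rw [add_zero] at h
    field_simp at h
    exact h.symm
  have hsplit : ∀ x, ∑' a, f a x = x⁻¹ + ∑' a, f' a x := by
    intro x
    rw [(hsum x).tsum_eq_add_tsum_ite 0]
    -- With `1 / 0 = 0` the summand at `a = 0` is exactly `x⁻¹`.
    simp [hf, hf', zetaSummand, hμ0]
  set Z : ℂ → ℂ := fun x => ∑' a, f a x with hZ
  -- After reindexing by `a ↦ a - b` the polar parts of `Z (x + b)` and `μ b * Z x` cancel term by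
  -- term, leaving only the convergence corrections, which are affine in `x`.
  have haff : ∀ b : Λ, ∃ A B : ℂ, ∀ x, Z (x + b) = μ b * Z x + (A + B * x) := by
    intro b
    have hreindex : ∀ x, ∑' a : Λ, μ b * f (a - b) x = μ b * Z x := by
      intro x
      rw [tsum_mul_left, hZ]
      exact congrArg _ ((Equiv.subRight b).tsum_eq fun a => f a x)
    set c : Λ → ℂ → ℂ := fun a x => f a (x + b) - μ b * f (a - b) x with hc
    have hcs : ∀ x, Summable fun a => c a x := fun x =>
      (hsum (x + b)).sub (((Equiv.subRight b).summable_iff.2 (hsum x)).mul_left _)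
    have hceq : ∀ a x, c a x = c a 0 + (c a 1 - c a 0) * x := by
      intro a x
      have h1 : μ b * μ (a - b) = μ a := by rw [← hadd]; congr 1; abel
      have h2 : ∀ x, c a x = μ a * (1 / (a : ℂ) + (x + b) / (a : ℂ) ^ 2 - 1 / ((a : ℂ) - b) -
          x / ((a : ℂ) - b) ^ 2) := by
        intro x
        simp only [hc, hf, zetaSummand, ← mul_assoc, h1, AddSubgroupClass.coe_sub]
        rw [show x - ((a : ℂ) - b) = x + b - a by ring]
        ring
      rw [h2, h2, h2]
      ring
    refine ⟨∑' a, c a 0, ∑' a, (c a 1 - c a 0), fun x => ?_⟩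
    have hsb : Summable fun a => μ b * f (a - b) x :=
      ((Equiv.subRight b).summable_iff.2 (hsum x)).mul_left _
    rw [← tsum_mul_right, ← (hcs 0).tsum_add (((hcs 1).sub (hcs 0)).mul_right x), ← hreindex]
    simp_rw [← hceq]
    rw [← hsb.tsum_add (hcs x)]
    refine tsum_congr fun a => ?_
    simp only [hc]
    ring
  obtain ⟨A, B, hAB⟩ := haff b₀
  have hm' : (1 - μ b₀) ≠ 0 := sub_ne_zero.2 hb₀.symm
  -- `p + q x` is the affine function with the same defect `A + B x` under `b₀` as `Z`; solving for
  -- it divides by `1 - μ b₀`.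
  set q := B / (1 - μ b₀) with hq
  set p := (A - q * b₀) / (1 - μ b₀) with hp
  have hqB : q * (1 - μ b₀) = B := by rw [hq]; field_simp
  have hpA : p * (1 - μ b₀) = A - q * b₀ := by rw [hp]; field_simp
  set F : ℂ → ℂ := fun x => Z x - (p + q * x) with hF
  have hF₀ : ∀ x, F (x + b₀) = μ b₀ * F x := by
    intro x
    simp only [hF, hAB]
    linear_combination -hpA - x * hqB
  refine ⟨F, fun x => ∑' a, f' a x - (p + q * x), ?_, ?_, ?_, ?_⟩
  · intro x hx
    have hx0 : x ≠ 0 := fun h => hx (h ▸ Λ.zero_mem)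
    have h1 : AnalyticAt ℂ (fun x => ∑' a, f' a x) x :=
      hdiff.analyticAt (hopen.mem_nhds fun h => hx h.1)
    have h2 : F = fun x => x⁻¹ + ∑' a, f' a x - (p + q * x) := by
      funext y
      simp only [hF, hZ, hsplit]
    rw [h2]
    fun_prop (disch := exact hx0)
  · intro a x
    obtain ⟨A', B', h'⟩ := haff a
    have hR : ∀ x, F (x + a) - μ a * F x =
        (A' - q * a + (μ a - 1) * p) + (B' + (μ a - 1) * q) * x := by
      intro x
      simp only [hF, h']
      ring
    -- For every other `a` the defect of `F` is affine and, as translations commute, is itself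
    -- multiplied by `μ b₀` under `b₀`; so it vanishes.
    have := eq_zero_of_affine (b := b₀) hb₀
      (A := A' - q * a + (μ a - 1) * p) (B := B' + (μ a - 1) * q) (fun x => by
        rw [← hR, ← hR, add_right_comm, hF₀, hF₀]
        ring)
    have h0 := hR x
    rw [this.1, this.2] at h0
    linear_combination h0
  · have h1 : AnalyticAt ℂ (fun x => ∑' a, f' a x) 0 :=
      hdiff.analyticAt (hopen.mem_nhds fun h => h.2 rfl)
    fun_prop
  · intro x
    simp only [hF, hZ, hsplit]
    ring

end kronecker

/-! ### Primitives of holomorphic one-forms -/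

section primitive

variable {V : Type*} [NormedAddCommGroup V] [NormedSpace ℂ V]

theorem hasDerivAt_comp_line {ψ : V → ℂ} {a : V →L[ℂ] ℂ} {z₀ y : V} {t : ℝ}
    (h : HasFDerivAt ψ a (z₀ + (t : ℂ) • y)) :
    HasDerivAt (fun s : ℝ => ψ (z₀ + (s : ℂ) • y)) (a y) t := by
  have h1 : HasDerivAt (fun s : ℂ => z₀ + s • y) y (t : ℂ) := by
    simpa using ((hasDerivAt_id (t : ℂ)).smul_const y).const_add z₀
  exact (h.comp_hasDerivAt (t : ℂ) h1).comp_ofReal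

/-- A primitive of an analytic one-form is analytic. -/
theorem analyticAt_of_hasFDerivAt {ψ : V → ℂ} {a : V → V →L[ℂ] ℂ} {z₀ : V}
    (ha : AnalyticAt ℂ a z₀) (hψ : ∀ᶠ z in 𝓝 z₀, HasFDerivAt ψ (a z) z) : AnalyticAt ℂ ψ z₀ := by
  obtain ⟨p, r₁, hp₁⟩ := ha
  obtain ⟨ε, hε, hεψ⟩ := Metric.eventually_nhds_iff_ball.1 hψ
  set r : ENNReal := min r₁ (ENNReal.ofReal ε) with hr
  have hrpos : 0 < r := lt_min hp₁.r_pos (by simpa using hε)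
  have hp : HasFPowerSeriesOnBall a p z₀ r := hp₁.mono hrpos (min_le_left _ _)
  -- From `ψ (z₀ + y) - ψ z₀ = ∫₀¹ a (z₀ + t y) y dt`, integrating the series of `a` termwise; `∫₀¹
  -- tⁿ dt` gives the factor `1 / (n + 1)`.
  let q : FormalMultilinearSeries ℂ V (V →L[ℂ] ℂ) := fun n => ((n : ℂ) + 1)⁻¹ • p n
  have hn1 : ∀ n : ℕ, ‖((n : ℂ) + 1)⁻¹‖ ≤ 1 := by
    intro n
    rw [norm_inv, show ((n : ℂ) + 1) = ((n + 1 : ℕ) : ℂ) by push_cast; ring, Complex.norm_natCast]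
    exact inv_le_one_of_one_le₀ (by exact_mod_cast Nat.le_add_left 1 n)
  have hqr : p.radius ≤ q.radius := FormalMultilinearSeries.radius_le_of_le fun {n} => by
    rw [show q n = ((n : ℂ) + 1)⁻¹ • p n from rfl, norm_smul]
    exact mul_le_of_le_one_left (norm_nonneg _) (hn1 n)
  have hq : HasFPowerSeriesOnBall q.sum q 0 r :=
    (q.hasFPowerSeriesOnBall ((hrpos.trans_le hp.r_le).trans_le hqr)).mono hrpos
      (hp.r_le.trans hqr)
  have key : ∀ y ∈ Metric.eball (0 : V) r, ψ (z₀ + y) = ψ z₀ + q.sum y y := by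
    intro y hy
    have hyn : ‖y‖ₑ < r := by simpa using hy
    have hyε : ‖y‖ < ε := by
      have := hyn.trans_le (min_le_right _ _)
      rwa [← ofReal_norm, ENNReal.ofReal_lt_ofReal_iff hε] at this
    have hty : ∀ t ∈ Set.Icc (0 : ℝ) 1, ‖(t : ℂ) • y‖ ≤ ‖y‖ := by
      intro t ht
      rw [norm_smul, Complex.norm_real, Real.norm_of_nonneg ht.1]
      exact mul_le_of_le_one_left (norm_nonneg _) ht.2
    have htm : ∀ t ∈ Set.Icc (0 : ℝ) 1, (t : ℂ) • y ∈ Metric.eball (0 : V) r := by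
      intro t ht
      have : ‖(t : ℂ) • y‖ₑ ≤ ‖y‖ₑ := by
        rw [← ofReal_norm, ← ofReal_norm]
        exact ENNReal.ofReal_le_ofReal (hty t ht)
      simpa using this.trans_lt hyn
    have hcont : ContinuousOn (fun t : ℝ => a (z₀ + (t : ℂ) • y) y) (Set.uIcc 0 1) := by
      rw [Set.uIcc_of_le zero_le_one]
      refine ContinuousOn.clm_apply ?_ continuousOn_const
      refine hp.continuousOn.comp (by fun_prop) fun t ht => ?_
      have := htm t ht
      simpa [Metric.mem_eball, edist_eq_enorm_sub] using this
    have hint : ∫ t in (0 : ℝ)..1, a (z₀ + (t : ℂ) • y) y = ψ (z₀ + y) - ψ z₀ := by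
      rw [intervalIntegral.integral_eq_sub_of_hasDerivAt (f := fun s : ℝ => ψ (z₀ + (s : ℂ) • y))
        (fun t ht => hasDerivAt_comp_line (hεψ _ ?_)) hcont.intervalIntegrable]
      · simp
      · rw [Set.uIcc_of_le zero_le_one] at ht
        simpa using (hty t ht).trans_lt hyε
    have hpow : ∀ (n : ℕ) (t : ℝ), p n (fun _ => (t : ℂ) • y) y = (t : ℂ) ^ n * p n (fun _ => y) y := by
      intro n t
      rw [(p n).map_smul_univ (fun _ => (t : ℂ)) (fun _ => y)]
      simp
    have hsum := intervalIntegral.hasSum_integral_of_dominated_convergence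
      (μ := MeasureTheory.volume) (a := (0 : ℝ)) (b := 1)
      (F := fun (n : ℕ) (t : ℝ) => p n (fun _ => (t : ℂ) • y) y)
      (f := fun t => a (z₀ + (t : ℂ) • y) y) (fun n _ => ‖p n‖ * ‖y‖ ^ n * ‖y‖)
      (fun n => by
        simp_rw [hpow]
        exact (by fun_prop : Continuous fun t : ℝ => (t : ℂ) ^ n * p n (fun _ => y) y).aestronglyMeasurable)
      (fun n => .of_forall fun t ht => by
        rw [Set.uIoc_of_le zero_le_one] at ht
        refine (ContinuousLinearMap.le_opNorm _ _).trans ?_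
        gcongr
        refine ((p n).le_opNorm _).trans ?_
        gcongr
        simp only [Finset.prod_const, Finset.card_univ, Fintype.card_fin]
        gcongr
        exact hty t (Set.Ioc_subset_Icc_self ht))
      (.of_forall fun t _ => by
        refine Summable.mul_right _ ?_
        have : ((‖y‖₊ : NNReal) : ENNReal) < p.radius := hyn.trans_le hp.r_le
        simpa using p.summable_norm_mul_pow this)
      (by simp)
      (.of_forall fun t ht => by
        rw [Set.uIoc_of_le zero_le_one] at ht
        have := hp.hasSum (htm t (Set.Ioc_subset_Icc_self ht))
        exact this.mapL (ContinuousLinearMap.apply ℂ ℂ y))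
    have hval : ∀ n : ℕ, ∫ t in (0 : ℝ)..1, p n (fun _ => (t : ℂ) • y) y = q n (fun _ => y) y := by
      intro n
      simp_rw [hpow]
      rw [intervalIntegral.integral_mul_const]
      have : ∫ t in (0 : ℝ)..1, (t : ℂ) ^ n = ((n : ℂ) + 1)⁻¹ := by
        have h := integral_pow (a := 0) (b := 1) n
        have h' : ∫ t in (0 : ℝ)..1, (t : ℂ) ^ n = ((∫ t in (0 : ℝ)..1, t ^ n : ℝ) : ℂ) := by
          rw [← intervalIntegral.integral_ofReal]
          push_cast
          rfl
        rw [h', h]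
        push_cast
        simp
      rw [this]
      rfl
    have h2 := (hq.hasSum (y := y) hy).mapL (ContinuousLinearMap.apply ℂ ℂ y)
    simp only [zero_add, ContinuousLinearMap.apply_apply] at h2
    simp_rw [hval] at hsum
    have h3 := hsum.unique h2
    rw [hint] at h3
    rw [← h3]; ring
  have hA : AnalyticAt ℂ (fun z => ψ z₀ + q.sum (z - z₀) (z - z₀)) z₀ := by
    have h1 : AnalyticAt ℂ (fun z : V => z - z₀) z₀ := analyticAt_id.sub analyticAt_const
    have h2 : AnalyticAt ℂ (fun z : V => q.sum (z - z₀)) z₀ :=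
      AnalyticAt.fun_comp (g := q.sum) (by rw [sub_self]; exact hq.analyticAt) h1
    exact analyticAt_const.add (AnalyticAt.comp₂
      ((ContinuousLinearMap.id ℂ (V →L[ℂ] ℂ)).analyticAt_bilinear _) h2 h1)
  refine hA.congr ?_
  filter_upwards [Metric.eball_mem_nhds z₀ hrpos] with z hz
  have := key (z - z₀) (by simpa [edist_eq_enorm_sub] using hz)
  rw [← this]
  congr 1
  abel

/-- A closed holomorphic one-form on `V` has a holomorphic primitive. -/
theorem exists_primitive {a : V → V →L[ℂ] ℂ} (ha : AnalyticOnNhd ℂ a Set.univ)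
    (hclosed : ∀ z u v : V, fderiv ℂ a z u v = fderiv ℂ a z v u) :
    ∃ ψ : V → ℂ, AnalyticOnNhd ℂ ψ Set.univ ∧ ∀ z, HasFDerivAt ψ (a z) z := by
  have hd : ∀ z, HasFDerivAt a (fderiv ℂ a z) z := fun z =>
    (ha z trivial).differentiableAt.hasFDerivAt
  obtain ⟨ψ, hψ⟩ :=
    Convex.exists_forall_hasFDerivWithinAt_of_hasFDerivWithinAt_symmetric (𝕜 := ℂ) (E := V)
    (F := ℂ) (s := Set.univ) (ω := a) (dω := fun z => (fderiv ℂ a z).restrictScalars ℝ) convex_univ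
    (fun x _ => ((hd x).restrictScalars ℝ).hasFDerivWithinAt)
    (fun z _ u _ v _ => hclosed z u v)
  have hψ' : ∀ z, HasFDerivAt ψ (a z) z := fun z => by
    simpa using hψ z trivial
  exact ⟨ψ, fun z _ => analyticAt_of_hasFDerivAt (ha z trivial) (.of_forall hψ'), hψ'⟩

end primitive

/-! ### Vanishing of quasi-periodic functions with removable singularities -/

/-- Riemann's removable singularity theorem at each point. Taking punctured limits as values of the
extension makes the values of `ψ` at the singularities irrelevant. -/
theorem exists_entire_extension {ψ : ℂ → ℂ}
    (hd : ∀ t₀, ∀ᶠ t in 𝓝[≠] t₀, DifferentiableAt ℂ ψ t)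
    (hres : ∀ t₀, Tendsto (fun s => s * ψ (t₀ + s)) (𝓝[≠] 0) (𝓝 0)) :
    ∃ φ : ℂ → ℂ, Differentiable ℂ φ ∧ ∀ t, ContinuousAt ψ t → φ t = ψ t := by
  refine ⟨fun t => limUnder (𝓝[≠] t) ψ, fun t₀ => ?_, fun t ht =>
    (ht.tendsto.mono_left nhdsWithin_le_nhds).limUnder_eq⟩
  obtain ⟨s, hs, hs'⟩ : ∃ s ∈ 𝓝 t₀, ∀ t ∈ s \ {t₀}, DifferentiableAt ℂ ψ t := by
    have := (hd t₀)
    rw [eventually_nhdsWithin_iff] at this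
    exact ⟨_, this, fun t ht => ht.1 ht.2⟩
  have hlit : (fun t => ψ t - ψ t₀) =o[𝓝[≠] t₀] fun t => (t - t₀)⁻¹ := by
    rw [Asymptotics.isLittleO_iff_tendsto' (by
      filter_upwards [self_mem_nhdsWithin] with t ht h
      exact absurd (inv_eq_zero.1 h) (sub_ne_zero.2 ht))]
    have hsh : Tendsto (fun t => t - t₀) (𝓝[≠] t₀) (𝓝[≠] 0) := by
      refine tendsto_nhdsWithin_iff.2 ⟨?_, ?_⟩
      · have : Continuous fun t : ℂ => t - t₀ := by fun_prop
        have := this.tendsto t₀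
        rw [sub_self] at this
        exact this.mono_left nhdsWithin_le_nhds
      · filter_upwards [self_mem_nhdsWithin] with t ht
        exact sub_ne_zero.2 ht
    have h1 := (hres t₀).comp hsh
    have h2 : Tendsto (fun t => (t - t₀) * ψ t₀) (𝓝[≠] t₀) (𝓝 0) := by
      have := (hsh.mono_right nhdsWithin_le_nhds).mul_const (ψ t₀)
      rwa [zero_mul] at this
    have h3 := h1.sub h2
    rw [sub_zero] at h3
    refine h3.congr fun t => ?_
    simp only [Function.comp, add_sub_cancel, div_inv_eq_mul]
    ring
  have hmain := Complex.differentiableOn_update_limUnder_of_isLittleO hs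
    (fun t ht => (hs' t ht).differentiableWithinAt) hlit
  refine ((hmain.differentiableAt hs).congr_of_eventuallyEq ?_)
  filter_upwards [hs] with t ht
  by_cases h : t = t₀
  · subst h; simp
  · rw [Function.update_of_ne h]
    exact ((hs' t ⟨ht, h⟩).continuousAt.tendsto.mono_left nhdsWithin_le_nhds).limUnder_eq

section vanishing

variable {V : Type*} [NormedAddCommGroup V] [NormedSpace ℂ V] [FiniteDimensional ℂ V]

theorem dense_compl_preimage_singleton {β : V →L[ℂ] ℂ} (hβ : β ≠ 0) (s : ℂ) :
    Dense {z | β z ≠ s} := by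
  obtain ⟨d, hd⟩ : ∃ d, β d ≠ 0 := by
    by_contra! h
    exact hβ (ContinuousLinearMap.ext h)
  intro z
  by_cases hz : β z = s
  · rw [mem_closure_iff_frequently]
    have hc : Tendsto (fun t : ℂ => z + t • d) (𝓝[≠] 0) (𝓝 z) := by
      have : Continuous fun t : ℂ => z + t • d := by fun_prop
      have := this.tendsto 0
      simp only [zero_smul, add_zero] at this
      exact this.mono_left nhdsWithin_le_nhds
    refine hc.frequently (Eventually.frequently ?_)
    filter_upwards [self_mem_nhdsWithin] with t ht
    simp only [map_add, map_smul, hz, smul_eq_mul, ne_eq, add_eq_left, mul_eq_zero, hd, or_false]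
    exact ht
  · exact subset_closure hz

/-- Each value `s` is avoided on a dense open set; countably many such sets are intersected in the
sense of Baire category. -/
theorem eventually_residual_notMem {β : V →L[ℂ] ℂ} (hβ : β ≠ 0) {S : Set ℂ} (hS : S.Countable) :
    ∀ᶠ z in residual V, β z ∉ S := by
  have h : ∀ᶠ z in residual V, ∀ s ∈ S, β z ≠ s :=
    (eventually_countable_ball hS).2 fun s _ =>
      residual_of_dense_open (isOpen_ne_fun β.continuous continuous_const)
        (dense_compl_preimage_singleton hβ s)
  filter_upwards [h] with z hz hzS
  exact hz _ hzS rfl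

variable {ι : Type*} [Finite ι] (α : ι → V →L[ℂ] ℂ) (S : ι → Set ℂ)

/-- The line through `z` in direction `e` is in general position with respect to the
hypersurfaces `α i z ∈ S i`. -/
def LineGeneric (e z : V) : Prop :=
  (∀ i, α i e = 0 → α i z ∉ S i) ∧
    ∀ i j (t : ℂ), α i (z + t • e) ∈ S i → α j (z + t • e) ∈ S j →
      ∀ x y, α i x * α j y = α i y * α j x

variable {α S}

/-- If the line meets `α i = s` and `α j = s'` at the same parameter, eliminating the parameter
gives `α j e * α i z - α i e * α j z = α j e * s - α i e * s'`. Unless the form on the left is zero,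
this excludes only countably many hyperplanes of points `z`. -/
theorem eventually_lineGeneric (hα : ∀ i, α i ≠ 0) (hS : ∀ i, (S i).Countable) (e : V) :
    ∀ᶠ z in residual V, LineGeneric α S e z := by
  have h1 : ∀ᶠ z in residual V, ∀ i, α i z ∉ S i :=
    eventually_countable_forall.2 fun i => eventually_residual_notMem (hα i) (hS i)
  have h2 : ∀ᶠ z in residual V, ∀ i j, α j e • α i - α i e • α j ≠ 0 →
      (α j e • α i - α i e • α j) z ∉
        Set.image2 (fun x y => α j e * x - α i e * y) (S i) (S j) := by
    refine eventually_countable_forall.2 fun i => eventually_countable_forall.2 fun j => ?_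
    by_cases h : α j e • α i - α i e • α j = 0
    · simp [h]
    · filter_upwards [eventually_residual_notMem h ((hS i).image2 (hS j) _)] with z hz _ using hz
  filter_upwards [h1, h2] with z hz1 hz2
  refine ⟨fun i _ => hz1 i, fun i j t hi hj => ?_⟩
  by_cases h : α j e • α i - α i e • α j = 0
  -- The eliminated form is zero: either `α i` is constant on the line and misses `S i`, or `α i`
  -- and `α j` are proportional.
  · have h' : ∀ x, α j e * α i x = α i e * α j x := fun x => by
      have := congrArg (fun φ : V →L[ℂ] ℂ => φ x) h
      simpa [sub_eq_zero] using this
    by_cases hi0 : α i e = 0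
    · rw [map_add, map_smul, hi0, smul_zero, add_zero] at hi
      exact absurd hi (hz1 i)
    · intro x y
      have hx := h' x
      have hy := h' y
      refine mul_left_cancel₀ hi0 ?_
      linear_combination α i y * hx - α i x * hy
  · refine absurd ⟨_, hi, _, hj, ?_⟩ (hz2 i j h)
    simp only [map_add, map_smul, smul_eq_mul, sub_apply, smul_apply]
    ring

variable {Ψ : V → ℂ}

/-- A generic line is transversal to the hyperplanes it meets, and those met at one point are
parallel; there `hres` says that the restriction of `Ψ` has a removable singularity. -/
theorem exists_entire_extension_line
    (hSd : ∀ i x, ∀ᶠ y in 𝓝[≠] x, y ∉ S i)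
    (hΨ : ∀ z, (∀ i, α i z ∉ S i) → DifferentiableAt ℂ Ψ z)
    (hres : ∀ z e, (∀ i j, α i z ∈ S i → α j z ∈ S j → ∀ x y, α i x * α j y = α i y * α j x) →
      (∀ i, α i z ∈ S i → α i e ≠ 0) →
      Tendsto (fun t : ℂ => t * Ψ (z + t • e)) (𝓝[≠] 0) (𝓝 0))
    {e z : V} (hg : LineGeneric α S e z) :
    ∃ φ : ℂ → ℂ, Differentiable ℂ φ ∧
      (∀ t : ℂ, (∀ i, α i (z + t • e) ∉ S i) → φ t = Ψ (z + t • e)) ∧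
      ∀ t₀ : ℂ, ∀ᶠ t in 𝓝[≠] t₀, ∀ i, α i (z + t • e) ∉ S i := by
  have hline : ∀ t : ℂ, DifferentiableAt ℂ (fun t : ℂ => z + t • e) t := fun t => by fun_prop
  have hoff : ∀ t : ℂ, (∀ i, α i (z + t • e) ∉ S i) →
      DifferentiableAt ℂ (fun t : ℂ => Ψ (z + t • e)) t := fun t ht =>
    (hΨ _ ht).comp t (hline t)
  have hev : ∀ t₀ : ℂ, ∀ᶠ t in 𝓝[≠] t₀, ∀ i, α i (z + t • e) ∉ S i := by
    intro t₀
    refine eventually_all.2 fun i => ?_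
    by_cases hi : α i e = 0
    · refine .of_forall fun t => ?_
      simpa [hi] using hg.1 i hi
    · have : Tendsto (fun t : ℂ => α i (z + t • e)) (𝓝[≠] t₀) (𝓝[≠] (α i (z + t₀ • e))) := by
        refine tendsto_nhdsWithin_iff.2 ⟨?_, ?_⟩
        · have : Continuous fun t : ℂ => α i (z + t • e) := by fun_prop
          exact (this.tendsto t₀).mono_left nhdsWithin_le_nhds
        · filter_upwards [self_mem_nhdsWithin] with t ht h
          simp only [map_add, map_smul, add_right_inj, smul_eq_mul, Set.mem_singleton_iff,
            mul_eq_mul_right_iff, hi, or_false] at h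
          exact ht h
      exact this.eventually (hSd i _)
  obtain ⟨φ, hφ, hφ'⟩ := exists_entire_extension (ψ := fun t : ℂ => Ψ (z + t • e))
    (fun t₀ => (hev t₀).mono hoff) (fun t₀ => by
      have := hres (z + t₀ • e) e (fun i j hi hj => hg.2 i j t₀ hi hj) (fun i hi h0 => by
        have := hg.1 i h0
        rw [map_add, map_smul, h0, smul_zero, add_zero] at hi
        exact this hi)
      simpa only [add_smul, add_assoc] using this)
  exact ⟨φ, hφ, fun t ht => hφ' t (hoff t ht).continuousAt, hev⟩

theorem isClosed_of_eventually_notMem {S : Set ℂ} (hSd : ∀ x, ∀ᶠ y in 𝓝[≠] x, y ∉ S) :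
    IsClosed S := by
  refine isOpen_compl_iff.1 (isOpen_iff_mem_nhds.2 fun x hx => ?_)
  have := hSd x
  rw [eventually_nhdsWithin_iff] at this
  filter_upwards [this] with y hy
  by_cases h : y = x
  · rwa [h]
  · exact hy h

theorem isOpen_forall_notMem (hSd : ∀ i x, ∀ᶠ y in 𝓝[≠] x, y ∉ S i) :
    IsOpen {z | ∀ i, α i z ∉ S i} := by
  rw [Set.ofPred_forall]
  exact isOpen_iInter_of_finite fun i =>
    (isClosed_of_eventually_notMem (hSd i)).isOpen_compl.preimage (α i).continuous

/-- A function with removable singularities in codimension one is locally bounded. -/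
theorem exists_local_bound (hα : ∀ i, α i ≠ 0) (hS : ∀ i, (S i).Countable)
    (hSd : ∀ i x, ∀ᶠ y in 𝓝[≠] x, y ∉ S i)
    (hΨ : ∀ z, (∀ i, α i z ∉ S i) → DifferentiableAt ℂ Ψ z)
    (hres : ∀ z e, (∀ i j, α i z ∈ S i → α j z ∈ S j → ∀ x y, α i x * α j y = α i y * α j x) →
      (∀ i, α i z ∈ S i → α i e ≠ 0) →
      Tendsto (fun t : ℂ => t * Ψ (z + t • e)) (𝓝[≠] 0) (𝓝 0)) (z₀ : V) :
    ∃ M : ℝ, ∀ᶠ z in 𝓝 z₀, (∀ i, α i z ∉ S i) → ‖Ψ z‖ ≤ M := by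
  have : CompleteSpace V := FiniteDimensional.complete ℂ V
  have hopen := isOpen_forall_notMem (α := α) hSd
  -- A direction transversal to all the hyperplanes.
  obtain ⟨e, he⟩ : ∃ e, ∀ i, α i e ∉ ({0} : Set ℂ) := by
    have h1 : ∀ᶠ z in residual V, ∀ i, α i z ∉ ({0} : Set ℂ) :=
      eventually_countable_forall.2 fun i =>
        eventually_residual_notMem (hα i) (Set.countable_singleton 0)
    exact (dense_of_mem_residual h1).nonempty
  simp only [Set.mem_singleton_iff] at he
  -- The line through `z₀` meets the hypersurfaces for countably many parameters only, so some
  -- circle around `0` avoids them. By compactness nearby parallel circles avoid them too, with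
  -- almost the same bound on `Ψ`.
  obtain ⟨r, hr, hrS⟩ : ∃ r : ℝ, 0 < r ∧ ∀ t : ℂ, ‖t‖ = r → ∀ i, α i (z₀ + t • e) ∉ S i := by
    have hT : {t : ℂ | ∃ i, α i (z₀ + t • e) ∈ S i}.Countable := by
      rw [Set.ofPred_exists]
      refine Set.countable_iUnion fun i => ?_
      refine Set.Countable.preimage_of_injOn (hS i) (f := fun t : ℂ => α i (z₀ + t • e)) ?_
      intro t _ t' _ h
      simpa [he i] using h
    obtain ⟨r, hr, hr'⟩ := ((hT.image norm).dense_compl ℝ).exists_mem_open isOpen_Ioi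
      (⟨1, Set.mem_Ioi.2 one_pos⟩ : (Set.Ioi (0 : ℝ)).Nonempty)
    exact ⟨r, hr', fun t ht i hi => hr ⟨t, ⟨i, hi⟩, ht⟩⟩
  have hcont : ∀ t : ℂ, ‖t‖ = r → ContinuousAt Ψ (z₀ + t • e) := fun t ht =>
    (hΨ _ (hrS t ht)).continuousAt
  obtain ⟨B, hB⟩ := (isCompact_sphere (0 : ℂ) r).exists_bound_of_continuousOn
    (f := fun t : ℂ => Ψ (z₀ + t • e)) (fun t ht =>
      (ContinuousAt.comp (f := fun t : ℂ => z₀ + t • e) (hcont t (by simpa using ht))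
        (by fun_prop)).continuousWithinAt)
  have hev : ∀ᶠ z in 𝓝 z₀, ∀ t ∈ Metric.sphere (0 : ℂ) r,
      (∀ i, α i (z + t • e) ∉ S i) ∧ ‖Ψ (z + t • e)‖ < B + 1 := by
    refine (isCompact_sphere (0 : ℂ) r).eventually_forall_of_forall_eventually fun t ht => ?_
    have htr : ‖t‖ = r := by simpa using ht
    have hc : ContinuousAt (fun p : V × ℂ => p.1 + p.2 • e) (z₀, t) := by fun_prop
    refine (hc.eventually (hopen.mem_nhds (hrS t htr))).and
      ((hc.tendsto.eventually ((hcont t htr).norm.eventually_lt_const ?_)))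
    exact (hB t ht).trans_lt (lt_add_one B)
  refine ⟨B + 1, ?_⟩
  -- On a generic line the maximum principle for the entire extension carries the bound from the
  -- circle to its centre.
  have hgood : ∀ z, (∀ t ∈ Metric.sphere (0 : ℂ) r,
      (∀ i, α i (z + t • e) ∉ S i) ∧ ‖Ψ (z + t • e)‖ < B + 1) → LineGeneric α S e z →
      (∀ i, α i z ∉ S i) → ‖Ψ z‖ ≤ B + 1 := by
    intro z hz hg hzS
    obtain ⟨φ, hφ, hφ', -⟩ := exists_entire_extension_line hSd hΨ hres hg
    have h0 : φ 0 = Ψ z := by simpa using hφ' 0 (by simpa using hzS)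
    rw [← h0]
    refine Complex.norm_le_of_forall_mem_frontier_norm_le (U := Metric.ball (0 : ℂ) r)
      Metric.isBounded_ball hφ.diffContOnCl (fun t ht => ?_)
      (subset_closure (Metric.mem_ball_self hr))
    rw [frontier_ball _ hr.ne'] at ht
    rw [hφ' t (hz t ht).1]
    exact (hz t ht).2.le
  filter_upwards [hev.eventually_nhds] with z hz hzS
  -- Generic points are dense, so by continuity the bound holds at every nonsingular point.
  by_contra! hlt
  have h1 : ∀ᶠ z' in 𝓝 z, B + 1 < ‖Ψ z'‖ := (hΨ z hzS).continuousAt.norm.eventually_const_lt hlt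
  have h2 := hopen.mem_nhds hzS
  obtain ⟨O, hO, hOo, hzO⟩ := eventually_nhds_iff.1 ((hz.and h1).and h2)
  obtain ⟨z', hz'g, hz'⟩ := (dense_of_mem_residual
    (eventually_lineGeneric hα hS e)).exists_mem_open hOo ⟨z, hzO⟩
  have := hO z' hz'
  exact absurd (hgood z' this.1.1 hz'g this.2) (not_le.2 this.1.2)

/-- A function on `V` with nontrivial unitary multipliers, whose singularities along hyperplanes
are removable in codimension one, vanishes. -/
theorem eq_zero_of_multipliers (T : TorusAction V) (hα : ∀ i, α i ≠ 0)
    (hS : ∀ i, (S i).Countable) (hSd : ∀ i x, ∀ᶠ y in 𝓝[≠] x, y ∉ S i)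
    (hΨ : ∀ z, (∀ i, α i z ∉ S i) → DifferentiableAt ℂ Ψ z)
    (hres : ∀ z e, (∀ i j, α i z ∈ S i → α j z ∈ S j → ∀ x y, α i x * α j y = α i y * α j x) →
      (∀ i, α i z ∈ S i → α i e ≠ 0) →
      Tendsto (fun t : ℂ => t * Ψ (z + t • e)) (𝓝[≠] 0) (𝓝 0))
    (hZ : ∀ (γ : T.Γ) (z : V), (∀ i, α i z ∉ S i) → ∀ i, α i (z + γ) ∉ S i)
    (u : T.Γ → ℂ) (hu : ∀ γ, ‖u γ‖ = 1)
    (hper : ∀ (γ : T.Γ) (z : V), (∀ i, α i z ∉ S i) → Ψ (z + γ) = u γ * Ψ z)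
    {γ₀ : T.Γ} (hγ₀ : u γ₀ ≠ 1) {z : V} (hz : ∀ i, α i z ∉ S i) : Ψ z = 0 := by
  have : CompleteSpace V := FiniteDimensional.complete ℂ V
  have hopen := isOpen_forall_notMem (α := α) hSd
  -- As `‖u γ‖ = 1`, the norm of `Ψ` descends to the compact torus, where the local bounds become a
  -- global one.
  obtain ⟨M, hM⟩ : ∃ M : ℝ, ∀ z, (∀ i, α i z ∉ S i) → ‖Ψ z‖ ≤ M := by
    choose B hB using exists_local_bound hα hS hSd hΨ hres
    have := T.compactSpace_X
    obtain ⟨t, ht⟩ := isCompact_univ.elim_finite_subcover (ι := V) (X := T.X)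
      (fun z₀ => T.proj '' interior {z | (∀ i, α i z ∉ S i) → ‖Ψ z‖ ≤ B z₀})
      (fun z₀ => T.Γ.isOpenMap_mkQ _ isOpen_interior) (fun x _ => by
        induction x using Submodule.Quotient.induction_on with
        | H z => exact Set.mem_iUnion.2 ⟨z, z, mem_interior_iff_mem_nhds.2 (hB z), rfl⟩)
    obtain ⟨M, hM⟩ := (t.finite_toSet.image B).bddAbove
    refine ⟨M, fun z hz => ?_⟩
    obtain ⟨z₀, hz₀, y, hy, hyz⟩ := Set.mem_iUnion₂.1 (ht (Set.mem_univ (T.proj z)))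
    have hmem : y - z ∈ T.Γ := (T.proj_eq_iff y z).1 hyz
    have hy' := interior_subset hy
    have hyeq : y = z + (⟨y - z, hmem⟩ : T.Γ) := by simp
    have h1 : ‖Ψ y‖ ≤ B z₀ := hy' (by rw [hyeq]; exact hZ _ z hz)
    rw [hyeq, hper _ z hz, norm_mul, hu, one_mul] at h1
    exact h1.trans (hM ⟨z₀, hz₀, rfl⟩)
  -- Liouville on the line in the direction of the period `γ₀`: the extension takes the values `Ψ z`
  -- at `0` and `u γ₀ * Ψ z` at `1`.
  have hgood : ∀ z, LineGeneric α S γ₀ z → (∀ i, α i z ∉ S i) → Ψ z = 0 := by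
    intro z hg hzS
    obtain ⟨φ, hφ, hφ', hev⟩ := exists_entire_extension_line hSd hΨ hres hg
    have hbd : ∀ t, ‖φ t‖ ≤ M := by
      intro t
      refine le_of_tendsto (f := fun s => ‖φ s‖) (x := 𝓝[≠] t)
        ((hφ.continuous.norm.tendsto t).mono_left nhdsWithin_le_nhds) ?_
      filter_upwards [hev t] with s hs
      rw [hφ' s hs]
      exact hM _ hs
    have hconst : φ 0 = φ 1 := hφ.apply_eq_apply_of_bounded
      (isBounded_iff_forall_norm_le.2 ⟨M, by rintro _ ⟨t, rfl⟩; exact hbd t⟩) 0 1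
    rw [hφ' 0 (by simpa using hzS), hφ' 1 (by simpa using hZ γ₀ z hzS), one_smul, zero_smul,
      add_zero, hper γ₀ z hzS] at hconst
    have h : (1 - u γ₀) * Ψ z = 0 := by linear_combination hconst
    exact (mul_eq_zero.1 h).resolve_left (sub_ne_zero.2 hγ₀.symm)
  by_contra hne
  have h1 : ∀ᶠ z' in 𝓝 z, Ψ z' ≠ 0 := (hΨ z hz).continuousAt.eventually_ne hne
  obtain ⟨O, hO, hOo, hzO⟩ := eventually_nhds_iff.1 (h1.and (hopen.mem_nhds hz))
  obtain ⟨z', hz'g, hz'⟩ := (dense_of_mem_residual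
    (eventually_lineGeneric hα hS (γ₀ : V))).exists_mem_open hOo ⟨z, hzO⟩
  exact (hO z' hz').1 (hgood z' hz'g (hO z' hz').2)

end vanishing

namespace TorusAction

variable {V : Type*} [NormedAddCommGroup V] [NormedSpace ℂ V] [FiniteDimensional ℂ V]
  (T : TorusAction V)

/-! ### Geometry of reflection hypertori -/

omit T in
theorem _root_.EllipticDunkl.IsReflection.exists_form {g : V ≃ₗ[ℂ] V} (hg : IsReflection g) :
    ∃ φ : V →L[ℂ] ℂ, φ ≠ 0 ∧ ∀ v, φ v = 0 ↔ g v = v := by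
  set K := LinearMap.ker ((g : V →ₗ[ℂ] V) - LinearMap.id) with hK
  have hmem : ∀ v, v ∈ K ↔ g v = v := fun v => by
    simp [hK, LinearMap.mem_ker, sub_eq_zero]
  have hKne : K ≠ ⊤ := by
    intro h
    have := hg.finrank_fixed
    rw [← hK, h, finrank_top] at this
    omega
  obtain ⟨e, he⟩ : ∃ e, e ∉ K := by
    by_contra! h
    exact hKne ((Submodule.eq_top_iff').2 h)
  obtain ⟨φ, hφe, hφK⟩ := Submodule.exists_dual_map_eq_bot_of_notMem he inferInstance
  have hle : K ≤ LinearMap.ker φ := fun v hv => by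
    have : φ v ∈ K.map φ := ⟨v, hv, rfl⟩
    rw [hφK] at this
    exact this
  have hfr : Module.finrank ℂ (LinearMap.ker φ) + 1 = Module.finrank ℂ V :=
    Module.Dual.finrank_ker_add_one_of_ne_zero (fun h => hφe (by simp [h]))
  have heq : K = LinearMap.ker φ := Submodule.eq_of_le_of_finrank_eq hle (by
    have := hg.finrank_fixed
    rw [← hK] at this
    omega)
  refine ⟨LinearMap.toContinuousLinearMap φ, fun h => hφe ?_, fun v => ?_⟩
  · have := congrArg (fun ψ : V →L[ℂ] ℂ => ψ e) h
    simpa using this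
  · rw [← hmem, heq]
    simp [LinearMap.mem_ker]

omit T in
theorem _root_.EllipticDunkl.exists_transvection_vector {α : V →L[ℂ] ℂ} (hα : α ≠ 0)
    {w : V ≃ₗ[ℂ] V} (hw : ∀ v, α v = 0 → w v = v) : ∃ ε : V, ∀ x, w x = x + α x • ε := by
  obtain ⟨e, he⟩ : ∃ e, α e ≠ 0 := by
    by_contra! h
    exact hα (ContinuousLinearMap.ext h)
  refine ⟨(α e)⁻¹ • (w e - e), fun x => ?_⟩
  have h := hw (x - (α x * (α e)⁻¹) • e) (by simp [he])
  rw [map_sub, map_smul, sub_eq_iff_eq_add] at h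
  rw [h, smul_smul, smul_sub]
  abel

/-- The component of `X^g` through a fixed point is a translate of the image of `V^g`. -/
theorem component_eq (g : T.W) {z : V} (hz : T.proj z ∈ MulAction.fixedBy T.X g) :
    connectedComponentIn (MulAction.fixedBy T.X g) (T.proj z) =
      T.proj '' {y | g.1 (y - z) = y - z} := by
  classical
  refine Set.Subset.antisymm ?_ ?_
  swap
  · rintro _ ⟨y, hy, rfl⟩
    have := T.proj_mem_component g z (y - z) hz hy
    simpa using this
  set A : Set T.X := T.proj '' {y | g.1 (y - z) = y - z} with hA
  have hadd : ∀ y v, g.1 v = v → T.proj y ∈ A → T.proj (y + v) ∈ A := by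
    rintro y v hv ⟨x, hx, hxy⟩
    refine ⟨x + v, ?_, ?_⟩
    · simp only [Set.mem_ofPred_eq] at hx ⊢
      rw [add_sub_right_comm, map_add, hx, hv]
    · rw [proj_eq_iff] at hxy ⊢
      convert hxy using 1
      abel
  -- `A` is open and closed in `X^g`: for nearby fixed points the small vector `g (y - z') - (y -
  -- z')` lies in the discrete group `Γ`, so it is zero.
  have hloc : ∀ x ∈ MulAction.fixedBy T.X g, ∀ᶠ x' in 𝓝[MulAction.fixedBy T.X g] x,
      (x' ∈ A ↔ x ∈ A) := by
    intro x
    induction x using Submodule.Quotient.induction_on with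
    | H z' =>
      intro hz'
      have hc : Continuous fun y : V => (g.1 (y - z') - (y - z')) :=
        ((continuous_lin g.1).comp (by fun_prop)).sub (by fun_prop)
      have h1 : ∀ᶠ y in 𝓝 z', (g.1 (y - z') - (y - z')) ∈ T.Γ →
          g.1 (y - z') - (y - z') = 0 := by
        have := hc.tendsto z'
        simp only [sub_self, map_zero] at this
        exact this.eventually T.eventually_eq_zero_of_mem
      rw [eventually_nhdsWithin_iff]
      filter_upwards [T.Γ.isOpenMap_mkQ.image_mem_nhds h1]
      rintro _ ⟨y, hy, rfl⟩ hyF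
      have hy' := (T.mem_fixedBy_proj g y).1 hyF
      have hz'' := (T.mem_fixedBy_proj g z').1 hz'
      have h2 : g.1 (y - z') - (y - z') ∈ T.Γ := by
        have := T.Γ.sub_mem hy' hz''
        rw [map_sub]
        convert this using 1
        abel
      have h3 : g.1 (y - z') = y - z' := sub_eq_zero.1 (hy h2)
      constructor
      · intro h
        have h4 : g.1 (z' - y) = z' - y := by
          rw [← neg_sub y z', map_neg, h3]
        have := hadd y (z' - y) h4 h
        simpa using this
      · intro h
        have := hadd z' (y - z') h3 h
        simpa using this
  have hpre : IsPreconnected (connectedComponentIn (MulAction.fixedBy T.X g) (T.proj z)) :=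
    isPreconnected_connectedComponentIn
  intro x hx
  have hconst := hpre.constant (f := fun x => decide (x ∈ A)) (fun y hy => by
    have hyF := connectedComponentIn_subset _ _ hy
    refine Tendsto.congr' (f₁ := fun _ => decide (y ∈ A)) ?_ tendsto_const_nhds
    filter_upwards [nhdsWithin_mono _ (connectedComponentIn_subset _ _) (hloc y hyF)] with x' hx'
    simp only [decide_eq_decide]
    exact hx'.symm) hx (mem_connectedComponentIn hz)
  simp only [decide_eq_decide] at hconst
  exact hconst.2 ⟨z, by simp, rfl⟩

variable {T}

theorem gen_mem {H : Set T.X} (hH : T.IsHypertorus H) : T.gen hH ∈ T.WH H :=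
  (T.existsUnique_gen hH).choose_spec.1.1

theorem det_gen {H : Set T.X} (hH : T.IsHypertorus H) :
    LinearMap.det ((T.gen hH).1 : V →ₗ[ℂ] V) = Complex.exp (2 * Real.pi * Complex.I / T.nH H) :=
  (T.existsUnique_gen hH).choose_spec.1.2

theorem eq_gen {H : Set T.X} (hH : T.IsHypertorus H) {w : T.W} (hw : w ∈ T.WH H)
    (hdet : LinearMap.det (w.1 : V →ₗ[ℂ] V) = Complex.exp (2 * Real.pi * Complex.I / T.nH H)) :
    w = T.gen hH :=
  (T.existsUnique_gen hH).choose_spec.2 w ⟨hw, hdet⟩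

theorem det_pow_coe (w : T.W) (j : ℕ) :
    LinearMap.det ((w ^ j).1 : V →ₗ[ℂ] V) = LinearMap.det (w.1 : V →ₗ[ℂ] V) ^ j := by
  rw [← LinearEquiv.coe_det, ← LinearEquiv.coe_det, ← Units.val_pow_eq_pow_val, ← map_pow]
  rfl

theorem Pairs.elt_mem (p : T.Pairs) : p.elt ∈ T.WH p.H := Subgroup.pow_mem _ (gen_mem _) _

theorem Pairs.det_elt_ne_one (p : T.Pairs) : LinearMap.det (p.elt.1 : V →ₗ[ℂ] V) ≠ 1 := by
  have h0 : T.nH p.H ≠ 0 := Nat.card_pos.ne'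
  rw [Pairs.elt, det_pow_coe, det_gen]
  exact (Complex.isPrimitiveRoot_exp _ h0).pow_ne_one_of_pos_of_lt
    (Nat.one_le_iff_ne_zero.1 p.one_le) p.lt

theorem Pairs.elt_ne_one (p : T.Pairs) : p.elt ≠ 1 := by
  intro h
  refine p.det_elt_ne_one ?_
  rw [h]
  exact LinearMap.det_id

theorem Pairs.gen_ne_one (p : T.Pairs) : T.gen p.isHypertorus ≠ 1 := by
  intro h
  refine p.elt_ne_one ?_
  rw [Pairs.elt, h, one_pow]

/-- A hypertorus is the image of an affine hyperplane. -/
theorem Pairs.exists_form (p : T.Pairs) : ∃ (α : V →L[ℂ] ℂ) (z₀ : V), α ≠ 0 ∧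
    (∀ v, α v = 0 ↔ (T.gen p.isHypertorus).1 v = v) ∧
    p.H = T.proj '' {y | α (y - z₀) = 0} := by
  obtain ⟨g, hg, x, hx, hHx⟩ := p.isHypertorus
  obtain ⟨α, hα, hαg⟩ := hg.exists_form
  obtain ⟨z₀, rfl⟩ := Submodule.Quotient.mk_surjective _ x
  have hfix : ∀ v, α v = 0 → (T.gen p.isHypertorus).1 v = v := by
    have hmem : ∀ H', p.H = H' → T.gen p.isHypertorus ∈ T.WH H' := by
      rintro _ rfl
      exact gen_mem _
    exact fun v hv => T.fixes_of_mem_WH g _ hx _ (hmem _ hHx) v ((hαg v).1 hv)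
  refine ⟨α, z₀, hα, fun v => ⟨hfix v, fun hv => ?_⟩, ?_⟩
  -- The generator is the identity on `ker α`; fixing one more direction would make it trivial,
  -- whereas `1 ≤ j < n_H` forces `n_H > 1`.
  · by_contra hv0
    refine p.gen_ne_one (Subtype.ext (LinearEquiv.ext fun y => ?_))
    obtain ⟨ε, hε⟩ := exists_transvection_vector hα hfix
    have h1 := hε v
    rw [hv, left_eq_add, smul_eq_zero] at h1
    rw [hε y, h1.resolve_left hv0, smul_zero, add_zero]
    rfl
  · rw [hHx]
    simp_rw [hαg]
    exact T.component_eq g hx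

/-- A linear form with kernel `V^{g_H}`. -/
noncomputable def Pairs.form (p : T.Pairs) : V →L[ℂ] ℂ := p.exists_form.choose

/-- A point of `V` over `H`. -/
noncomputable def Pairs.base (p : T.Pairs) : V := p.exists_form.choose_spec.choose

theorem Pairs.form_ne_zero (p : T.Pairs) : p.form ≠ 0 := p.exists_form.choose_spec.choose_spec.1

theorem Pairs.form_eq_zero_iff (p : T.Pairs) (v : V) :
    p.form v = 0 ↔ (T.gen p.isHypertorus).1 v = v :=
  p.exists_form.choose_spec.choose_spec.2.1 v

theorem Pairs.H_eq (p : T.Pairs) : p.H = T.proj '' {y | p.form (y - p.base) = 0} :=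
  p.exists_form.choose_spec.choose_spec.2.2

/-- The image of the lattice under the linear form of a hypertorus. -/
noncomputable def Pairs.periods (p : T.Pairs) : Submodule ℤ ℂ :=
  T.Γ.map ((p.form : V →ₗ[ℂ] ℂ).restrictScalars ℤ)

theorem Pairs.mem_periods (p : T.Pairs) (x : ℂ) :
    x ∈ p.periods ↔ ∃ γ ∈ T.Γ, p.form γ = x := by
  simp [Pairs.periods, Submodule.mem_map]

/-- The preimage of `H` in `V` is `{z | p.form z ∈ p.poles}`. -/
def Pairs.poles (p : T.Pairs) : Set ℂ := {x | x - p.form p.base ∈ p.periods}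

theorem Pairs.proj_mem_iff (p : T.Pairs) (z : V) : T.proj z ∈ p.H ↔ p.form z ∈ p.poles := by
  rw [Pairs.poles, Set.mem_ofPred_eq, mem_periods, p.H_eq]
  constructor
  · rintro ⟨y, hy, hyz⟩
    rw [proj_eq_iff] at hyz
    refine ⟨_, T.Γ.neg_mem hyz, ?_⟩
    simp only [Set.mem_ofPred_eq, map_sub, map_neg] at hy ⊢
    linear_combination -hy
  · rintro ⟨γ, hγ, h⟩
    refine ⟨z - γ, ?_, ?_⟩
    · simp only [Set.mem_ofPred_eq, map_sub, h]
      ring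
    · rw [proj_eq_iff]
      simpa using hγ

omit T in
theorem _root_.EllipticDunkl.exists_smul_of_parallel {α β : V →L[ℂ] ℂ} (hα : α ≠ 0)
    (h : ∀ x y, α x * β y = α y * β x) : ∃ c : ℂ, β = c • α := by
  obtain ⟨e, he⟩ : ∃ e, α e ≠ 0 := by
    by_contra! h
    exact hα (ContinuousLinearMap.ext h)
  refine ⟨β e / α e, ContinuousLinearMap.ext fun x => ?_⟩
  have := h e x
  simp only [smul_apply, smul_eq_mul]
  field_simp
  linear_combination this

omit T in
theorem _root_.EllipticDunkl.exists_smul_of_ker_le {α β : V →L[ℂ] ℂ} (hα : α ≠ 0)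
    (h : ∀ x, α x = 0 → β x = 0) : ∃ c : ℂ, β = c • α := by
  refine exists_smul_of_parallel hα fun x y => ?_
  have := h (α x • y - α y • x) (by simp only [map_sub, map_smul, smul_eq_mul]; ring)
  simp only [map_sub, map_smul, smul_eq_mul] at this
  linear_combination this

theorem Pairs.form_eq_zero_of_parallel {p q : T.Pairs}
    (h : ∀ x y, p.form x * q.form y = p.form y * q.form x) {v : V} (hv : p.form v = 0) :
    q.form v = 0 := by
  obtain ⟨c, hc⟩ := exists_smul_of_parallel p.form_ne_zero h
  rw [hc, smul_apply, hv, smul_zero]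

theorem Pairs.elt_fix (p : T.Pairs) {v : V} (hv : p.form v = 0) : p.elt.1 v = v := by
  have h : (T.gen p.isHypertorus).1 v = v := (p.form_eq_zero_iff v).1 hv
  have : ∀ j : ℕ, (T.gen p.isHypertorus ^ j).1 v = v := by
    intro j
    induction j with
    | zero => simp
    | succ j ih =>
      rw [pow_succ]
      change (T.gen p.isHypertorus ^ j).1 ((T.gen p.isHypertorus).1 v) = v
      rw [h, ih]
  exact this p.j

theorem coe_inv_apply_self (w : T.W) (v : V) : (w⁻¹).1 (w.1 v) = v := by
  change ((w⁻¹ * w : T.W)).1 v = v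
  rw [inv_mul_cancel]; rfl

theorem coe_apply_inv_self (w : T.W) (v : V) : w.1 ((w⁻¹).1 v) = v := by
  change ((w * w⁻¹ : T.W)).1 v = v
  rw [mul_inv_cancel]; rfl

theorem Pairs.exists_vector (p : T.Pairs) :
    ∃ ε : V, ε ≠ 0 ∧ ∀ x, (p.elt⁻¹).1 x = x - p.form x • ε := by
  obtain ⟨ε, hε⟩ := exists_transvection_vector p.form_ne_zero (w := (p.elt⁻¹).1) fun v hv => by
    conv_lhs => rw [← p.elt_fix hv]
    exact coe_inv_apply_self _ _
  refine ⟨-ε, ?_, fun x => by rw [hε]; simp⟩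
  rw [neg_ne_zero]
  rintro rfl
  refine p.elt_ne_one ?_
  have : p.elt⁻¹ = 1 := Subtype.ext (LinearEquiv.ext fun y => by rw [hε y]; simp)
  rwa [inv_eq_one] at this

/-- A vector `ε` with `g⁻¹ x = x - α(x) ε`. -/
noncomputable def Pairs.vec (p : T.Pairs) : V := p.exists_vector.choose

theorem Pairs.vec_ne_zero (p : T.Pairs) : p.vec ≠ 0 := p.exists_vector.choose_spec.1

theorem Pairs.elt_inv_apply (p : T.Pairs) (x : V) : (p.elt⁻¹).1 x = x - p.form x • p.vec :=
  p.exists_vector.choose_spec.2 x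

/-- For `x = α(γ)` the vector `x ε` is `γ - g⁻¹ γ`. -/
theorem Pairs.smul_vec_mem (p : T.Pairs) {x : ℂ} (hx : x ∈ p.periods) : x • p.vec ∈ T.Γ := by
  obtain ⟨γ, hγ, rfl⟩ := (p.mem_periods x).1 hx
  have h1 := T.map_mem _ (p.elt⁻¹).2 γ hγ
  rw [p.elt_inv_apply] at h1
  have := T.Γ.sub_mem hγ h1
  simpa using this

/-- A linear form need not map a lattice to a discrete group; here `x ↦ x ε` embeds the periods
continuously into `Γ`. -/
instance (p : T.Pairs) : DiscreteTopology p.periods := by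
  have : DiscreteTopology p.periods.toAddSubgroup := by
    refine discreteTopology_of_isOpen_singleton_zero (isOpen_iff_mem_nhds.2 ?_)
    rintro _ rfl
    have hc : Continuous fun x : p.periods.toAddSubgroup => (x : ℂ) • p.vec := by fun_prop
    have := hc.tendsto 0
    simp only [ZeroMemClass.coe_zero, zero_smul] at this
    filter_upwards [this.eventually T.eventually_eq_zero_of_mem] with x hx
    have h0 := hx (p.smul_vec_mem x.2)
    exact Subtype.ext ((smul_eq_zero.1 h0).resolve_right p.vec_ne_zero)
  exact this

theorem Pairs.eventually_notMem_poles (p : T.Pairs) (x : ℂ) : ∀ᶠ y in 𝓝[≠] x, y ∉ p.poles := by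
  have hcl := isClosed_of_subset_discrete p.periods
    (Set.sdiff_subset (s := (p.periods : Set ℂ)) (t := {x - p.form p.base}))
  have hc : Continuous fun y : ℂ => y - p.form p.base := by fun_prop
  have : ∀ᶠ y in 𝓝 x, y - p.form p.base ∉ (p.periods : Set ℂ) \ {x - p.form p.base} :=
    hc.continuousAt.eventually (hcl.isOpen_compl.mem_nhds fun h => h.2 rfl)
  rw [eventually_nhdsWithin_iff]
  filter_upwards [this] with y hy hyx h
  exact hy ⟨h, fun h' => hyx (by simpa using h')⟩

theorem Pairs.countable_poles (p : T.Pairs) : p.poles.Countable := by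
  have hΓ : (T.Γ : Set V).Countable :=
    Set.countable_coe_iff.1 (inferInstanceAs (Countable T.Γ))
  have h : (p.periods : Set ℂ).Countable := hΓ.image p.form
  exact h.preimage_of_injOn (sub_left_injective.injOn)

theorem Pairs.add_mem_poles_iff (p : T.Pairs) (γ : T.Γ) (z : V) :
    p.form (z + γ) ∈ p.poles ↔ p.form z ∈ p.poles := by
  rw [← p.proj_mem_iff, ← p.proj_mem_iff, proj_add]

/-! ### The action of `W` on hypertori -/

omit T in
theorem _root_.EllipticDunkl.IsReflection.conj {g : V ≃ₗ[ℂ] V} (hg : IsReflection g)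
    (w : V ≃ₗ[ℂ] V) : IsReflection (w * g * w⁻¹) where
  ne_one h := hg.ne_one (by
    have : g = w⁻¹ * (w * g * w⁻¹) * w := by group
    rw [this, h]; group)
  semisimple := by
    refine (LinearEquiv.isSemisimple_iff (g : V →ₗ[ℂ] V) _ w (LinearMap.ext fun x => ?_)).1
      hg.semisimple
    change w (g x) = w (g (w.symm (w x)))
    rw [w.symm_apply_apply]
  finrank_fixed := by
    rw [← hg.finrank_fixed, ← LinearEquiv.finrank_map_eq w
      (LinearMap.ker ((g : V →ₗ[ℂ] V) - LinearMap.id))]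
    refine congrArg (fun K : Submodule ℂ V => Module.finrank ℂ K + 1) ?_
    have hker : ∀ (k : V ≃ₗ[ℂ] V) (x : V),
        x ∈ LinearMap.ker ((k : V →ₗ[ℂ] V) - LinearMap.id) ↔ k x = x := fun k x => by
      simp [LinearMap.mem_ker, sub_eq_zero]
    ext x
    rw [hker, Submodule.mem_map]
    simp only [hker, LinearEquiv.mul_apply, LinearEquiv.coe_coe]
    constructor
    · intro h
      refine ⟨w⁻¹ x, ?_, ?_⟩
      · apply w.injective
        rw [h]
        exact (w.apply_symm_apply x).symm
      · exact w.apply_symm_apply x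
    · rintro ⟨y, hy, rfl⟩
      have : w⁻¹ (w y) = y := w.symm_apply_apply y
      rw [this, hy]

theorem mem_fixedBy_conj (w g : T.W) (z : V) (hz : T.proj z ∈ MulAction.fixedBy T.X g) :
    T.proj (w.1 z) ∈ MulAction.fixedBy T.X (w * g * w⁻¹) := by
  rw [MulAction.mem_fixedBy, ← smul_proj] at *
  rw [mul_smul, mul_smul, inv_smul_smul, hz]

theorem IsHypertorus.smul {H : Set T.X} (hH : T.IsHypertorus H) (w : T.W) :
    T.IsHypertorus (w • H) := by
  obtain ⟨g, hg, x, hx, rfl⟩ := hH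
  obtain ⟨z, rfl⟩ := Submodule.Quotient.mk_surjective _ x
  refine ⟨w * g * w⁻¹, hg.conj w.1, T.proj (w.1 z), mem_fixedBy_conj w g z hx, ?_⟩
  have h1 := T.component_eq g hx
  have h2 := T.component_eq _ (mem_fixedBy_conj w g z hx)
  refine Eq.trans (congrArg (fun A : Set T.X => w • A) h1) (Eq.trans ?_ h2.symm)
  ext a
  constructor
  · rintro ⟨_, ⟨y, hy, rfl⟩, rfl⟩
    refine ⟨w.1 y, ?_, rfl⟩
    change w.1 (g.1 ((w⁻¹).1 (w.1 y - w.1 z))) = w.1 y - w.1 z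
    rw [← map_sub, coe_inv_apply_self]
    exact congrArg w.1 hy
  · rintro ⟨y, hy, rfl⟩
    refine ⟨T.proj ((w⁻¹).1 y), ⟨_, ?_, rfl⟩, ?_⟩
    · change w.1 (g.1 ((w⁻¹).1 (y - w.1 z))) = y - w.1 z at hy
      rw [map_sub, coe_inv_apply_self] at hy
      apply w.1.injective
      rw [hy, map_sub, coe_apply_inv_self]
    · change w • T.proj ((w⁻¹).1 y) = T.proj y
      rw [smul_proj, coe_apply_inv_self]

theorem nH_smul (H : Set T.X) (w : T.W) : T.nH (w • H) = T.nH H := by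
  have h := SubMulAction.fixingSubgroup_map_conj_eq (M := T.W) (s := w • H) (t := H) (g := w) rfl
  rw [nH, nH, WH, WH, ← h]
  exact (Nat.card_congr (Subgroup.equivMapOfInjective _ _ (MulAut.conj w).injective).toEquiv).symm

/-- The conjugate lies in `W_{wH}` and has the same determinant, which characterizes the generator.
-/
theorem gen_smul {H : Set T.X} (hH : T.IsHypertorus H) (w : T.W) :
    T.gen (hH.smul w) = w * T.gen hH * w⁻¹ := by
  refine (eq_gen _ (Set.conj_mem_fixingSubgroup (M := T.W) (g := w) rfl (gen_mem hH)) ?_).symm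
  rw [nH_smul, ← det_gen hH]
  exact LinearMap.det_conj ((T.gen hH).1 : V →ₗ[ℂ] V) w.1

/-- The action of `W` on the set of pairs `(H, j)`. -/
def Pairs.translate (w : T.W) (p : T.Pairs) : T.Pairs where
  H := w • p.H
  isHypertorus := p.isHypertorus.smul w
  j := p.j
  one_le := p.one_le
  lt := by rw [nH_smul]; exact p.lt

theorem Pairs.elt_translate (w : T.W) (p : T.Pairs) :
    (p.translate w).elt = w * p.elt * w⁻¹ := by
  have : (p.translate w).elt = T.gen (p.isHypertorus.smul w) ^ p.j := rfl
  rw [this, gen_smul, conj_pow]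
  rfl

theorem Pairs.translate_mul (w w' : T.W) (p : T.Pairs) :
    (p.translate w').translate w = p.translate (w * w') :=
  Pairs.ext' (smul_smul w w' p.H) rfl

theorem Pairs.translate_one (p : T.Pairs) : p.translate 1 = p := Pairs.ext' (one_smul _ p.H) rfl

theorem Pairs.proj_mem_translate (w : T.W) (p : T.Pairs) (z : V) :
    T.proj z ∈ (p.translate w).H ↔ T.proj ((w⁻¹).1 z) ∈ p.H := by
  change T.proj z ∈ w • p.H ↔ _
  rw [Set.mem_smul_set_iff_inv_smul_mem, smul_proj]

theorem Pairs.form_translate_eq_zero_iff (w : T.W) (p : T.Pairs) (v : V) :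
    (p.translate w).form v = 0 ↔ p.form ((w⁻¹).1 v) = 0 := by
  have : T.gen (p.translate w).isHypertorus = w * T.gen p.isHypertorus * w⁻¹ :=
    gen_smul p.isHypertorus w
  rw [form_eq_zero_iff, form_eq_zero_iff, this]
  change w.1 ((T.gen p.isHypertorus).1 ((w⁻¹).1 v)) = v ↔ _
  constructor
  · intro h
    apply w.1.injective
    rw [h, coe_apply_inv_self]
  · intro h
    rw [h, coe_apply_inv_self]

theorem Pairs.sub_elt_inv_mem (p : T.Pairs) {z : V} (hz : T.proj z ∈ p.H) :
    z - (p.elt⁻¹).1 z ∈ T.Γ := by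
  rw [← proj_eq_iff, ← smul_proj]
  exact ((mem_fixingSubgroup_iff _).1 (Subgroup.inv_mem _ p.elt_mem) _ hz).symm

end TorusAction
namespace TorusAction.LineBundle

open TorusAction

variable {V : Type*} [NormedAddCommGroup V] [NormedSpace ℂ V] [FiniteDimensional ℂ V]
  {T : TorusAction V}

/-! ### Reduction of a flat connection to a unitary local system -/

/-- A real additive function on the lattice is the real part of a complex linear form. -/
theorem exists_form_re_eq (ℓ : T.Γ →+ ℝ) : ∃ c : V →L[ℂ] ℂ, ∀ γ : T.Γ, (c γ).re = ℓ γ := by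
  have : FiniteDimensional ℝ V := FiniteDimensional.complexToReal V
  have : Module.Free ℤ T.Γ := ZLattice.module_free ℝ T.Γ
  let b := Module.Free.chooseBasis ℤ T.Γ
  let B := b.ofZLatticeBasis ℝ T.Γ
  -- A ℤ-basis of `Γ` is an ℝ-basis of `V`, so `ℓ` extends real-linearly; a real form is the real
  -- part of a complex one.
  let R : V →ₗ[ℝ] ℝ := B.constr ℝ fun i => ℓ (b i)
  have hR : (R.restrictScalars ℤ).comp T.Γ.subtype = ℓ.toIntLinearMap := by
    refine b.ext fun i => ?_
    have : (b i : V) = B i := (b.ofZLatticeBasis_apply ℝ T.Γ i).symm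
    simp only [LinearMap.comp_apply, Submodule.subtype_apply, LinearMap.restrictScalars_apply, this]
    simp [R]
  refine ⟨LinearMap.toContinuousLinearMap (Module.Dual.extendRCLike (𝕜 := ℂ) R), fun γ => ?_⟩
  have h1 := LinearMap.congr_fun hR γ
  simp only [LinearMap.comp_apply, Submodule.subtype_apply, LinearMap.restrictScalars_apply,
    AddMonoidHom.coe_toIntLinearMap] at h1
  rw [← h1]
  simp [Module.Dual.extendRCLike_apply]

/-- A gauge transformation `φ` which turns the multipliers of `L` into a unitary character `u` of
the lattice and the connection into a constant form `c`. -/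
structure UnitaryGauge (L : T.LineBundle) where
  φ : V → ℂ
  u : V → ℂ
  c : V →L[ℂ] ℂ
  analytic : ∀ z, AnalyticAt ℂ φ z
  ne_zero : ∀ z, φ z ≠ 0
  norm_u : ∀ γ ∈ T.Γ, ‖u γ‖ = 1
  u_add : ∀ γ ∈ T.Γ, ∀ γ' ∈ T.Γ, u (γ + γ') = u γ * u γ'
  mul_eq : ∀ (γ : T.Γ) z, L.χ γ z * φ z = u γ * φ (z + γ)

/-- With `ψ` a primitive of the connection form, `exp (-ψ)` is a flat frame, so the automorphy
factor becomes a character `lam` of `Γ`. Its logarithmic modulus is additive, hence equals `Re c` on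
`Γ` for a linear form `c`; the extra factor `exp c` makes the character unitary at the price of a
constant connection form. -/
theorem exists_unitaryGauge (L : T.LineBundle) (conn : L.FlatConnection) :
    ∃ G : L.UnitaryGauge, ∀ z v, fderiv ℂ G.φ z v = (G.c v - conn.form z v) * G.φ z := by
  obtain ⟨ψ, hψa, hψ⟩ := exists_primitive conn.analytic conn.flat
  -- The differential vanishes: this is `conn.transform` multiplied by the exponential.
  have hconst : ∀ (γ : T.Γ) z, L.χ γ z * Complex.exp (ψ (z + γ) - ψ z) =
      L.χ γ 0 * Complex.exp (ψ (0 + γ) - ψ 0) := by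
    intro γ z
    have hd : ∀ y, HasFDerivAt (fun y => L.χ γ y * Complex.exp (ψ (y + γ) - ψ y))
        (L.χ γ y • (Complex.exp (ψ (y + γ) - ψ y) • (conn.form (y + γ) - conn.form y)) +
          Complex.exp (ψ (y + γ) - ψ y) • fderiv ℂ (L.χ γ) y) y := by
      intro y
      have h1 : HasFDerivAt (fun y => ψ (y + γ)) (conn.form (y + γ)) y :=
        (hasFDerivAt_comp_add_right (γ : V)).2 (hψ (y + γ))
      exact (L.analytic γ y trivial).differentiableAt.hasFDerivAt.mul (h1.sub (hψ y)).cexp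
    refine is_const_of_fderiv_eq_zero (𝕜 := ℂ) (fun y => (hd y).differentiableAt) (fun y => ?_) z 0
    rw [(hd y).fderiv]
    ext v
    simp only [add_apply, smul_apply, sub_apply, smul_eq_mul, zero_apply]
    linear_combination Complex.exp (ψ (y + γ) - ψ y) * conn.transform γ y v
  set lam : T.Γ → ℂ := fun γ => L.χ γ 0 * Complex.exp (ψ (0 + γ) - ψ 0) with hlam
  have hlam0 : ∀ γ, lam γ ≠ 0 := fun γ => mul_ne_zero (L.ne_zero _ _) (Complex.exp_ne_zero _)
  have hadd : ∀ γ γ', lam (γ + γ') = lam γ * lam γ' := by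
    intro γ γ'
    have h1 := hconst γ ((0 : V) + γ')
    have h2 : lam (γ + γ') = L.χ (γ + γ') 0 * Complex.exp (ψ (0 + ((γ + γ' : T.Γ) : V)) - ψ 0) :=
      rfl
    have h3 : lam γ' = L.χ γ' 0 * Complex.exp (ψ (0 + γ') - ψ 0) := rfl
    have h4 : (0 : V) + ((γ + γ' : T.Γ) : V) = 0 + γ' + γ := by
      simp [add_comm]
    rw [h2, L.cocycle, h4, h3, show lam γ = _ from h1.symm,
      show ψ (0 + γ' + γ) - ψ 0 = (ψ (0 + γ' + γ) - ψ (0 + γ')) + (ψ (0 + γ') - ψ 0) by ring,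
      Complex.exp_add]
    ring
  let ℓ : T.Γ →+ ℝ := AddMonoidHom.mk' (fun γ => Real.log ‖lam γ‖) fun γ γ' => by
    rw [hadd, norm_mul, Real.log_mul (norm_ne_zero_iff.2 (hlam0 _)) (norm_ne_zero_iff.2 (hlam0 _))]
  obtain ⟨c, hc⟩ := exists_form_re_eq ℓ
  classical
  let u : V → ℂ := fun v => if h : v ∈ T.Γ then lam ⟨v, h⟩ * Complex.exp (-c v) else 0
  have hu : ∀ γ (h : γ ∈ T.Γ), u γ = lam ⟨γ, h⟩ * Complex.exp (-c γ) := fun γ h => dif_pos h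
  have hφ : ∀ z, HasFDerivAt (fun z => Complex.exp (c z - ψ z))
      (Complex.exp (c z - ψ z) • (c - conn.form z)) z := fun z => (c.hasFDerivAt.sub (hψ z)).cexp
  refine ⟨{ φ := fun z => Complex.exp (c z - ψ z)
            u := u
            c := c
            analytic := fun z => ((c.analyticAt z).sub (hψa z trivial)).cexp
            ne_zero := fun z => Complex.exp_ne_zero _
            norm_u := ?_
            u_add := ?_
            mul_eq := ?_ }, ?_⟩
  · intro γ h
    have h1 : (c γ).re = Real.log ‖lam ⟨γ, h⟩‖ := hc ⟨γ, h⟩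
    rw [hu γ h, norm_mul, Complex.norm_exp, Complex.neg_re, h1, Real.exp_neg,
      Real.exp_log (norm_pos_iff.2 (hlam0 _)), mul_inv_cancel₀ (norm_ne_zero_iff.2 (hlam0 _))]
  · intro γ h γ' h'
    have h1 : lam ⟨γ + γ', T.Γ.add_mem h h'⟩ = lam ⟨γ, h⟩ * lam ⟨γ', h'⟩ := hadd ⟨γ, h⟩ ⟨γ', h'⟩
    rw [hu γ h, hu γ' h', hu _ (T.Γ.add_mem h h'), h1, map_add, neg_add, Complex.exp_add]
    ring
  · intro γ z
    have h1 : L.χ γ z * Complex.exp (ψ (z + γ) - ψ z) = lam γ := hconst γ z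
    rw [hu γ γ.2, show (⟨γ, γ.2⟩ : T.Γ) = γ from rfl, ← h1, mul_assoc, mul_assoc, ← Complex.exp_add,
      ← Complex.exp_add, map_add]
    congr 2
    ring
  · intro z v
    simp only
    rw [(hφ z).fderiv]
    simp only [smul_apply, sub_apply, smul_eq_mul]
    ring

namespace UnitaryGauge

variable {L : T.LineBundle} (G : L.UnitaryGauge)

theorem u_ne_zero {γ : V} (h : γ ∈ T.Γ) : G.u γ ≠ 0 :=
  norm_pos_iff.1 (by rw [G.norm_u γ h]; exact one_pos)

theorem u_sub {γ γ' : V} (h : γ ∈ T.Γ) (h' : γ' ∈ T.Γ) : G.u (γ - γ') = G.u γ / G.u γ' := by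
  have := G.u_add (γ - γ') (T.Γ.sub_mem h h') γ' h'
  rw [sub_add_cancel] at this
  rw [this, mul_div_assoc, div_self (G.u_ne_zero h'), mul_one]

theorem χ_eq (γ : T.Γ) (z : V) : L.χ γ z = G.u γ * G.φ (z + γ) / G.φ z := by
  rw [← G.mul_eq, mul_div_assoc, div_self (G.ne_zero z), mul_one]

/-- The multipliers of `(L^w)^* ⊗ L`. -/
theorem homBundle_χ_eq (w : T.W) (γ : T.Γ) (z : V) :
    ((L.twist w).homBundle L).χ γ z * (G.φ z / G.φ ((w⁻¹).1 z)) =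
      G.u (γ - (w⁻¹).1 γ) * (G.φ (z + γ) / G.φ ((w⁻¹).1 (z + γ))) := by
  have hγ := T.map_mem _ (w⁻¹).2 γ.1 γ.2
  have h1 : ((L.twist w).homBundle L).χ γ z =
      (L.χ (T.latticeAct w⁻¹ γ) ((w⁻¹).1 z))⁻¹ * L.χ γ z := rfl
  have h2 : ((T.latticeAct w⁻¹ γ : T.Γ) : V) = (w⁻¹).1 γ := rfl
  rw [h1, G.χ_eq, G.χ_eq, G.u_sub γ.2 hγ, h2, map_add]
  have := G.ne_zero z
  have := G.ne_zero ((w⁻¹).1 z)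
  have := G.ne_zero ((w⁻¹).1 z + (w⁻¹).1 γ)
  have := G.u_ne_zero hγ
  field_simp

theorem analyticAt_ratio (w : T.W) (z : V) :
    AnalyticAt ℂ (fun z => G.φ z / G.φ ((w⁻¹).1 z)) z :=
  (G.analytic z).div ((G.analytic _).comp (analytic_lin (w⁻¹).1 z trivial)) (G.ne_zero _)

/-- If this character were trivial, `φ / (φ ∘ w⁻¹)` would be a nowhere vanishing holomorphic section
of `(L^w)^* ⊗ L`. -/
theorem exists_u_ne_one (hL : L.HasTrivialStabilizer) {w : T.W} (hw : w ≠ 1) :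
    ∃ γ ∈ T.Γ, G.u (γ - (w⁻¹).1 γ) ≠ 1 := by
  by_contra! h
  refine hL w hw ⟨fun z => G.φ z / G.φ ((w⁻¹).1 z), fun z _ => G.analyticAt_ratio w z,
    fun z => div_ne_zero (G.ne_zero _) (G.ne_zero _), fun γ z => ?_⟩
  rw [G.homBundle_χ_eq, h γ γ.2, one_mul]

/-! ### Construction of the sections `f_{H,j}` -/

/-- The scalar function `K` with `f_{H,j} = (φ / φ ∘ g⁻¹) K • α`. -/
structure IsKernel (p : T.Pairs) (K : V → ℂ) : Prop where
  analytic : ∀ z, p.form z ∉ p.poles → AnalyticAt ℂ K z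
  periodic : ∀ γ ∈ T.Γ, ∀ z, K (z + γ) = G.u (γ - (p.elt⁻¹).1 γ) * K z
  residue : ∀ z₀, p.form z₀ ∈ p.poles → ∃ b : V → ℂ, AnalyticAt ℂ b z₀ ∧
    b z₀ = G.u (z₀ - (p.elt⁻¹).1 z₀) ∧
      ∀ᶠ z in 𝓝 z₀, p.form (z - z₀) ≠ 0 → K z = b z / p.form (z - z₀)
  zero_on : ∀ z, p.form z ∈ p.poles → K z = 0
  add_of_form_eq_zero : ∀ z v, p.form v = 0 → K (z + v) = K z

/-- Since `γ - g⁻¹ γ = α(γ) ε`, the required multiplier is a character of the group of periods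
`α(Γ)`, nontrivial by `exists_u_ne_one`; the one-variable function of `exists_kronecker_function`,
composed with `α`, then does the job. -/
theorem exists_isKernel (hL : L.HasTrivialStabilizer) (p : T.Pairs) :
    ∃ K : V → ℂ, G.IsKernel p K := by
  classical
  have hvec : ∀ γ, γ - (p.elt⁻¹).1 γ = p.form γ • p.vec := fun γ => by
    rw [p.elt_inv_apply]; abel
  obtain ⟨γ₀, hγ₀, hne⟩ := G.exists_u_ne_one hL p.elt_ne_one
  rw [hvec] at hne
  obtain ⟨F, R, hF, hFper, hR, hFR⟩ := exists_kronecker_function p.periods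
    (fun x => G.u ((x : ℂ) • p.vec))
    (fun a b => by
      simp only [Submodule.coe_add, add_smul]
      exact G.u_add _ (p.smul_vec_mem a.2) _ (p.smul_vec_mem b.2))
    (fun a => G.norm_u _ (p.smul_vec_mem a.2))
    (b₀ := ⟨p.form γ₀, (p.mem_periods _).2 ⟨γ₀, hγ₀, rfl⟩⟩) hne
  have hbase : T.proj p.base ∈ p.H := by
    rw [p.proj_mem_iff, Pairs.poles, Set.mem_ofPred_eq, sub_self]
    exact Submodule.zero_mem _
  have hbΓ := p.sub_elt_inv_mem hbase
  rw [hvec] at hbΓ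
  -- Near a point with `α(z₀) = α(base) + a` the function `F` has residue `u (a ε)`. The constant
  -- factor completes it to `u (α(z₀) ε) = u (z₀ - g⁻¹ z₀)`; it is a value of `u` on `Γ` because
  -- `base` lies over `H`.
  refine ⟨fun z => if p.form z ∈ p.poles then 0 else
    G.u (p.form p.base • p.vec) * F (p.form z - p.form p.base), ?_, ?_, ?_, ?_, ?_⟩
  · intro z hz
    have h1 : AnalyticAt ℂ (fun z => G.u (p.form p.base • p.vec) * F (p.form z - p.form p.base)) z :=
      analyticAt_const.mul (AnalyticAt.fun_comp (hF _ hz) ((p.form.analyticAt z).sub analyticAt_const))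
    refine h1.congr ?_
    have hcl := isClosed_of_eventually_notMem p.eventually_notMem_poles
    filter_upwards [p.form.continuous.continuousAt.eventually (hcl.isOpen_compl.mem_nhds hz)] with y hy
    rw [if_neg hy]
  · intro γ hγ z
    have hmem : p.form γ ∈ p.periods := (p.mem_periods _).2 ⟨γ, hγ, rfl⟩
    have h1 := p.add_mem_poles_iff ⟨γ, hγ⟩ z
    simp only at h1
    simp only [h1]
    split_ifs with h
    · rw [mul_zero]
    · have h2 := hFper ⟨p.form γ, hmem⟩ (p.form z - p.form p.base)
      simp only at h2
      rw [map_add, add_sub_right_comm, h2, hvec]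
      ring
  · intro z₀ hz₀
    set a := p.form z₀ - p.form p.base with ha
    have ha' : a ∈ p.periods := hz₀
    refine ⟨fun z => G.u (p.form p.base • p.vec) * G.u (a • p.vec) *
      (1 + p.form (z - z₀) * R (p.form (z - z₀))), ?_, ?_, ?_⟩
    · have h1 : AnalyticAt ℂ (fun z => p.form (z - z₀)) z₀ :=
        (p.form.analyticAt _).fun_comp (analyticAt_id.sub analyticAt_const)
      have h2 : AnalyticAt ℂ (fun z => R (p.form (z - z₀))) z₀ :=
        AnalyticAt.fun_comp (g := R) (by simpa using hR) h1
      exact analyticAt_const.mul (analyticAt_const.add (h1.mul h2))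
    · simp only
      rw [sub_self, map_zero, zero_mul, add_zero, mul_one, ← G.u_add _ hbΓ _ (p.smul_vec_mem ha'),
        ← add_smul, hvec, ha, add_sub_cancel]
    · have h1 := p.eventually_notMem_poles (p.form z₀)
      rw [eventually_nhdsWithin_iff] at h1
      filter_upwards [p.form.continuous.continuousAt.eventually h1] with z hz hne
      have hne' : p.form z ≠ p.form z₀ := fun h => hne (by rw [map_sub, h, sub_self])
      rw [if_neg (hz hne')]
      have h2 : p.form z - p.form p.base = p.form (z - z₀) + a := by rw [ha, map_sub]; ring
      have h3 := hFper ⟨a, ha'⟩ (p.form (z - z₀))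
      simp only at h3
      rw [h2, h3, hFR]
      field_simp
  · intro z hz
    exact if_pos hz
  · intro z v hv
    simp only [map_add, hv, add_zero]

end UnitaryGauge

end TorusAction.LineBundle
-- Residues along lines, and uniqueness of the sections `f_{H,j}`.
theorem tendsto_mul_of_simple_pole {V : Type*} [NormedAddCommGroup V] [NormedSpace ℂ V]
    {K b : V → ℂ} {α : V →L[ℂ] ℂ} {z₀ e : V} (hb : ContinuousAt b z₀) (he : α e ≠ 0)
    (hev : ∀ᶠ z in 𝓝 z₀, α (z - z₀) ≠ 0 → K z = b z / α (z - z₀)) :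
    Tendsto (fun t : ℂ => t * K (z₀ + t • e)) (𝓝[≠] 0) (𝓝 (b z₀ / α e)) := by
  have hline : Tendsto (fun t : ℂ => z₀ + t • e) (𝓝[≠] 0) (𝓝 z₀) := by
    have : Continuous fun t : ℂ => z₀ + t • e := by fun_prop
    have := this.tendsto 0
    simp only [zero_smul, add_zero] at this
    exact this.mono_left nhdsWithin_le_nhds
  have h1 : Tendsto (fun t : ℂ => b (z₀ + t • e) / α e) (𝓝[≠] 0) (𝓝 (b z₀ / α e)) :=
    (hb.tendsto.comp hline).div_const _
  refine h1.congr' ?_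
  filter_upwards [hline.eventually hev, self_mem_nhdsWithin] with t ht ht0
  have ht0' : t ≠ 0 := ht0
  rw [add_sub_cancel_left, map_smul, smul_eq_mul] at ht
  rw [ht (mul_ne_zero ht0' he)]
  field_simp

theorem tendsto_mul_of_continuousAt {V : Type*} [NormedAddCommGroup V] [NormedSpace ℂ V]
    {K : V → ℂ} {z₀ : V} (hK : ContinuousAt K z₀) (e : V) :
    Tendsto (fun t : ℂ => t * K (z₀ + t • e)) (𝓝[≠] 0) (𝓝 0) := by
  have hc : ContinuousAt (fun t : ℂ => t * K (z₀ + t • e)) 0 := by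
    refine continuousAt_id.mul (ContinuousAt.comp (f := fun t : ℂ => z₀ + t • e) ?_ (by fun_prop))
    simpa using hK
  have := hc.tendsto
  rw [zero_mul] at this
  exact this.mono_left nhdsWithin_le_nhds

namespace TorusAction.LineBundle

open TorusAction

variable {V : Type*} [NormedAddCommGroup V] [NormedSpace ℂ V] [FiniteDimensional ℂ V]
  {T : TorusAction V} {L : T.LineBundle}

/-- The ratio `α v / α e` is unchanged by rescaling `α`, so the limit depends on `L` and `p` only:
any two Dunkl sections have equal residues. -/
theorem IsDunklSection.tendsto_residue {p : T.Pairs} {f : V → V →L[ℂ] ℂ}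
    (hf : L.IsDunklSection p f) {z₀ : V} (hz₀ : T.proj z₀ ∈ p.H) {e : V} (he : p.form e ≠ 0)
    (v : V) : Tendsto (fun t : ℂ => t * f (z₀ + t • e) v) (𝓝[≠] 0)
      (𝓝 (L.χ ⟨_, p.sub_elt_inv_mem hz₀⟩ ((p.elt⁻¹).1 z₀) * (p.form v / p.form e))) := by
  obtain ⟨α, hα, hαV, b, hb, hbz, hev⟩ := hf.residue z₀ hz₀
  obtain ⟨k, rfl⟩ := exists_smul_of_ker_le p.form_ne_zero
    (β := α) fun x hx => hαV x ((p.form_eq_zero_iff x).1 hx)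
  have hk : k ≠ 0 := fun h => hα (ContinuousLinearMap.ext fun x => by simp [h])
  have he' : (k • p.form) e ≠ 0 := mul_ne_zero hk he
  have h := tendsto_mul_of_simple_pole (K := fun z => f z v)
    (b := fun z => b z * (k • p.form) v) (hb.continuousAt.mul continuousAt_const) he' (by
      filter_upwards [hev] with z hz hne
      rw [hz hne, smul_apply, smul_eq_mul]
      ring)
  convert h using 2
  rw [hbz ⟨_, p.sub_elt_inv_mem hz₀⟩ (by simp)]
  simp only [smul_apply, smul_eq_mul]
  field_simp

namespace UnitaryGauge

theorem IsKernel.isDunklSection {G : L.UnitaryGauge} {p : T.Pairs} {K : V → ℂ}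
    (hK : G.IsKernel p K) :
    L.IsDunklSection p fun z => (G.φ z / G.φ ((p.elt⁻¹).1 z) * K z) • p.form where
  analytic z hz := by
    rw [p.proj_mem_iff] at hz
    exact ((G.analyticAt_ratio p.elt z).mul (hK.analytic z hz)).smul analyticAt_const
  periodic γ z := by
    rw [hK.periodic γ γ.2, smul_smul, ← mul_assoc (((L.twist p.elt).homBundle L).χ γ z),
      G.homBundle_χ_eq]
    congr 1
    ring
  mem_VH z v hv := by
    rw [smul_apply, (p.form_eq_zero_iff v).2 hv, smul_zero]
  residue z₀ hz₀ := by
    rw [p.proj_mem_iff] at hz₀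
    obtain ⟨b, hb, hbz, hev⟩ := hK.residue z₀ hz₀
    refine ⟨p.form, p.form_ne_zero, fun v hv => (p.form_eq_zero_iff v).2 hv,
      fun z => G.φ z / G.φ ((p.elt⁻¹).1 z) * b z, (G.analyticAt_ratio p.elt z₀).mul hb, ?_, ?_⟩
    · intro γ hγ
      have h1 : z₀ - (p.elt⁻¹).1 z₀ = γ := sub_eq_of_eq_add' hγ
      simp only
      rw [hbz, h1, G.χ_eq, ← hγ]
      ring
    · filter_upwards [hev] with z hz hne
      rw [hz hne, mul_div_assoc]
  zero_on z hz := by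
    rw [p.proj_mem_iff] at hz
    ext x
    simp [hK.zero_on z hz]

/-- The residues of the difference cancel; divided by `φ / (φ ∘ g⁻¹)` it has the nontrivial unitary
multipliers `u (γ - g⁻¹ γ)`, and `eq_zero_of_multipliers` applies. -/
theorem isDunklSection_unique (G : L.UnitaryGauge) (hL : L.HasTrivialStabilizer) {p : T.Pairs}
    {f₁ f₂ : V → V →L[ℂ] ℂ} (h₁ : L.IsDunklSection p f₁) (h₂ : L.IsDunklSection p f₂) :
    f₁ = f₂ := by
  obtain ⟨γ₀, hγ₀, hne⟩ := G.exists_u_ne_one hL p.elt_ne_one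
  funext z
  by_cases hz : T.proj z ∈ p.H
  · rw [h₁.zero_on z hz, h₂.zero_on z hz]
  ext v
  have happ : ∀ {f : V → V →L[ℂ] ℂ}, L.IsDunklSection p f → ∀ z, T.proj z ∉ p.H →
      DifferentiableAt ℂ (fun z => f z v) z := fun hf z hz =>
    (hf.analytic z hz).differentiableAt.clm_apply (differentiableAt_const v)
  have hr : ∀ z, DifferentiableAt ℂ (fun z => G.φ ((p.elt⁻¹).1 z) / G.φ z) z := fun z =>
    (((G.analytic _).comp (analytic_lin (p.elt⁻¹).1 z trivial)).div (G.analytic z)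
      (G.ne_zero z)).differentiableAt
  have hd : ∀ z, T.proj z ∉ p.H → DifferentiableAt ℂ (fun z => f₁ z v - f₂ z v) z := fun z hz =>
    (happ h₁ z hz).sub (happ h₂ z hz)
  have hzero := eq_zero_of_multipliers (ι := Unit) (α := fun _ => p.form) (S := fun _ => p.poles)
    (Ψ := fun z => (f₁ z v - f₂ z v) * (G.φ ((p.elt⁻¹).1 z) / G.φ z)) T
    (fun _ => p.form_ne_zero) (fun _ => p.countable_poles) (fun _ => p.eventually_notMem_poles)
    (fun z hz => (hd z (fun h => hz () ((p.proj_mem_iff z).1 h))).mul (hr z))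
    (fun z e _ he => by
      by_cases hzp : T.proj z ∈ p.H
      · have he' := he () ((p.proj_mem_iff z).1 hzp)
        have h := (h₁.tendsto_residue hzp he' v).sub (h₂.tendsto_residue hzp he' v)
        rw [sub_self] at h
        have hline : Tendsto (fun t : ℂ => z + t • e) (𝓝[≠] 0) (𝓝 z) := by
          have : Continuous fun t : ℂ => z + t • e := by fun_prop
          have := this.tendsto 0
          simp only [zero_smul, add_zero] at this
          exact this.mono_left nhdsWithin_le_nhds
        have h' := h.mul ((hr z).continuousAt.tendsto.comp hline)
        rw [zero_mul] at h'
        refine h'.congr fun t => ?_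
        simp only [Function.comp]
        ring
      · exact tendsto_mul_of_continuousAt ((hd z hzp).mul (hr z)).continuousAt e)
    (fun γ z hz i => by rw [p.add_mem_poles_iff]; exact hz i)
    (fun γ => G.u (γ - (p.elt⁻¹).1 γ))
    (fun γ => G.norm_u _ (T.Γ.sub_mem γ.2 (T.map_mem _ (p.elt⁻¹).2 γ γ.2)))
    (fun γ z _ => by
      have h := G.homBundle_χ_eq p.elt γ z
      simp only [h₁.periodic γ z, h₂.periodic γ z, smul_apply, smul_eq_mul]
      have := G.ne_zero z
      have := G.ne_zero (z + γ)
      have := G.ne_zero ((p.elt⁻¹).1 z)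
      have := G.ne_zero ((p.elt⁻¹).1 (z + γ))
      field_simp at h ⊢
      linear_combination (f₁ z v - f₂ z v) * h)
    (γ₀ := ⟨γ₀, hγ₀⟩) hne (z := z) (fun _ h => hz ((p.proj_mem_iff z).2 h))
  exact sub_eq_zero.1 ((mul_eq_zero.1 hzero).resolve_right
    (div_ne_zero (G.ne_zero _) (G.ne_zero _)))

theorem existsUnique_isDunklSection (G : L.UnitaryGauge) (hL : L.HasTrivialStabilizer) (p : T.Pairs) :
    ∃! f : V → (V →L[ℂ] ℂ), L.IsDunklSection p f := by
  obtain ⟨K, hK⟩ := G.exists_isKernel hL p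
  exact ⟨_, hK.isDunklSection, fun f hf => G.isDunklSection_unique hL hf hK.isDunklSection⟩

theorem IsKernel.dunklSection_eq {G : L.UnitaryGauge} (hL : L.HasTrivialStabilizer)
    {p : T.Pairs} {K : V → ℂ} (hK : G.IsKernel p K) :
    L.dunklSection p = fun z => (G.φ z / G.φ ((p.elt⁻¹).1 z) * K z) • p.form := by
  have hex : ∃ f, L.IsDunklSection p f := ⟨_, hK.isDunklSection⟩
  refine G.isDunklSection_unique hL ?_ hK.isDunklSection
  rw [dunklSection, dif_pos hex]
  exact hex.choose_spec

end UnitaryGauge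

end TorusAction.LineBundle
-- Cancellation of residues in the commutator.
namespace TorusAction

variable {V : Type*} [NormedAddCommGroup V] [NormedSpace ℂ V] [FiniteDimensional ℂ V]
  {T : TorusAction V}

theorem Pairs.form_mem_poles_translate (w : T.W) (p : T.Pairs) (z : V) :
    (p.translate w).form z ∈ (p.translate w).poles ↔ p.form ((w⁻¹).1 z) ∈ p.poles := by
  rw [← proj_mem_iff, ← proj_mem_iff, proj_mem_translate]

/-- The forms of `H` and of `g H'` are parallel only if those of `H` and `H'` are, for `g`
a reflection along `H`. -/
theorem Pairs.wedge_eq_zero_of_translate {p q : T.Pairs}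
    (h : ∀ x y, p.form x * (q.translate p.elt).form y = p.form y * (q.translate p.elt).form x)
    (u v : V) : p.form u * q.form v - p.form v * q.form u = 0 := by
  obtain ⟨k, hk⟩ := exists_smul_of_ker_le p.form_ne_zero (β := q.form) fun x hx => by
    have h1 := (form_translate_eq_zero_iff p.elt q x).1 (form_eq_zero_of_parallel h hx)
    rwa [p.elt_inv_apply, hx, zero_smul, sub_zero] at h1
  rw [hk]
  simp only [smul_apply, smul_eq_mul]
  ring

/-- Here the inverse of `q.elt` is `p.elt`, which fixes `ker p.form`; so `q.form` vanishes there and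
the two forms are proportional. -/
theorem Pairs.wedge_eq_zero_of_mul_eq_one {p q : T.Pairs} (h : p.elt * q.elt = 1) (u v : V) :
    p.form u * q.form v - p.form v * q.form u = 0 := by
  obtain ⟨k, hk⟩ := exists_smul_of_ker_le p.form_ne_zero (β := q.form) fun x hx => by
    have h1 := q.elt_inv_apply x
    rw [← eq_inv_of_mul_eq_one_left h, p.elt_fix hx] at h1
    exact (smul_eq_zero.1 (sub_eq_self.1 h1.symm)).resolve_right q.vec_ne_zero
  rw [hk]
  simp only [smul_apply, smul_eq_mul]
  ring

/-- The form of `g⁻¹ H` for a reflection `g` along `H'`. -/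
theorem Pairs.exists_form_translate_inv (p q : T.Pairs) :
    ∃ k m : ℂ, k ≠ 0 ∧ (∀ x, (p.translate q.elt⁻¹).form ((q.elt⁻¹).1 x) = k * p.form x) ∧
      ∀ x, (p.translate q.elt⁻¹).form x = k * (p.form x + m * q.form x) := by
  set p' := p.translate q.elt⁻¹ with hp'
  let β : V →L[ℂ] ℂ := LinearMap.toContinuousLinearMap
    ((p'.form : V →ₗ[ℂ] ℂ).comp ((q.elt⁻¹).1 : V →ₗ[ℂ] V))
  have hβ : ∀ x, β x = p'.form ((q.elt⁻¹).1 x) := fun x => rfl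
  obtain ⟨k, hk⟩ := exists_smul_of_ker_le p.form_ne_zero (β := β) fun x hx => by
    rw [hβ, hp', form_translate_eq_zero_iff, coe_inv_apply_self, hx]
  have hk' : ∀ x, p'.form ((q.elt⁻¹).1 x) = k * p.form x := fun x => by
    rw [← hβ, hk]; rfl
  obtain ⟨ε, hε⟩ := exists_transvection_vector q.form_ne_zero (w := q.elt.1) fun v hv =>
    q.elt_fix hv
  refine ⟨k, p.form ε, ?_, hk', fun x => ?_⟩
  · rintro rfl
    refine p'.form_ne_zero (ContinuousLinearMap.ext fun x => ?_)
    have := hk' (q.elt.1 x)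
    rw [coe_inv_apply_self, zero_mul] at this
    exact this
  · have := hk' (q.elt.1 x)
    rw [coe_inv_apply_self, hε, map_add, map_smul, smul_eq_mul] at this
    rw [this]
    ring

namespace LineBundle.UnitaryGauge

variable {L : T.LineBundle} {G : L.UnitaryGauge}

theorem IsKernel.tendsto_residue {p : T.Pairs} {K : V → ℂ} (hK : G.IsKernel p K) {z e : V}
    (hz : p.form z ∈ p.poles) (he : p.form e ≠ 0) :
    Tendsto (fun t : ℂ => t * K (z + t • e)) (𝓝[≠] 0)
      (𝓝 (G.u (z - (p.elt⁻¹).1 z) / p.form e)) := by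
  obtain ⟨b, hb, hbz, hev⟩ := hK.residue z hz
  rw [← hbz]
  exact tendsto_mul_of_simple_pole hb.continuousAt he hev

variable [Fintype T.Pairs] [DecidableEq T.W] (C : T.Pairs → ℂ) (K : T.Pairs → V → ℂ)

/-- The coefficient of `w` in the commutator of two Dunkl operators. -/
noncomputable def commCoeff (w : T.W) (u v : V) (z : V) : ℂ :=
  ∑ x : T.Pairs × T.Pairs with x.1.elt * x.2.elt = w,
    C x.1 * C x.2 * (K x.1 z * K x.2 ((x.1.elt⁻¹).1 z)) *
      (x.1.form u * x.2.form v - x.1.form v * x.2.form u)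

variable {C K}

theorem analyticAt_kernel_comp (hK : ∀ p, G.IsKernel p (K p)) {p q : T.Pairs} {z : V}
    (hz : q.form ((p.elt⁻¹).1 z) ∉ q.poles) :
    AnalyticAt ℂ (fun z => K q ((p.elt⁻¹).1 z)) z :=
  ((hK q).analytic _ hz).comp (analytic_lin (p.elt⁻¹).1 z trivial)

theorem tendsto_line (z e : V) : Tendsto (fun t : ℂ => z + t • e) (𝓝[≠] 0) (𝓝 z) := by
  have : Continuous fun t : ℂ => z + t • e := by fun_prop
  have := this.tendsto 0
  simp only [zero_smul, add_zero] at this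
  exact this.mono_left nhdsWithin_le_nhds

open Classical in
/-- Residue of a term of the commutator along the poles of the first factor. -/
noncomputable def residueFst (G : L.UnitaryGauge) (C : T.Pairs → ℂ) (K : T.Pairs → V → ℂ)
    (u v z e : V) (p q : T.Pairs) : ℂ :=
  if p.form z ∈ p.poles then
    C p * C q * (G.u (z - (p.elt⁻¹).1 z) / p.form e * K q ((p.elt⁻¹).1 z)) *
      (p.form u * q.form v - p.form v * q.form u)
  else 0

open Classical in
/-- Residue of a term of the commutator along the poles of the second factor. -/
noncomputable def residueSnd (G : L.UnitaryGauge) (C : T.Pairs → ℂ) (K : T.Pairs → V → ℂ)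
    (u v z e : V) (p q : T.Pairs) : ℂ :=
  if q.form ((p.elt⁻¹).1 z) ∈ q.poles then
    C p * C q * (K p z * (G.u ((p.elt⁻¹).1 z - (q.elt⁻¹).1 ((p.elt⁻¹).1 z)) /
      q.form ((p.elt⁻¹).1 e))) * (p.form u * q.form v - p.form v * q.form u)
  else 0

/-- Both factors can be singular at `z` only if `H` and `g H'` both pass through it. Then `hpar`
makes their forms parallel and the wedge factor kills the term, so every surviving pole is simple.
-/
theorem tendsto_commutator_term (hK : ∀ p, G.IsKernel p (K p)) {z e : V}
    (hpar : ∀ p q : T.Pairs, p.form z ∈ p.poles → q.form z ∈ q.poles →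
      ∀ x y, p.form x * q.form y = p.form y * q.form x)
    (he : ∀ p : T.Pairs, p.form z ∈ p.poles → p.form e ≠ 0) (u v : V) (p q : T.Pairs) :
    Tendsto (fun t : ℂ => t * (C p * C q * (K p (z + t • e) * K q ((p.elt⁻¹).1 (z + t • e))) *
      (p.form u * q.form v - p.form v * q.form u))) (𝓝[≠] 0)
      (𝓝 (residueFst G C K u v z e p q + residueSnd G C K u v z e p q)) := by
  have hq' := Pairs.form_mem_poles_translate p.elt q z
  by_cases hp : p.form z ∈ p.poles
  · by_cases hq : q.form ((p.elt⁻¹).1 z) ∈ q.poles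
    · have h0 := Pairs.wedge_eq_zero_of_translate (hpar p _ hp (hq'.2 hq)) u v
      simp only [residueFst, residueSnd, h0, mul_zero, ite_self, add_zero]
      exact tendsto_const_nhds
    · have h1 := (hK p).tendsto_residue hp (he p hp)
      have h2 := (analyticAt_kernel_comp hK hq).continuousAt.tendsto.comp (tendsto_line z e)
      have h3 := (((h1.mul h2).const_mul (C p * C q)).mul_const
        (p.form u * q.form v - p.form v * q.form u))
      rw [residueFst, residueSnd, if_pos hp, if_neg hq, add_zero]
      refine h3.congr fun t => ?_
      simp only [Function.comp]
      ring
  · have h1 := ((hK p).analytic z hp).continuousAt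
    by_cases hq : q.form ((p.elt⁻¹).1 z) ∈ q.poles
    · have he' : q.form ((p.elt⁻¹).1 e) ≠ 0 := by
        rw [ne_eq, ← Pairs.form_translate_eq_zero_iff]
        exact he _ (hq'.2 hq)
      have h2 := (hK q).tendsto_residue hq he'
      have h3 := ((((h1.tendsto.comp (tendsto_line z e)).mul h2).const_mul (C p * C q)).mul_const
        (p.form u * q.form v - p.form v * q.form u))
      rw [residueFst, residueSnd, if_neg hp, if_pos hq, zero_add]
      refine h3.congr fun t => ?_
      simp only [Function.comp, map_add, map_smul]
      ring
    · rw [residueFst, residueSnd, if_neg hp, if_neg hq, zero_add]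
      refine tendsto_mul_of_continuousAt (K := fun z => C p * C q * (K p z *
        K q ((p.elt⁻¹).1 z)) * (p.form u * q.form v - p.form v * q.form u)) ?_ e
      exact (continuousAt_const.mul
        (h1.mul (analyticAt_kernel_comp hK hq).continuousAt)).mul continuousAt_const

/-- The factor `K_p (z)` in the term `(p, q)` and the factor `K_{p'} (g_q⁻¹ z)` in the term `(q,
p')`, with `p' = g_q⁻¹ p`, have the same polar locus. The form of `p'` is `k (α_p + m α_q)`, so its
wedge with `α_q` is `-k` times the original one, and `k` cancels against the denominator of the
residue. -/
theorem residueFst_eq_neg (hK : ∀ p, G.IsKernel p (K p)) (hC : IsInvariant C)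
    (u v z e : V) (p q : T.Pairs) :
    residueFst G C K u v z e p q = -residueSnd G C K u v z e q (p.translate q.elt⁻¹) := by
  have hiff := Pairs.form_mem_poles_translate q.elt (p.translate q.elt⁻¹) z
  rw [Pairs.translate_mul, mul_inv_cancel, Pairs.translate_one] at hiff
  rw [residueFst, residueSnd]
  by_cases hp : p.form z ∈ p.poles
  · rw [if_pos hp, if_pos (hiff.1 hp)]
    have hCp : C (p.translate q.elt⁻¹) = C p := hC q.elt⁻¹ p _ rfl rfl
    obtain ⟨k, m, hk, hk1, hk2⟩ := Pairs.exists_form_translate_inv p q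
    have hγ := p.sub_elt_inv_mem ((p.proj_mem_iff z).2 hp)
    set γ := z - (p.elt⁻¹).1 z with hγdef
    have hqγ := T.map_mem _ (q.elt⁻¹).2 γ hγ
    have helt : ((p.translate q.elt⁻¹).elt⁻¹).1 ((q.elt⁻¹).1 z) = (q.elt⁻¹).1 ((p.elt⁻¹).1 z) := by
      rw [Pairs.elt_translate]
      change (((q.elt⁻¹ * p.elt * q.elt⁻¹⁻¹)⁻¹ * q.elt⁻¹ : T.W)).1 z =
        ((q.elt⁻¹ * p.elt⁻¹ : T.W)).1 z
      congr 2
      group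
    -- On the polar locus `z` and `g_p⁻¹ z` differ by the lattice vector `γ`; quasi-periodicity of
    -- `K_q` compares its values at the two points.
    have hper := (hK q).periodic γ hγ ((p.elt⁻¹).1 z)
    rw [show (p.elt⁻¹).1 z + γ = z by rw [hγdef]; abel, G.u_sub hγ hqγ] at hper
    have hu : G.u γ * K q ((p.elt⁻¹).1 z) = K q z * G.u ((q.elt⁻¹).1 γ) := by
      rw [hper]
      have := G.u_ne_zero hqγ
      field_simp
    rw [hCp, helt, ← map_sub, ← hγdef, hk1, hk2, hk2, div_mul_eq_mul_div, hu]
    -- If `p.form e = 0`, both denominators are zero and so, by convention, are both sides.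
    by_cases he : p.form e = 0
    · simp [he]
    · field_simp
      ring
  · rw [if_neg hp, if_neg fun h => hp (hiff.2 h), neg_zero]

theorem tendsto_commCoeff (hK : ∀ p, G.IsKernel p (K p)) (hC : IsInvariant C) {z e : V}
    (hpar : ∀ p q : T.Pairs, p.form z ∈ p.poles → q.form z ∈ q.poles →
      ∀ x y, p.form x * q.form y = p.form y * q.form x)
    (he : ∀ p : T.Pairs, p.form z ∈ p.poles → p.form e ≠ 0) (w : T.W) (u v : V) :
    Tendsto (fun t : ℂ => t * commCoeff C K w u v (z + t • e)) (𝓝[≠] 0) (𝓝 0) := by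
  have hsum := tendsto_finsetSum
    (Finset.univ.filter fun x : T.Pairs × T.Pairs => x.1.elt * x.2.elt = w)
    fun x _ => tendsto_commutator_term (C := C) hK hpar he u v x.1 x.2
  have hzero : ∑ x : T.Pairs × T.Pairs with x.1.elt * x.2.elt = w,
      (residueFst G C K u v z e x.1 x.2 + residueSnd G C K u v z e x.1 x.2) = 0 := by
    rw [Finset.sum_add_distrib, add_eq_zero_iff_eq_neg, ← Finset.sum_neg_distrib]
    -- The pairing preserves the product: `g_q (g_q⁻¹ g_p g_q) = g_p g_q`.
    refine Finset.sum_nbij' (fun x => (x.2, x.1.translate x.2.elt⁻¹))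
      (fun x => (x.2.translate x.1.elt, x.1)) ?_ ?_ ?_ ?_ ?_
    · rintro ⟨p, q⟩ h
      simp only [Finset.mem_filter, Finset.mem_univ, true_and] at h ⊢
      rw [← h, Pairs.elt_translate]
      group
    · rintro ⟨p, q⟩ h
      simp only [Finset.mem_filter, Finset.mem_univ, true_and] at h ⊢
      rw [← h, Pairs.elt_translate]
      group
    · rintro ⟨p, q⟩ _
      simp only [Pairs.translate_mul, mul_inv_cancel, Pairs.translate_one]
    · rintro ⟨p, q⟩ _
      simp only [Pairs.translate_mul, inv_mul_cancel, Pairs.translate_one]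
    · rintro ⟨p, q⟩ _
      exact residueFst_eq_neg hK hC u v z e p q
  rw [hzero] at hsum
  refine hsum.congr fun t => ?_
  rw [commCoeff, Finset.mul_sum]

/-- For `w = 1` every wedge vanishes. For `w ≠ 1` the multipliers of the two kernels in each term
combine to `u (γ - w⁻¹ γ)`, nontrivial by `exists_u_ne_one`, and the residues cancel by
`tendsto_commCoeff`. -/
theorem commCoeff_eq_zero (hL : L.HasTrivialStabilizer) (hK : ∀ p, G.IsKernel p (K p))
    (hC : IsInvariant C) (w : T.W) (u v : V) {z : V} (hz : ∀ p : T.Pairs, p.form z ∉ p.poles) :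
    commCoeff C K w u v z = 0 := by
  by_cases hw : w = 1
  · refine Finset.sum_eq_zero fun x hx => ?_
    simp only [Finset.mem_filter, Finset.mem_univ, true_and, hw] at hx
    rw [Pairs.wedge_eq_zero_of_mul_eq_one hx, mul_zero]
  obtain ⟨γ₀, hγ₀, hne⟩ := G.exists_u_ne_one hL hw
  refine eq_zero_of_multipliers (ι := T.Pairs) (α := Pairs.form) (S := Pairs.poles) T
    Pairs.form_ne_zero Pairs.countable_poles Pairs.eventually_notMem_poles ?_
    (fun z e hpar he => tendsto_commCoeff hK hC hpar he w u v)
    (fun γ z hz p => by rw [p.add_mem_poles_iff]; exact hz p)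
    (fun γ => G.u (γ - (w⁻¹).1 γ))
    (fun γ => G.norm_u _ (T.Γ.sub_mem γ.2 (T.map_mem _ (w⁻¹).2 γ γ.2))) ?_
    (γ₀ := ⟨γ₀, hγ₀⟩) hne hz
  · intro z hz
    refine DifferentiableAt.fun_sum fun x _ => ?_
    have h1 := ((hK x.1).analytic z (hz x.1)).differentiableAt
    have h2 := (analyticAt_kernel_comp hK (p := x.1) (q := x.2) (z := z) (by
      rw [← Pairs.form_mem_poles_translate]; exact hz _)).differentiableAt
    exact ((h1.mul h2).const_mul _).mul_const _
  · intro γ z _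
    rw [commCoeff, commCoeff, Finset.mul_sum]
    refine Finset.sum_congr rfl fun x hx => ?_
    simp only [Finset.mem_filter, Finset.mem_univ, true_and] at hx
    have hpγ := T.map_mem _ (x.1.elt⁻¹).2 γ γ.2
    have hqγ := T.map_mem _ (x.2.elt⁻¹).2 _ hpγ
    have hwinv : (w⁻¹).1 (γ : V) = (x.2.elt⁻¹).1 ((x.1.elt⁻¹).1 γ) := by
      rw [← hx, mul_inv_rev]
      rfl
    rw [map_add, (hK x.1).periodic γ γ.2, (hK x.2).periodic _ hpγ, hwinv, G.u_sub γ.2 hqγ,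
      G.u_sub γ.2 hpγ, G.u_sub hpγ hqγ]
    have := G.u_ne_zero hpγ
    have := G.u_ne_zero hqγ
    field_simp

end LineBundle.UnitaryGauge

end TorusAction
namespace TorusAction.LineBundle

open TorusAction

variable {V : Type*} [NormedAddCommGroup V] [NormedSpace ℂ V] [FiniteDimensional ℂ V]
  {T : TorusAction V} {L : T.LineBundle}

/-! ### The Dunkl operators on representatives -/

section gauged

variable [Fintype T.Pairs]

/-- The Dunkl operator on functions representing sections of `L`. -/
noncomputable def dunklFun (L : T.LineBundle) (conn : L.FlatConnection) (C : T.Pairs → ℂ) (v : V)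
    (s : V → ℂ) (z : V) : ℂ :=
  fderiv ℂ s z v + conn.form z v * s z -
    ∑ p : T.Pairs, C p * (L.dunklSection p z v * s ((p.elt⁻¹).1 z))

theorem exists_dunklOperator_mk (conn : L.FlatConnection) (C : T.Pairs → ℂ) (U : T.InvariantOpen)
    (v : V) (s : L.representatives U) : ∃ t : L.representatives U,
      L.dunklOperator conn C U v (Submodule.Quotient.mk s) = Submodule.Quotient.mk t ∧
        t.1 = L.dunklFun conn C v s.1 := by
  have hn : ∃ t : L.representatives U,
      conn.nabla U v (Submodule.Quotient.mk s) = Submodule.Quotient.mk t ∧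
        t.1 = fun z => fderiv ℂ s.1 z v + conn.form z v * s.1 z := ⟨⟨_, _⟩, rfl, rfl⟩
  have hm : ∀ p : T.Pairs, ∃ t : L.representatives U,
      (mulBy (fun z => L.dunklSection p z v) (L.dunklSection_mem p U v) ∘ₗ L.act U p.elt)
        (Submodule.Quotient.mk s) = Submodule.Quotient.mk t ∧
        t.1 = fun z => L.dunklSection p z v * s.1 ((p.elt⁻¹).1 z) := fun p => ⟨⟨_, _⟩, rfl, rfl⟩
  obtain ⟨n, hn, hn'⟩ := hn
  choose m hm hm' using hm
  refine ⟨n - ∑ p, C p • m p, ?_, ?_⟩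
  · rw [dunklOperator, finsum_eq_sum_of_fintype, LinearMap.sub_apply, hn, LinearMap.sum_apply]
    simp only [LinearMap.smul_apply, hm]
    rw [← Submodule.mkQ_apply, ← Submodule.mkQ_apply, map_sub, map_sum]
    simp only [map_smul, Submodule.mkQ_apply]
  · funext z
    rw [dunklFun, Submodule.coe_sub, Pi.sub_apply, hn', Submodule.coe_sum, Finset.sum_apply]
    simp only [Submodule.coe_smul, Pi.smul_apply, hm', smul_eq_mul]

/-- The Dunkl operator in a unitary gauge. -/
noncomputable def gaugedDunkl (c : V →L[ℂ] ℂ) (C : T.Pairs → ℂ) (K : T.Pairs → V → ℂ) (v : V)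
    (σ : V → ℂ) (z : V) : ℂ :=
  fderiv ℂ σ z v + c v * σ z -
    ∑ p : T.Pairs, C p * (K p z * p.form v * σ ((p.elt⁻¹).1 z))

/-- Conjugation by `φ`: the differential equation of `φ` turns `∇_v` into `∂_v + c(v)`, and the
factor `φ / (φ ∘ g⁻¹)` of `f_{H,j}` compensates for the action of `g` on `φ`. -/
theorem dunklFun_eq_gauged (hL : L.HasTrivialStabilizer) {conn : L.FlatConnection}
    {G : L.UnitaryGauge} (hG : ∀ z v, fderiv ℂ G.φ z v = (G.c v - conn.form z v) * G.φ z)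
    {C : T.Pairs → ℂ} {K : T.Pairs → V → ℂ} (hK : ∀ p, G.IsKernel p (K p)) {E : Set V}
    (hE : IsOpen E) (hEW : ∀ (w : T.W), ∀ z ∈ E, w.1 z ∈ E) {s σ : V → ℂ}
    (hs : ∀ z ∈ E, s z = G.φ z * σ z) (hσ : ∀ z ∈ E, DifferentiableAt ℂ σ z) (v : V) :
    ∀ z ∈ E, L.dunklFun conn C v s z = G.φ z * gaugedDunkl G.c C K v σ z := by
  intro z hz
  have h1 : s =ᶠ[𝓝 z] fun z => G.φ z * σ z := by
    filter_upwards [hE.mem_nhds hz] with y hy using hs y hy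
  rw [dunklFun, gaugedDunkl, h1.fderiv_eq,
    fderiv_fun_mul (G.analytic z).differentiableAt (hσ z hz), hs z hz, mul_sub, Finset.mul_sum]
  congr 1
  · simp only [add_apply, smul_apply, smul_eq_mul, hG]
    ring
  · refine Finset.sum_congr rfl fun p _ => ?_
    rw [(hK p).dunklSection_eq hL, hs _ (hEW p.elt⁻¹ z hz)]
    have := G.ne_zero ((p.elt⁻¹).1 z)
    simp only [smul_apply, smul_eq_mul]
    field_simp

omit [Fintype T.Pairs] in
-- `K` is constant along `ker p.form`, so its differential is a multiple of `p.form`.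
theorem UnitaryGauge.IsKernel.exists_fderiv {G : L.UnitaryGauge} {p : T.Pairs} {K : V → ℂ}
    (hK : G.IsKernel p K) {z : V} (hz : p.form z ∉ p.poles) :
    ∃ k : ℂ, ∀ v, fderiv ℂ K z v = k * p.form v := by
  obtain ⟨k, hk⟩ := exists_smul_of_ker_le p.form_ne_zero (β := fderiv ℂ K z) fun v hv => by
    have hd := (hK.analytic z hz).differentiableAt
    have h1 : HasDerivAt (fun t : ℂ => z + t • v) v 0 := by
      simpa using ((hasDerivAt_id (0 : ℂ)).smul_const v).const_add z
    have h2 : HasDerivAt (fun t : ℂ => K (z + t • v)) (fderiv ℂ K z v) 0 :=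
      HasFDerivAt.comp_hasDerivAt (f := fun t : ℂ => z + t • v) 0
        (by simpa using hd.hasFDerivAt) h1
    have h3 : (fun t : ℂ => K (z + t • v)) = fun _ => K z := by
      funext t
      exact hK.add_of_form_eq_zero z _ (by rw [map_smul, hv, smul_zero])
    rw [h3] at h2
    exact h2.unique (hasDerivAt_const _ _)
  exact ⟨k, fun v => by rw [hk]; rfl⟩

theorem differentiableAt_and_fderiv_gaugedDunkl {G : L.UnitaryGauge} (c : V →L[ℂ] ℂ)
    {C : T.Pairs → ℂ} {K : T.Pairs → V → ℂ} (hK : ∀ p, G.IsKernel p (K p)) {σ : V → ℂ} {z : V}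
    (hz : ∀ p : T.Pairs, p.form z ∉ p.poles) (hσ : ∀ w : T.W, AnalyticAt ℂ σ (w.1 z)) (u v : V) :
    DifferentiableAt ℂ (gaugedDunkl c C K u σ) z ∧
    fderiv ℂ (gaugedDunkl c C K u σ) z v = fderiv ℂ (fderiv ℂ σ) z v u + c u * fderiv ℂ σ z v -
      ∑ p : T.Pairs, C p * p.form u * (fderiv ℂ (K p) z v * σ ((p.elt⁻¹).1 z) +
        K p z * fderiv ℂ σ ((p.elt⁻¹).1 z) ((p.elt⁻¹).1 v)) := by
  have hσz : AnalyticAt ℂ σ z := hσ 1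
  have h1 : HasFDerivAt (fun z => fderiv ℂ σ z u)
      ((ContinuousLinearMap.apply ℂ ℂ u).comp (fderiv ℂ (fderiv ℂ σ) z)) z :=
    (ContinuousLinearMap.apply ℂ ℂ u).hasFDerivAt.comp z hσz.fderiv.differentiableAt.hasFDerivAt
  have h2 : HasFDerivAt (fun z => c u * σ z) (c u • fderiv ℂ σ z) z :=
    hσz.differentiableAt.hasFDerivAt.const_mul _
  have h3 : ∀ p : T.Pairs, HasFDerivAt
      (fun z => C p * (K p z * p.form u * σ ((p.elt⁻¹).1 z)))
      (C p • ((K p z * p.form u) • ((fderiv ℂ σ ((p.elt⁻¹).1 z)).comp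
        ((p.elt⁻¹).1.toContinuousLinearEquiv : V →L[ℂ] V)) +
        σ ((p.elt⁻¹).1 z) • (p.form u • fderiv ℂ (K p) z))) z := fun p => by
    have ha : HasFDerivAt (fun z => σ ((p.elt⁻¹).1 z)) ((fderiv ℂ σ ((p.elt⁻¹).1 z)).comp
        ((p.elt⁻¹).1.toContinuousLinearEquiv : V →L[ℂ] V)) z :=
      HasFDerivAt.comp z (hσ p.elt⁻¹).differentiableAt.hasFDerivAt
        ((p.elt⁻¹).1.toContinuousLinearEquiv : V →L[ℂ] V).hasFDerivAt
    exact ((((hK p).analytic z (hz p)).differentiableAt.hasFDerivAt.mul_const _).mul ha).const_mul _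
  have h := (h1.add h2).sub (HasFDerivAt.fun_sum (u := Finset.univ) fun p _ => h3 p)
  refine ⟨h.differentiableAt, ?_⟩
  rw [show gaugedDunkl c C K u σ = _ from rfl, HasFDerivAt.fderiv (f := gaugedDunkl c C K u σ) h]
  simp only [sub_apply, add_apply, ContinuousLinearMap.comp_apply, smul_apply, smul_eq_mul,
    ContinuousLinearMap.apply_apply, sum_apply]
  congr 1
  refine Finset.sum_congr rfl fun p _ => ?_
  have : ((p.elt⁻¹).1.toContinuousLinearEquiv : V →L[ℂ] V) v = (p.elt⁻¹).1 v := rfl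
  rw [this]
  ring

/-- Terms with the same product `w` share the factor `σ (w⁻¹ z)`, and their coefficients add up to
`commCoeff`. -/
theorem sum_commutator_eq_zero (hL : L.HasTrivialStabilizer) {G : L.UnitaryGauge}
    {C : T.Pairs → ℂ} (hC : IsInvariant C) {K : T.Pairs → V → ℂ} (hK : ∀ p, G.IsKernel p (K p))
    {z : V} (hz : ∀ p : T.Pairs, p.form z ∉ p.poles) (σ : V → ℂ) (u v : V) :
    ∑ p : T.Pairs, ∑ q : T.Pairs, C p * C q * (K p z * K q ((p.elt⁻¹).1 z)) *
      (p.form u * q.form v - p.form v * q.form u) * σ ((q.elt⁻¹).1 ((p.elt⁻¹).1 z)) = 0 := by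
  classical
  have := Fintype.ofFinite T.W
  rw [← Fintype.sum_prod_type' (f := fun p q : T.Pairs => C p * C q *
    (K p z * K q ((p.elt⁻¹).1 z)) * (p.form u * q.form v - p.form v * q.form u) *
      σ ((q.elt⁻¹).1 ((p.elt⁻¹).1 z))),
    ← Finset.sum_fiberwise Finset.univ fun x : T.Pairs × T.Pairs => x.1.elt * x.2.elt]
  refine Finset.sum_eq_zero fun w _ => ?_
  have h := UnitaryGauge.commCoeff_eq_zero hL hK hC w u v hz
  rw [UnitaryGauge.commCoeff] at h
  rw [← zero_mul (σ ((w⁻¹).1 z)), ← h, Finset.sum_mul]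
  refine Finset.sum_congr rfl fun x hx => ?_
  simp only [Finset.mem_filter, Finset.mem_univ, true_and] at hx
  rw [← hx, mul_inv_rev]
  rfl

theorem gaugedDunkl_comm (hL : L.HasTrivialStabilizer) {G : L.UnitaryGauge} (c : V →L[ℂ] ℂ)
    {C : T.Pairs → ℂ} (hC : IsInvariant C) {K : T.Pairs → V → ℂ} (hK : ∀ p, G.IsKernel p (K p))
    {σ : V → ℂ} {z : V} (hz : ∀ p : T.Pairs, p.form z ∉ p.poles)
    (hσ : ∀ w : T.W, AnalyticAt ℂ σ (w.1 z)) (u v : V) :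
    gaugedDunkl c C K v (gaugedDunkl c C K u σ) z =
      gaugedDunkl c C K u (gaugedDunkl c C K v σ) z := by
  have hσz : AnalyticAt ℂ σ z := hσ 1
  have hsymm : fderiv ℂ (fderiv ℂ σ) z v u = fderiv ℂ (fderiv ℂ σ) z u v :=
    (hσz.contDiffAt (n := ⊤)).isSymmSndFDerivAt (by simp) v u
  -- The composite is split by the number of group elements involved: zero, one or two.
  have hexp : ∀ u v, gaugedDunkl c C K v (gaugedDunkl c C K u σ) z =
      fderiv ℂ (fderiv ℂ σ) z v u + c u * fderiv ℂ σ z v + c v * fderiv ℂ σ z u + c v * c u * σ z -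
        ∑ p : T.Pairs, C p * (p.form u * (fderiv ℂ (K p) z v * σ ((p.elt⁻¹).1 z) +
          K p z * fderiv ℂ σ ((p.elt⁻¹).1 z) ((p.elt⁻¹).1 v)) +
          c v * (K p z * p.form u * σ ((p.elt⁻¹).1 z)) + K p z * p.form v *
            (fderiv ℂ σ ((p.elt⁻¹).1 z) u + c u * σ ((p.elt⁻¹).1 z))) +
        ∑ p : T.Pairs, ∑ q : T.Pairs, C p * C q * (K p z * K q ((p.elt⁻¹).1 z)) *
          (p.form v * q.form u) * σ ((q.elt⁻¹).1 ((p.elt⁻¹).1 z)) := by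
    intro u v
    rw [gaugedDunkl, (differentiableAt_and_fderiv_gaugedDunkl c hK hz hσ u v).2]
    simp only [gaugedDunkl]
    have h2 : ∀ p : T.Pairs, C p * (K p z * p.form v *
        (fderiv ℂ σ ((p.elt⁻¹).1 z) u + c u * σ ((p.elt⁻¹).1 z) -
          ∑ q : T.Pairs, C q * (K q ((p.elt⁻¹).1 z) * q.form u *
            σ ((q.elt⁻¹).1 ((p.elt⁻¹).1 z))))) =
        C p * (K p z * p.form v * (fderiv ℂ σ ((p.elt⁻¹).1 z) u + c u * σ ((p.elt⁻¹).1 z))) -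
          ∑ q : T.Pairs, C p * C q * (K p z * K q ((p.elt⁻¹).1 z)) *
          (p.form v * q.form u) * σ ((q.elt⁻¹).1 ((p.elt⁻¹).1 z)) := by
      intro p
      rw [mul_sub, mul_sub, Finset.mul_sum, Finset.mul_sum]
      refine congrArg _ (Finset.sum_congr rfl fun q _ => ?_)
      ring
    simp only [h2]
    have h3 : c v * (fderiv ℂ σ z u + c u * σ z -
        ∑ p : T.Pairs, C p * (K p z * p.form u * σ ((p.elt⁻¹).1 z))) =
        c v * (fderiv ℂ σ z u + c u * σ z) -
          ∑ p : T.Pairs, c v * (C p * (K p z * p.form u * σ ((p.elt⁻¹).1 z))) := by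
      rw [mul_sub, Finset.mul_sum]
    have h4 : ∀ p : T.Pairs, C p * (p.form u * (fderiv ℂ (K p) z v * σ ((p.elt⁻¹).1 z) +
          K p z * fderiv ℂ σ ((p.elt⁻¹).1 z) ((p.elt⁻¹).1 v)) +
          c v * (K p z * p.form u * σ ((p.elt⁻¹).1 z)) + K p z * p.form v *
            (fderiv ℂ σ ((p.elt⁻¹).1 z) u + c u * σ ((p.elt⁻¹).1 z))) =
        C p * p.form u * (fderiv ℂ (K p) z v * σ ((p.elt⁻¹).1 z) +
          K p z * fderiv ℂ σ ((p.elt⁻¹).1 z) ((p.elt⁻¹).1 v)) +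
        c v * (C p * (K p z * p.form u * σ ((p.elt⁻¹).1 z))) +
        C p * (K p z * p.form v *
          (fderiv ℂ σ ((p.elt⁻¹).1 z) u + c u * σ ((p.elt⁻¹).1 z))) := fun p => by ring
    simp only [h3, h4, Finset.sum_add_distrib, Finset.sum_sub_distrib]
    ring
  -- Each term with one group element is symmetric in `u` and `v`: `dK` is proportional to `α`, and
  -- the deviation of `g⁻¹ v` from `v` is `-α(v) ε`, which contributes a multiple of the symmetric
  -- product `α(u) α(v)`.
  have hfirst : ∀ p : T.Pairs,
      C p * (p.form u * (fderiv ℂ (K p) z v * σ ((p.elt⁻¹).1 z) +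
          K p z * fderiv ℂ σ ((p.elt⁻¹).1 z) ((p.elt⁻¹).1 v)) +
          c v * (K p z * p.form u * σ ((p.elt⁻¹).1 z)) + K p z * p.form v *
            (fderiv ℂ σ ((p.elt⁻¹).1 z) u + c u * σ ((p.elt⁻¹).1 z))) =
      C p * (p.form v * (fderiv ℂ (K p) z u * σ ((p.elt⁻¹).1 z) +
          K p z * fderiv ℂ σ ((p.elt⁻¹).1 z) ((p.elt⁻¹).1 u)) +
          c u * (K p z * p.form v * σ ((p.elt⁻¹).1 z)) + K p z * p.form u *
            (fderiv ℂ σ ((p.elt⁻¹).1 z) v + c v * σ ((p.elt⁻¹).1 z))) := by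
    intro p
    obtain ⟨k, hk⟩ := (hK p).exists_fderiv (hz p)
    rw [hk, hk, p.elt_inv_apply u, p.elt_inv_apply v]
    simp only [map_sub, map_smul, smul_eq_mul]
    ring
  have hquad := sum_commutator_eq_zero hL hC hK hz σ u v
  have hquad' : ∑ p : T.Pairs, ∑ q : T.Pairs, C p * C q * (K p z * K q ((p.elt⁻¹).1 z)) *
          (p.form v * q.form u) * σ ((q.elt⁻¹).1 ((p.elt⁻¹).1 z)) =
      ∑ p : T.Pairs, ∑ q : T.Pairs, C p * C q * (K p z * K q ((p.elt⁻¹).1 z)) *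
          (p.form u * q.form v) * σ ((q.elt⁻¹).1 ((p.elt⁻¹).1 z)) := by
    rw [← sub_eq_zero, ← neg_eq_zero, neg_sub, ← Finset.sum_sub_distrib, ← hquad]
    refine Finset.sum_congr rfl fun p _ => ?_
    rw [← Finset.sum_sub_distrib]
    refine Finset.sum_congr rfl fun q _ => ?_
    ring
  rw [hexp u v, hexp v u, Finset.sum_congr rfl fun p _ => hfirst p, hquad', hsymm]
  ring

theorem dunklFun_comm (hL : L.HasTrivialStabilizer) (conn : L.FlatConnection)
    {C : T.Pairs → ℂ} (hC : IsInvariant C) {s : V → ℂ} {E : Set V} (hE : IsOpen E)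
    (hEW : ∀ (w : T.W), ∀ z ∈ E, w.1 z ∈ E) (hs : ∀ z ∈ E, AnalyticAt ℂ s z)
    (hEp : ∀ z ∈ E, ∀ p : T.Pairs, T.proj z ∉ p.H) (u v : V) :
    ∀ z ∈ E, L.dunklFun conn C v (L.dunklFun conn C u s) z =
      L.dunklFun conn C u (L.dunklFun conn C v s) z := by
  obtain ⟨G, hG⟩ := L.exists_unitaryGauge conn
  choose K hK using G.exists_isKernel hL
  have hz : ∀ z ∈ E, ∀ p : T.Pairs, p.form z ∉ p.poles := fun z hz p h =>
    hEp z hz p ((p.proj_mem_iff z).2 h)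
  let σ : V → ℂ := fun z => s z / G.φ z
  have hσ : ∀ z ∈ E, AnalyticAt ℂ σ z := fun z hz => (hs z hz).div (G.analytic z) (G.ne_zero z)
  have hsσ : ∀ z ∈ E, s z = G.φ z * σ z := fun z _ => (mul_div_cancel₀ _ (G.ne_zero z)).symm
  have h1 := fun v => dunklFun_eq_gauged (C := C) hL hG hK hE hEW hsσ
    (fun z hz => (hσ z hz).differentiableAt) v
  have h2 := fun u v => dunklFun_eq_gauged (C := C) hL hG hK hE hEW (h1 u) (fun z hzE =>
    (differentiableAt_and_fderiv_gaugedDunkl G.c hK (hz z hzE) (fun w => hσ _ (hEW w z hzE)) u v).1) v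
  intro z hzE
  rw [h2 u v z hzE, h2 v u z hzE,
    gaugedDunkl_comm hL G.c hC hK (hz z hzE) (fun w => hσ _ (hEW w z hzE)) u v]

end gauged

/-! ### Passage from functions to meromorphic sections. -/

/-- A meromorphic function is analytic on a dense open `W`-invariant set avoiding all hypertori. -/
theorem exists_dense_invariant (U : T.InvariantOpen) {s : V → ℂ} (hs : IsMero U.lift s) :
    ∃ E : Set V, IsOpen E ∧ E ⊆ U.lift ∧ U.lift ⊆ closure E ∧ (∀ (w : T.W), ∀ z ∈ E, w.1 z ∈ E) ∧
      (∀ z ∈ E, AnalyticAt ℂ s z) ∧ ∀ z ∈ E, ∀ p : T.Pairs, T.proj z ∉ p.H := by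
  have : CompleteSpace V := FiniteDimensional.complete ℂ V
  -- Adding the exterior of `U.lift` makes `A` dense in all of `V`, so that its translates under `W`
  -- can be intersected by Baire category.
  set A : Set V := {z | AnalyticAt ℂ s z} ∪ (closure U.lift)ᶜ with hA
  have hAo : IsOpen A := (isOpen_analyticAt ℂ s).union isClosed_closure.isOpen_compl
  have hAd : Dense A := by
    have h1 : closure U.lift ⊆ closure A :=
      closure_minimal ((hs.genDifferentiable U.isOpen_lift).trans
        (closure_mono fun z hz => Or.inl hz.2)) isClosed_closure
    intro z
    by_cases hz : z ∈ closure U.lift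
    · exact h1 hz
    · exact subset_closure (Or.inr hz)
  have hEo : IsOpen (U.lift ∩ {z | (∀ w : T.W, w.1 z ∈ A) ∧ ∀ p : T.Pairs, p.form z ∉ p.poles}) := by
    refine U.isOpen_lift.inter (IsOpen.inter ?_
      (isOpen_forall_notMem Pairs.eventually_notMem_poles))
    change IsOpen {z | ∀ w : T.W, w.1 z ∈ A}
    rw [Set.ofPred_forall]
    exact isOpen_iInter_of_finite fun w => hAo.preimage (continuous_lin w.1)
  refine ⟨_, hEo, Set.inter_subset_left, ?_, ?_, ?_, ?_⟩
  · have hres : ∀ᶠ z in residual V,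
        (∀ w : T.W, w.1 z ∈ A) ∧ ∀ p : T.Pairs, p.form z ∉ p.poles := by
      refine (eventually_countable_forall.2 fun w => ?_).and
        (eventually_countable_forall.2 fun p =>
          eventually_residual_notMem p.form_ne_zero p.countable_poles)
      refine residual_of_dense_open (hAo.preimage (continuous_lin w.1)) ?_
      exact hAd.preimage (homeo w.1).isOpenMap
    exact (dense_of_mem_residual hres).open_subset_closure_inter U.isOpen_lift
  · rintro w z ⟨hzU, hzA, hzp⟩
    refine ⟨(U.act_mem_lift w z).2 hzU, fun w' => hzA (w' * w), fun p hp => ?_⟩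
    rw [← p.proj_mem_iff] at hp
    have h := (Pairs.proj_mem_translate w⁻¹ p z).2 (by rw [inv_inv]; exact hp)
    rw [Pairs.proj_mem_iff] at h
    exact hzp _ h
  · rintro z ⟨hzU, hzA, -⟩
    rcases hzA 1 with h | h
    · exact h
    · exact absurd (subset_closure hzU) h
  · rintro z ⟨-, -, hzp⟩ p hp
    exact hzp p ((p.proj_mem_iff z).1 hp)

theorem dunklOperator_comm (hL : L.HasTrivialStabilizer) (conn : L.FlatConnection)
    {C : T.Pairs → ℂ} (hC : IsInvariant C) (U : T.InvariantOpen) (v u : V) :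
    ⁅L.dunklOperator conn C U v, L.dunklOperator conn C U u⁆ = 0 := by
  have := Fintype.ofFinite T.Pairs
  refine LinearMap.ext fun x => ?_
  induction x using Submodule.Quotient.induction_on with
  | H s =>
    obtain ⟨tu, htu, htu'⟩ := exists_dunklOperator_mk conn C U u s
    obtain ⟨tv, htv, htv'⟩ := exists_dunklOperator_mk conn C U v s
    obtain ⟨tvu, htvu, htvu'⟩ := exists_dunklOperator_mk conn C U v tu
    obtain ⟨tuv, htuv, htuv'⟩ := exists_dunklOperator_mk conn C U u tv
    rw [LieRing.of_associative_ring_bracket, LinearMap.sub_apply, Module.End.mul_apply,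
      Module.End.mul_apply, htu, htv, htvu, htuv, LinearMap.zero_apply, sub_eq_zero, mk_eq_iff]
    -- Meromorphic sections agree once they agree on a dense open set; `E` must be `W`-invariant
    -- because the operators evaluate `s` at all points `w z`.
    obtain ⟨E, hEo, hEU, hUE, hEW, hEs, hEp⟩ := exists_dense_invariant U s.2.1
    refine ⟨E, hEo, hEU, hUE, fun z hz => ?_⟩
    rw [htvu', htuv', htu', htv']
    exact dunklFun_comm hL conn hC hEo hEW hEs hEp u v z hz

end TorusAction.LineBundle
end EllipticDunkl

theorem theorem4p1 {V : Type*} [NormedAddCommGroup V] [NormedSpace ℂ V] [FiniteDimensional ℂ V]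
    (T : EllipticDunkl.TorusAction V) (L : T.LineBundle) (hL : L.IsTopologicallyTrivial)
    (hstab : L.HasTrivialStabilizer) (conn : L.FlatConnection)
    (C : T.Pairs → ℂ) (hC : EllipticDunkl.TorusAction.IsInvariant C) :
    (∀ p : T.Pairs, ∃! f : V → (V →L[ℂ] ℂ), L.IsDunklSection p f) ∧
      ∀ (U : T.InvariantOpen) (v u : V),
        ⁅L.dunklOperator conn C U v, L.dunklOperator conn C U u⁆ = 0 := by
  obtain ⟨G, -⟩ := L.exists_unitaryGauge conn
  exact ⟨G.existsUnique_isDunklSection hstab, L.dunklOperator_comm hstab conn hC⟩
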